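/- **Setting.** Let $\Delta$ be a Dynkin diagram of type $\mathsf{A}_n$ ($n\ge 1$), $\mathsf{D}_n$ ($n\ge 4$), $\mathsf{E}_6$, $\mathsf{E}_7$ or $\mathsf{E}_8$, with vertex set $\Delta_0$; write $i\sim j$ if $i,j$ are adjacent. Let $\sigma$ be an automorphism of $\Delta$ such that $i\not\sim\sigma(i)$ for every $i\in\Delta_0$, let $r\in\{1,2,3\}$ be its order, $d_i$ the size of the $\sigma$-orbit of $i$, and $n_\sigma$ the number of $\sigma$-orbits. Let $\mathfrak g$ be the simple Lie algebra attached to $(\Delta,\sigma)$, and $h^\vee$ its dual Coxeter number: for $\sigma=\mathrm{id}$, $\mathfrak g$ has the type of $\Delta$ and $h^\vee=n+1,\ 2n-2,\ 12,\ 18,\ 30$ for $\mathsf{A}_n,\mathsf{D}_n,\mathsf{E}_6,\mathsf{E}_7,\mathsf{E}_8$; for $r=2$ and $\Delta=\mathsf{A}_{2m-1},\mathsf{D}_{m+1},\mathsf{E}_6$, $\mathfrak g=\mathsf{B}_m,\mathsf{C}_m,\mathsf{F}_4$ and $h^\vee=2m-1,\ m+1,\ 9$; for $r=3$, $\Delta=\mathsf{D}_4$,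 $\mathfrak g=\mathsf{G}_2$ and $h^\vee=4$. Let $\mathsf W$ be the Weyl group of $\Delta$, with simple roots $\alpha_i$, simple reflections $s_i$, set of positive roots $\mathsf R^+$ and longest element $w_0$; put $N=|\mathsf R^+|$, and let $i\mapsto i^*$ be the involution of $\Delta_0$ with $w_0\alpha_i=-\alpha_{i^*}$. *Commutation classes.* Two sequences in $\Delta_0$ are commutation equivalent if one is obtained from the other by repeatedly exchanging adjacent entries $(i,j)$ with $i\not\sim j$; the class of $\boldsymbol i$ is $[\boldsymbol i]$. For a reduced word $\boldsymbol i=(i_1,\dots,i_N)$ of $w_0$ put $\beta_k=s_{i_1}\cdots s_{i_{k-1}}\alpha_{i_k}$ and $\operatorname{res}(\beta_k)=i_k$; the quiver $\Upsilon_{\boldsymbol i}$ has vertex set $\mathsf R^+$ and an arrow $\beta_k\to\beta_j$ if and only if $j<k$, $i_j\sim i_k$ and no $l$ with $j<l<k$ has $i_l\in\{i_j,i_k\}$. These depend only on $[\boldsymbol i]$, and are written $\operatorname{res}^{[\boldsymbol i]}$ and $\Upsilon_{[\boldsymbol i]}$. Put $r_{i_1}[\boldsymbol i]=[(i_2,\dots,i_N,i_1^*)]$.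 An $r$-cluster point is an equivalence class, for the equivalence relation generated by $c\sim r_ic$, of commutation classes of reduced words of $w_0$. The *$\sigma$-adapted $r$-cluster point* $[\![\Delta^\sigma]\!]$ is, for $\sigma\ne\mathrm{id}$, the unique $r$-cluster point which contains the classes of all words $$(i_1,\dots,i_{n_\sigma},\sigma(i_1),\dots,\sigma(i_{n_\sigma}),\dots,\sigma^{rh^\vee/2-1}(i_1),\dots,\sigma^{rh^\vee/2-1}(i_{n_\sigma}))$$ where $(i_1,\dots,i_{n_\sigma})$ contains exactly one element of each $\sigma$-orbit; for $\sigma=\mathrm{id}$ it is the $r$-cluster point $\{[Q]\}$, with $Q$ running over the orientations of $\Delta$ and $[Q]$ the set of the reduced words $(i_1,\dots,i_N)$ of $w_0$ such that $i_k$ is a source of $s_{i_{k-1}}\cdots s_{i_1}Q$ for all $k$ ($s_i$ reverses all arrows incident to $i$). *Q-data.* Fix a $\sigma$-parity function, i.e. integers $0\le\epsilon_i<2d_i$ ($i\in\Delta_0$) such that $\epsilon_i\equiv\epsilon_j \pmod 2$ for $i,j$ in one $\sigma$-orbit, $\epsilon_{\sigma^l(i)}\equiv\epsilon_i-2l\pmod{2d_i}$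 for $l\in\mathbb Z$, and $\epsilon_i\equiv\epsilon_j+\min(d_i,d_j)\pmod{2\min(d_i,d_j)}$ for $i\sim j$. A *Q-datum* $\mathcal Q=(\Delta,\sigma,\xi)$ for $\mathfrak g$ is given by a function $\xi:\Delta_0\to\mathbb Z$ such that (H1) $|\xi_i-\xi_j|=d_i$ if $i\sim j$ and $d_i=d_j$; (H2) if $i\sim j$ and $d_i<d_j$, there is a unique $j^\circ$ in the $\sigma$-orbit of $j$ such that $|\xi_i-\xi_{j^\circ}|=1$ and $\xi_{\sigma^l(j^\circ)}=\xi_{j^\circ}-2l$ for $0\le l<r$; (H3) $\xi_i-\epsilon_i\in 2d_i\mathbb Z$ for all $i$. A vertex $i$ is a source of $\mathcal Q$ if $\xi_i>\xi_j$ for all $j\sim i$; then $s_i\mathcal Q$ is obtained by replacing $\xi_i$ by $\xi_i-2d_i$. A sequence $(i_1,\dots,i_l)$ is adapted to $\mathcal Q$ if $i_k$ is a source of $s_{i_{k-1}}\cdots s_{i_1}\mathcal Q$ for all $k$. The *twisted Auslander–Reiten quiver* $\Gamma_{\mathcal Q}$ has as vertices the pairs $(i,\xi_i-2d_ik)$ with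 $i\in\Delta_0$, $k\in\mathbb Z$ and $0\le 2d_ik<rh^\vee+\xi_i-\xi_{i^*}$, and an arrow $(i,p)\to(j,s)$ if and only if $i\sim j$ and $s-p=\min(d_i,d_j)$; put $\pi(i,p)=i$. **Theorem.** For each Q-datum $\mathcal Q$ for $\mathfrak g$, let $[\mathcal Q]$ be the set of all reduced words of $w_0$ adapted to $\mathcal Q$. Then $[\mathcal Q]$ is a single commutation class, and there is a unique isomorphism of quivers $\Gamma_{\mathcal Q}\cong\Upsilon_{[\mathcal Q]}$ which intertwines $\pi$ and $\operatorname{res}^{[\mathcal Q]}$. Moreover, $[\![\Delta^\sigma]\!]$ is well defined, and $\mathcal Q\mapsto[\mathcal Q]$ induces a bijection from the set of Q-data for $\mathfrak g$, modulo adding constants in $2r\mathbb Z$ to $\xi$, onto $[\![\Delta^\sigma]\!]$. -/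

import Mathlib

namespace QData

/-! ### Simply-laced Dynkin diagrams -/

/-- The types `A_n` (`n ≥ 1`), `D_n` (`n ≥ 4`), `E_6`, `E_7`, `E_8`. -/
inductive ADEType : Type
  | A (n : ℕ) (hn : 1 ≤ n) : ADEType
  | D (n : ℕ) (hn : 4 ≤ n) : ADEType
  | E₆ : ADEType
  | E₇ : ADEType
  | E₈ : ADEType

namespace ADEType

/-- The number of vertices of the Dynkin diagram. -/
@[reducible] def rank : ADEType → ℕ
  | A n _ => n
  | D n _ => n
  | E₆ => 6
  | E₇ => 7
  | E₈ => 8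

/-- The Cartan matrix. -/
def cartan : (X : ADEType) → Matrix (Fin X.rank) (Fin X.rank) ℤ
  | A n _ => CartanMatrix.A n
  | D n _ => CartanMatrix.D n
  | E₆ => CartanMatrix.E₆
  | E₇ => CartanMatrix.E₇
  | E₈ => CartanMatrix.E₈

/-- The Dynkin diagram: distinct vertices are adjacent when the Cartan integer is nonzero. -/
def diagram (X : ADEType) : SimpleGraph (Fin X.rank) :=
  SimpleGraph.fromRel fun i j => X.cartan i j ≠ 0

/-- The dual Coxeter number `h^∨` of the simple Lie algebra `𝔤` obtained by folding the diagram
of type `X` by an automorphism of order `r`: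
`A_n`, `D_n`, `E_n` if `r = 1`; `A_{2m-1}` gives `B_m` (`h^∨ = 2m - 1`),
`D_n` gives `C_{n-1}` (`h^∨ = n`), `E_6` gives `F_4` (`h^∨ = 9`) if `r = 2`;
`D_4` gives `G_2` (`h^∨ = 4`) if `r = 3`.
(No other combination admits a folding; the value is then irrelevant.) -/
def dualCoxeter : ADEType → ℕ → ℕ
  | A n _, 1 => n + 1
  | A n _, _ => n
  | D n _, 1 => 2 * n - 2
  | D n _, 2 => n
  | D _ _, _ => 4
  | E₆, 1 => 12
  | E₆, _ => 9
  | E₇, _ => 18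
  | E₈, _ => 30

end ADEType

/-! ### Weyl group, roots, reduced words -/

section Weyl

variable {V : Type*} (Γ : SimpleGraph V)

open Classical in
/-- The simple root `α_i = 2 ϖ_i - ∑_{j ∼ i} ϖ_j` in the weight lattice `P = V → ℤ`,
whose standard basis consists of the fundamental weights `ϖ_j`. -/
noncomputable def simpleRoot (i : V) : V → ℤ :=
  fun j => if j = i then 2 else if Γ.Adj i j then -1 else 0

theorem proj_simpleRoot (i : V) :
    (LinearMap.proj i : (V → ℤ) →ₗ[ℤ] ℤ) (simpleRoot Γ i) = 2 := by
  simp [simpleRoot]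

/-- The simple reflection `s_i λ = λ - (λ, α_i) α_i`; here `(λ, α_i)` is the coefficient of `ϖ_i`
in `λ`, because `(ϖ_j, α_i) = δ_{ij}`. -/
noncomputable def simpleReflection (i : V) : (V → ℤ) ≃ₗ[ℤ] (V → ℤ) :=
  Module.reflection (proj_simpleRoot Γ i)

/-- The Weyl group, as a subgroup of `Aut(P)`. -/
def weylGroup : Subgroup ((V → ℤ) ≃ₗ[ℤ] (V → ℤ)) :=
  Subgroup.closure (Set.range (simpleReflection Γ))

/-- The product `s_{i₁} ⋯ s_{iₗ}` attached to the sequence `(i₁, …, iₗ)`. -/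
noncomputable def wordProd (w : List V) : (V → ℤ) ≃ₗ[ℤ] (V → ℤ) :=
  (w.map (simpleReflection Γ)).prod

/-- `w` is a reduced word for `g`. -/
def IsReducedWord (w : List V) (g : (V → ℤ) ≃ₗ[ℤ] (V → ℤ)) : Prop :=
  wordProd Γ w = g ∧ ∀ w' : List V, wordProd Γ w' = g → w.length ≤ w'.length

/-- The length `ℓ(g)` of an element `g` of the Weyl group. -/
noncomputable def weylLength (g : (V → ℤ) ≃ₗ[ℤ] (V → ℤ)) : ℕ :=
  sInf {l | ∃ w : List V, wordProd Γ w = g ∧ w.length = l}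

/-- `g` is an element of maximal length of the Weyl group. -/
def IsLongest (g : (V → ℤ) ≃ₗ[ℤ] (V → ℤ)) : Prop :=
  g ∈ weylGroup Γ ∧ ∀ g' ∈ weylGroup Γ, weylLength Γ g' ≤ weylLength Γ g

/-- The longest element `w₀` of the Weyl group. -/
noncomputable def longestElement : (V → ℤ) ≃ₗ[ℤ] (V → ℤ) :=
  Classical.epsilon (IsLongest Γ)

/-- The involution `i ↦ i^*` of the set of vertices, determined by `w₀ α_i = - α_{i^*}`. -/
noncomputable def starInvolution (i : V) : V :=
  @Classical.epsilon V ⟨i⟩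
    (fun j => longestElement Γ (simpleRoot Γ i) = - simpleRoot Γ j)

/-- The set `R = W · {α_i}` of roots. -/
def roots : Set (V → ℤ) :=
  {β | ∃ g ∈ weylGroup Γ, ∃ i, β = g (simpleRoot Γ i)}

/-- The set `R⁺ = R ∩ Q⁺` of positive roots, `Q⁺` being the nonnegative integral span of the
simple roots. -/
def positiveRoots : Set (V → ℤ) :=
  roots Γ ∩ (AddSubmonoid.closure (Set.range (simpleRoot Γ)) : Set (V → ℤ))

/-- The root `β_k = s_{i₁} ⋯ s_{i_{k-1}} (α_{i_k})` of the word `w = (i₁, …, iₗ)`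
(positions are counted from `0` here). -/
noncomputable def wordRoot (w : List V) (k : Fin w.length) : V → ℤ :=
  wordProd Γ (w.take k) (simpleRoot Γ (w.get k))

/-! ### Commutation classes and r-cluster points -/

/-- Exchange of two adjacent entries which are not adjacent in the diagram. -/
inductive CommStep : List V → List V → Prop
  | swap (u v : List V) (i j : V) (hij : ¬ Γ.Adj i j) :
      CommStep (u ++ i :: j :: v) (u ++ j :: i :: v)

/-- The commutation class `[w]` of a sequence `w`. -/
def commClass (w : List V) : Set (List V) :=
  {w' | Relation.EqvGen (CommStep Γ) w w'}

/-- `c' = r_i c` for some vertex `i`: there is a reduced word `(i, i₂, …, i_N)` for `w₀` in the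
commutation class `c`, and `c'` is the class of `(i₂, …, i_N, i^*)`. -/
def ReflectionStep (c c' : Set (List V)) : Prop :=
  ∃ (i : V) (w : List V), IsReducedWord Γ (i :: w) (longestElement Γ) ∧
    c = commClass Γ (i :: w) ∧ c' = commClass Γ (w ++ [starInvolution Γ i])

/-- `P` is an r-cluster point: the set of all commutation classes which are reflection equivalent
to the commutation class of some given reduced word for `w₀`. -/
def IsRClusterPoint (P : Set (Set (List V))) : Prop :=
  ∃ w, IsReducedWord Γ w (longestElement Γ) ∧
    P = {c | Relation.EqvGen (ReflectionStep Γ) (commClass Γ w) c}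

/-! ### The combinatorial Auslander-Reiten quiver of a reduced word -/

/-- There is an arrow from `x` to `y` in the combinatorial Auslander-Reiten quiver `Υ_w`:
`x = β_k` and `y = β_j` with `j < k`, `i_j ∼ i_k`, and no entry strictly between the positions
`j` and `k` equals `i_j` or `i_k`. -/
def CombArrow (w : List V) (x y : V → ℤ) : Prop :=
  ∃ j k : Fin w.length, j < k ∧ x = wordRoot Γ w k ∧ y = wordRoot Γ w j ∧
    Γ.Adj (w.get j) (w.get k) ∧
    ∀ l : Fin w.length, j < l → l < k → w.get l ≠ w.get j ∧ w.get l ≠ w.get k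

/-- The residue of the root `β` with respect to `w` is `i`. -/
def HasResidue (w : List V) (β : V → ℤ) (i : V) : Prop :=
  ∃ k : Fin w.length, β = wordRoot Γ w k ∧ w.get k = i

/-! ### Dynkin quivers and the adapted classes -/

/-- A Dynkin quiver: an orientation of the diagram. `arrow i j` means that there is an arrow
`i → j`. -/
structure DynkinQuiver where
  arrow : V → V → Prop
  adj_of_arrow : ∀ i j, arrow i j → Γ.Adj i j
  oriented : ∀ i j, Γ.Adj i j → (arrow i j ↔ ¬ arrow j i)

/-- The arrows of `s_i Q`: all arrows incident to `i` are reversed. -/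
def reverseAt (a : V → V → Prop) (i : V) : V → V → Prop :=
  fun x y => ((x = i ∨ y = i) ∧ a y x) ∨ (x ≠ i ∧ y ≠ i ∧ a x y)

/-- `(i₁, …, iₗ)` is adapted to the quiver with arrows `a`: `i_k` is a source of
`s_{i_{k-1}} ⋯ s_{i₁} Q` for all `k`. -/
def AdaptedToQuiver : (V → V → Prop) → List V → Prop
  | _, [] => True
  | a, i :: w => (∀ j, ¬ a j i) ∧ AdaptedToQuiver (reverseAt a i) w

/-- The set `[Q]` of the reduced words for `w₀` which are adapted to the Dynkin quiver `Q`. -/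
def DynkinQuiver.adaptedClass (Q : DynkinQuiver Γ) : Set (List V) :=
  {w | IsReducedWord Γ w (longestElement Γ) ∧ AdaptedToQuiver Q.arrow w}

/-! ### Foldings and the `σ`-adapted r-cluster point -/

variable (σ : Equiv.Perm V)

/-- `d_i`: the cardinality of the `σ`-orbit of `i`. -/
noncomputable def orbitSize (i : V) : ℕ :=
  {j | σ.SameCycle i j}.ncard

/-- The set `I` of `σ`-orbits. -/
abbrev Orbits : Type _ := Quotient (Equiv.Perm.SameCycle.setoid σ)

/-- `t = (i₁, …, iₙ)`, with `n = |I|`, meets every `σ`-orbit, so that `s_{i₁} ⋯ s_{iₙ} σ` is a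
`σ`-Coxeter element. -/
def IsCoxeterSequence (t : List V) : Prop :=
  t.length = Nat.card (Orbits σ) ∧
    ∀ o : Orbits σ, ∃ i ∈ t, Quotient.mk (Equiv.Perm.SameCycle.setoid σ) i = o

/-- The concatenation of `t, σ(t), …, σ^{m-1}(t)`. -/
def iterateSequence (m : ℕ) (t : List V) : List V :=
  (List.range m).flatMap fun k => t.map ⇑(σ ^ k)

/-- `P` is the `σ`-adapted r-cluster point `[[Δ^σ]]` (`h` being the dual Coxeter number of `𝔤`
and `r` the order of `σ`). For `σ = id` it is the r-cluster point `{[Q] | Q a Dynkin quiver}`;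
for `σ ≠ id` it is the r-cluster point which contains the commutation class of
`i(τ) = (t, σ(t), …, σ^{rh/2-1}(t))` for every `σ`-Coxeter element `τ = s_{i₁} ⋯ s_{iₙ} σ`,
`t = (i₁, …, iₙ)`. -/
def IsAdaptedClusterPoint (h : ℕ) (P : Set (Set (List V))) : Prop :=
  IsRClusterPoint Γ P ∧
  (σ = 1 → P = {c | ∃ Q : DynkinQuiver Γ, c = Q.adaptedClass Γ}) ∧
  (σ ≠ 1 → ∀ t, IsCoxeterSequence σ t →
    commClass Γ (iterateSequence σ (orderOf σ * h / 2) t) ∈ P)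

/-! ### Q-data -/

/-- `ε` is a `σ`-parity function. -/
def IsParityFunction (ε : V → ℤ) : Prop :=
  (∀ i, 0 ≤ ε i ∧ ε i < 2 * (orbitSize σ i : ℤ)) ∧
  (∀ i j, σ.SameCycle i j → ε i ≡ ε j [ZMOD 2]) ∧
  (∀ (i : V) (l : ℤ), ε ((σ ^ l) i) ≡ ε i - 2 * l [ZMOD 2 * (orbitSize σ i : ℤ)]) ∧
  (∀ i j, Γ.Adj i j →
    ε i ≡ ε j + min (orbitSize σ i : ℤ) (orbitSize σ j)
      [ZMOD 2 * min (orbitSize σ i : ℤ) (orbitSize σ j)])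

/-- `ξ` is a height function on `(Δ, σ)`: conditions (H1) and (H2). -/
def IsHeightFunction (ξ : V → ℤ) : Prop :=
  (∀ i j, Γ.Adj i j → orbitSize σ i = orbitSize σ j → |ξ i - ξ j| = orbitSize σ i) ∧
  (∀ i j, Γ.Adj i j → orbitSize σ i < orbitSize σ j →
    ∃! j₀, σ.SameCycle j j₀ ∧ |ξ i - ξ j₀| = 1 ∧
      ∀ l : ℕ, l < orderOf σ → ξ ((σ ^ l) j₀) = ξ j₀ - 2 * l)

/-- A Q-datum `(Δ, σ, ξ)`, the height function `ξ` being normalised by the fixed parity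
function `ε`. -/
structure QDatum (ε : V → ℤ) where
  height : V → ℤ
  isHeight : IsHeightFunction Γ σ height
  parity : ∀ i, 2 * (orbitSize σ i : ℤ) ∣ height i - ε i

/-- `i` is a source with respect to `ξ`. -/
def IsSource (ξ : V → ℤ) (i : V) : Prop := ∀ j, Γ.Adj i j → ξ j < ξ i

open Classical in
/-- The height function `s_i ξ`. -/
noncomputable def reflectHeight (ξ : V → ℤ) (i : V) : V → ℤ :=
  fun j => ξ j - if i = j then 2 * (orbitSize σ j : ℤ) else 0

/-- `(i₁, …, iₗ)` is adapted to `(Δ, σ, ξ)`: `i_k` is a source of `s_{i_{k-1}} ⋯ s_{i₁} ξ`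
for all `k`. -/
def Adapted : (V → ℤ) → List V → Prop
  | _, [] => True
  | ξ, i :: w => IsSource Γ ξ i ∧ Adapted (reflectHeight σ ξ i) w

theorem adapted_add_const (c : ℤ) (w : List V) :
    ∀ ξ : V → ℤ, Adapted Γ σ (fun i => ξ i + c) w ↔ Adapted Γ σ ξ w := by
  induction w with
  | nil => intro ξ; exact Iff.rfl
  | cons i w ih =>
    intro ξ
    have h : reflectHeight σ (fun i => ξ i + c) i = fun j => reflectHeight σ ξ i j + c := by
      funext j; simp only [reflectHeight]; ring
    simp only [Adapted, IsSource, h, ih, add_lt_add_iff_right]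

namespace QDatum

variable {Γ σ} {ε : V → ℤ}

/-- The set `[𝒬]` of the reduced words for `w₀` which are adapted to `𝒬`. -/
def adaptedClass (Q : QDatum Γ σ ε) : Set (List V) :=
  {w | IsReducedWord Γ w (longestElement Γ) ∧ Adapted Γ σ Q.height w}

/-- The vertices of the repetition quiver. -/
def repetitionVertices (σ : Equiv.Perm V) (ε : V → ℤ) : Set (V × ℤ) :=
  {x | 2 * (orbitSize σ x.1 : ℤ) ∣ x.2 - ε x.1}

/-- The arrows `x → y` of the repetition quiver, for `x` and `y` among its vertices. -/
def RepetitionArrow (Γ : SimpleGraph V) (σ : Equiv.Perm V) (x y : V × ℤ) : Prop :=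
  Γ.Adj y.1 x.1 ∧ y.2 - x.2 = min (orbitSize σ x.1 : ℤ) (orbitSize σ y.1)

/-- The vertices of the twisted Auslander-Reiten quiver `Γ_𝒬`, the full subquiver of the
repetition quiver on the vertices `(i, ξ_i - 2 d_i k)` with
`0 ≤ 2 d_i k < r h + ξ_i - ξ_{i^*}`. -/
def arVertices (h : ℕ) (Q : QDatum Γ σ ε) : Set (V × ℤ) :=
  {x | x ∈ repetitionVertices σ ε ∧ ∃ k : ℤ,
    x.2 = Q.height x.1 - 2 * (orbitSize σ x.1 : ℤ) * k ∧
    0 ≤ 2 * (orbitSize σ x.1 : ℤ) * k ∧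
    2 * (orbitSize σ x.1 : ℤ) * k <
      (orderOf σ : ℤ) * h + Q.height x.1 - Q.height (starInvolution Γ x.1)}

/-- `φ` is an isomorphism of quivers from `Γ_𝒬` to `Υ_w` which intertwines the first projection
with the residue. -/
def IsARIso (h : ℕ) (Q : QDatum Γ σ ε) (w : List V)
    (φ : Q.arVertices h ≃ positiveRoots Γ) : Prop :=
  (∀ x y : Q.arVertices h,
    RepetitionArrow Γ σ x.1 y.1 ↔ CombArrow Γ w (φ x).1 (φ y).1) ∧
  ∀ x : Q.arVertices h, HasResidue Γ w (φ x).1 x.1.1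

/-- Two Q-data are identified when their height functions differ by a constant in `2rℤ`. -/
instance shiftSetoid (Γ : SimpleGraph V) (σ : Equiv.Perm V) (ε : V → ℤ) :
    Setoid (QDatum Γ σ ε) where
  r Q Q' := ∃ m : ℤ, ∀ i, Q'.height i = Q.height i + 2 * (orderOf σ : ℤ) * m
  iseqv :=
    { refl := fun Q => ⟨0, fun i => by ring⟩
      symm := fun ⟨m, hm⟩ => ⟨-m, fun i => by rw [hm i]; ring⟩
      trans := fun ⟨m, hm⟩ ⟨m', hm'⟩ => ⟨m + m', fun i => by rw [hm' i, hm i]; ring⟩ }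

theorem adaptedClass_eq_of_rel (Q Q' : QDatum Γ σ ε) (h : Q ≈ Q') :
    Q.adaptedClass = Q'.adaptedClass := by
  obtain ⟨m, hm⟩ := h
  have e : Q'.height = fun i => Q.height i + 2 * (orderOf σ : ℤ) * m := funext hm
  ext w
  simp only [adaptedClass, Set.mem_ofPred_eq, e, adapted_add_const]

/-- The map `𝒬 ↦ [𝒬]` on Q-data modulo `2rℤ`. -/
def classMap (Γ : SimpleGraph V) (σ : Equiv.Perm V) (ε : V → ℤ) :
    Quotient (shiftSetoid Γ σ ε) → Set (List V) :=
  Quotient.lift adaptedClass adaptedClass_eq_of_rel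

end QDatum

end Weyl

end QData

open QData

set_option linter.unusedSectionVars false

/-! Height functions are treated as cuts. A height function with its parity is the upper boundary of
an order ideal of the repetition quiver (`QDatum.isCut`, `IsCut.isHeightFunction`). A source is a
boundary vertex that may be removed, and s_i moves the boundary one vertex down in column i, so an
adapted word strips off vertices one by one. Two adapted words with the same content differ by
commutations (`eqvGen_of_perm`), and so do two adapted reduced words for one Weyl group element
(`eqvGen_of_wordProd_eq`). Hence [Q] is a single commutation class as soon as it is nonempty.

Call ξ good if some adapted reduced word for w_0 carries ξ_i to ξ_{i*} - r h^∨. If i :: u is such a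
word, then u followed by i* is one for s_i ξ (`IsGood.rotate`). Any two cuts of the same parity are
joined by reflections at sources, up to a shift (`exists_adapted_to_shift`). So one good height
function makes all of them good, and reflections of Q-data correspond to the operators r_i on
classes: the classes [Q] form one r-cluster point. Counting the letters in front of the first
occurrence of each letter recovers ξ up to a constant (`height_sub_of_adapted`), whence injectivity.

The k-th position of an adapted word for w_0 gives a vertex of Γ_Q, namely the letter i_k with its
current height, and also the root β_k. Comparing the two gives the isomorphism of quivers. It is
unique because an automorphism of Γ_Q that preserves columns shifts each column by a constant, which
must be zero (`slab_rigid`).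

For the cluster point, every sequence t of orbit representatives is adapted to some cut ξ, and t
carries ξ to ξ∘σ^{-1} - 2 (`IsCoxeterSequence.exists_isCut`). Since * is the inverse of σ^{r h^∨/2}
when σ ≠ id, the iterated sequence has the content of a good word of ξ; being adapted, it is
commutation equivalent to it, hence reduced for w_0. For σ = id, height functions up to constants
are orientations of Δ.

What remains is one good height function for each (Δ, σ). Reducedness is certified by a linear form
that is positive on the simple roots and on every β_k. In types A and D this is done on the weights
of the vector representation, which (twisted) Coxeter elements permute cyclically up to sign; types
E and four foldings of D_4 are settled by evaluation. The root system facts rest on positive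
definiteness of the Cartan form: a root is a vector of norm 2, and its coordinates all have one
sign. -/

namespace QData

/-! ### Simple roots, the action on root coordinates, and the quadratic form -/

section RootLattice

variable {V : Type*} (Γ : SimpleGraph V)

theorem simpleRoot_self (i : V) : simpleRoot Γ i i = 2 := by simp [simpleRoot]

variable {Γ} in
theorem simpleRoot_of_adj {i j : V} (h : Γ.Adj i j) : simpleRoot Γ i j = -1 := by
  simp [simpleRoot, h, h.ne']

variable {Γ} in
theorem simpleRoot_of_not_adj {i j : V} (hij : i ≠ j) (h : ¬ Γ.Adj i j) :
    simpleRoot Γ i j = 0 := by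
  simp [simpleRoot, h, hij.symm]

theorem simpleRoot_comm (i j : V) : simpleRoot Γ i j = simpleRoot Γ j i := by
  rcases eq_or_ne i j with rfl | hij
  · rfl
  · by_cases h : Γ.Adj i j
    · rw [simpleRoot_of_adj h, simpleRoot_of_adj h.symm]
    · rw [simpleRoot_of_not_adj hij h, simpleRoot_of_not_adj hij.symm (fun h' => h h'.symm)]

variable {Γ} in
theorem simpleRoot_nonpos {i j : V} (hij : i ≠ j) : simpleRoot Γ i j ≤ 0 := by
  by_cases h : Γ.Adj i j
  · rw [simpleRoot_of_adj h]; norm_num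
  · rw [simpleRoot_of_not_adj hij h]

theorem simpleRoot_injective : Function.Injective (simpleRoot Γ) := by
  intro i j h
  by_contra hij
  have h1 := congrFun h i
  rw [simpleRoot_self] at h1
  have := simpleRoot_nonpos (Γ := Γ) (Ne.symm hij)
  omega

theorem simpleReflection_apply (i : V) (l : V → ℤ) :
    simpleReflection Γ i l = l - l i • simpleRoot Γ i := by
  simp [simpleReflection, Module.reflection_apply]

theorem simpleReflection_mul_self (i : V) : simpleReflection Γ i * simpleReflection Γ i = 1 :=
  Module.involutive_reflection (proj_simpleRoot Γ i) |> fun h => LinearEquiv.ext h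

theorem simpleReflection_inv (i : V) : (simpleReflection Γ i)⁻¹ = simpleReflection Γ i :=
  inv_eq_of_mul_eq_one_left (simpleReflection_mul_self Γ i)

theorem simpleReflection_simpleRoot_self (i : V) :
    simpleReflection Γ i (simpleRoot Γ i) = -simpleRoot Γ i := by
  rw [simpleReflection_apply, simpleRoot_self, two_smul]; abel

variable {Γ} in
theorem simpleReflection_simpleRoot_of_not_adj {i j : V} (hij : i ≠ j) (h : ¬ Γ.Adj i j) :
    simpleReflection Γ i (simpleRoot Γ j) = simpleRoot Γ j := by
  rw [simpleReflection_apply, simpleRoot_comm, simpleRoot_of_not_adj hij h]; simp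

variable {Γ} in
theorem simpleReflection_commute {i j : V} (h : ¬ Γ.Adj i j) :
    simpleReflection Γ i * simpleReflection Γ j = simpleReflection Γ j * simpleReflection Γ i := by
  rcases eq_or_ne i j with rfl | hij
  · rfl
  · ext l : 1
    have h1 := simpleRoot_of_not_adj hij h
    have h2 := simpleRoot_comm Γ i j ▸ h1
    simp only [LinearEquiv.mul_apply, simpleReflection_apply, Pi.sub_apply, Pi.smul_apply, h1, h2]
    simp only [smul_zero, sub_zero]
    abel

@[simp] theorem wordProd_nil : wordProd Γ [] = 1 := rfl

@[simp] theorem wordProd_cons (i : V) (w : List V) :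
    wordProd Γ (i :: w) = simpleReflection Γ i * wordProd Γ w := by simp [wordProd]

@[simp] theorem wordProd_append (u v : List V) :
    wordProd Γ (u ++ v) = wordProd Γ u * wordProd Γ v := by simp [wordProd]

theorem wordProd_reverse (w : List V) : wordProd Γ w.reverse = (wordProd Γ w)⁻¹ := by
  induction w with
  | nil => simp
  | cons i w ih => simp [ih, simpleReflection_inv]

theorem mem_weylGroup_iff (g : (V → ℤ) ≃ₗ[ℤ] (V → ℤ)) :
    g ∈ weylGroup Γ ↔ ∃ w, wordProd Γ w = g := by
  constructor
  · intro hg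
    induction hg using Subgroup.closure_induction with
    | mem x hx => obtain ⟨i, rfl⟩ := hx; exact ⟨[i], by simp⟩
    | one => exact ⟨[], rfl⟩
    | mul x y _ _ hx hy =>
      obtain ⟨u, rfl⟩ := hx; obtain ⟨v, rfl⟩ := hy; exact ⟨u ++ v, by simp⟩
    | inv x _ hx => obtain ⟨u, rfl⟩ := hx; exact ⟨u.reverse, wordProd_reverse Γ u⟩
  · rintro ⟨w, rfl⟩
    induction w with
    | nil => exact one_mem _
    | cons i w ih =>
      rw [wordProd_cons]
      exact mul_mem (Subgroup.subset_closure ⟨i, rfl⟩) ih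

variable [Fintype V]

/-- The element of the weight lattice with the given coordinates with respect to the simple
roots. -/
noncomputable def toWeight : (V → ℤ) →ₗ[ℤ] (V → ℤ) :=
  Fintype.linearCombination ℤ (simpleRoot Γ)

theorem toWeight_eq_sum (x : V → ℤ) : toWeight Γ x = ∑ i, x i • simpleRoot Γ i := by
  simp [toWeight, Fintype.linearCombination_apply]

theorem toWeight_apply (x : V → ℤ) (j : V) :
    toWeight Γ x j = ∑ i, x i * simpleRoot Γ i j := by
  simp [toWeight_eq_sum, Finset.sum_apply]

variable [DecidableEq V]

@[simp] theorem toWeight_single (i : V) : toWeight Γ (Pi.single i 1) = simpleRoot Γ i := by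
  simp [toWeight_eq_sum, Pi.single_apply]

theorem simpleRoot_dotProduct (i : V) (x : V → ℤ) : simpleRoot Γ i ⬝ᵥ x = toWeight Γ x i := by
  rw [toWeight_apply, dotProduct]
  exact Finset.sum_congr rfl fun j _ => by rw [simpleRoot_comm, mul_comm]

theorem toWeight_dotProduct_comm (x y : V → ℤ) : toWeight Γ x ⬝ᵥ y = toWeight Γ y ⬝ᵥ x := by
  simp only [dotProduct, toWeight_apply, Finset.sum_mul]
  rw [Finset.sum_comm]
  refine Finset.sum_congr rfl fun i _ => Finset.sum_congr rfl fun j _ => ?_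
  rw [simpleRoot_comm]; ring

/-- The action of a simple reflection on coordinates with respect to the simple roots. -/
noncomputable def rootRefl (i : V) (x : V → ℤ) : V → ℤ := x - toWeight Γ x i • Pi.single i 1

theorem toWeight_rootRefl (i : V) (x : V → ℤ) :
    toWeight Γ (rootRefl Γ i x) = simpleReflection Γ i (toWeight Γ x) := by
  rw [rootRefl, map_sub, map_smul, toWeight_single, simpleReflection_apply]

/-- The dot product pairs weights with root coordinates, the fundamental weights being dual to the
simple roots. Its invariance yields that of `rootNorm`. -/
theorem simpleReflection_dotProduct_rootRefl (i : V) (l x : V → ℤ) :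
    simpleReflection Γ i l ⬝ᵥ rootRefl Γ i x = l ⬝ᵥ x := by
  have h := simpleRoot_dotProduct Γ i x
  simp only [simpleReflection_apply, rootRefl, sub_dotProduct, dotProduct_sub, smul_dotProduct,
    dotProduct_smul, h, dotProduct_single, Pi.sub_apply, Pi.smul_apply, simpleRoot_self,
    smul_eq_mul]
  ring

/-- The action of a word on coordinates with respect to the simple roots. -/
noncomputable def wordAct (w : List V) (x : V → ℤ) : V → ℤ := w.foldr (rootRefl Γ) x

theorem toWeight_wordAct (w : List V) (x : V → ℤ) :
    toWeight Γ (wordAct Γ w x) = wordProd Γ w (toWeight Γ x) := by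
  induction w with
  | nil => rfl
  | cons i w ih =>
    rw [wordProd_cons, LinearEquiv.mul_apply, ← ih, ← toWeight_rootRefl]; rfl

theorem wordProd_dotProduct_wordAct (w : List V) (l x : V → ℤ) :
    wordProd Γ w l ⬝ᵥ wordAct Γ w x = l ⬝ᵥ x := by
  induction w with
  | nil => rfl
  | cons i w ih =>
    rw [wordProd_cons, LinearEquiv.mul_apply]
    exact (simpleReflection_dotProduct_rootRefl Γ i _ _).trans ih

/-- The quadratic form of the root lattice. -/
noncomputable def rootNorm (x : V → ℤ) : ℤ := toWeight Γ x ⬝ᵥ x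

theorem rootNorm_rootRefl (i : V) (x : V → ℤ) : rootNorm Γ (rootRefl Γ i x) = rootNorm Γ x := by
  rw [rootNorm, toWeight_rootRefl, simpleReflection_dotProduct_rootRefl, rootNorm]

theorem rootNorm_wordAct (w : List V) (x : V → ℤ) :
    rootNorm Γ (wordAct Γ w x) = rootNorm Γ x := by
  rw [rootNorm, toWeight_wordAct, wordProd_dotProduct_wordAct, rootNorm]

@[simp] theorem rootNorm_single (i : V) : rootNorm Γ (Pi.single i 1) = 2 := by
  simp [rootNorm, simpleRoot_self]

theorem rootNorm_neg (x : V → ℤ) : rootNorm Γ (-x) = rootNorm Γ x := by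
  simp [rootNorm]

theorem rootNorm_add (x y : V → ℤ) :
    rootNorm Γ (x + y) = rootNorm Γ x + rootNorm Γ y + 2 * (toWeight Γ x ⬝ᵥ y) := by
  simp only [rootNorm, map_add, add_dotProduct, dotProduct_add]
  rw [toWeight_dotProduct_comm Γ y x]; ring

theorem rootNorm_smul (c : ℤ) (x : V → ℤ) : rootNorm Γ (c • x) = c * (c * rootNorm Γ x) := by
  rw [rootNorm, map_smul, smul_dotProduct, dotProduct_smul, smul_eq_mul, smul_eq_mul, rootNorm]

/-- The diagonal terms are 2 x_i², and each off-diagonal term occurs twice. Evenness turns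
positivity of the norm into the bound 2 for nonzero vectors. -/
theorem even_rootNorm (x : V → ℤ) : Even (rootNorm Γ x) := by
  have key : ∀ s : Finset V, Even (rootNorm Γ (∑ i ∈ s, x i • Pi.single i 1)) := by
    intro s
    induction s using Finset.induction_on with
    | empty => simp [rootNorm]
    | insert i s hi ih =>
      rw [Finset.sum_insert hi, rootNorm_add, rootNorm_smul, rootNorm_single]
      exact ((((even_two).mul_left _).mul_left _).add ih).add (even_two_mul _)
  have := key Finset.univ
  rwa [← pi_eq_sum_univ' x] at this

end RootLattice

/-! ### Positive definiteness, and positive roots as nonnegative vectors of norm 2 -/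

section FiniteType

variable {V : Type*} [Fintype V]

/-- A graph admits a vector which shows that its Cartan form is positive definite. -/
def IsFiniteType (Γ : SimpleGraph V) : Prop :=
  ∃ δ : V → ℤ, (∀ i, 0 < δ i) ∧ ∀ j, 0 < ∑ i, δ i * simpleRoot Γ i j

variable {Γ : SimpleGraph V} [DecidableEq V]

/-- Substitute x_i = δ_i y_i. For i ≠ j the Cartan integer is nonpositive, so y_i y_j ≤ (y_i² +
y_j²)/2 bounds each term from below. The bounds add up to ∑_j δ_j y_j² (∑_i δ_i a_{ij}), which is
positive by the choice of δ. -/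
theorem rootNorm_pos (hΓ : IsFiniteType Γ) {x : V → ℤ} (hx : x ≠ 0) : 0 < rootNorm Γ x := by
  obtain ⟨δ, hδ, hA⟩ := hΓ
  let y : V → ℚ := fun i => x i / δ i
  have hδ' : ∀ i, (0 : ℚ) < δ i := fun i => by exact_mod_cast hδ i
  have hxy : ∀ i, (x i : ℚ) = δ i * y i := fun i => by
    simp only [y]; field_simp [(hδ' i).ne']
  have h0 : (rootNorm Γ x : ℚ) = ∑ j, ∑ i, (x i : ℚ) * simpleRoot Γ i j * x j := by
    simp [rootNorm, dotProduct, toWeight_apply, Finset.sum_mul]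
  have h1 : ∀ i j, (simpleRoot Γ i j : ℚ) * δ i * δ j * (y i ^ 2 + y j ^ 2) / 2 ≤
      (x i : ℚ) * simpleRoot Γ i j * x j := by
    intro i j
    rw [hxy i, hxy j]
    rcases eq_or_ne i j with rfl | hij
    · apply le_of_eq; ring
    · have hn : (simpleRoot Γ i j : ℚ) ≤ 0 := by exact_mod_cast simpleRoot_nonpos hij
      have hp : (0 : ℚ) ≤ δ i * δ j * (y i - y j) ^ 2 :=
        mul_nonneg (mul_nonneg (hδ' i).le (hδ' j).le) (sq_nonneg _)
      nlinarith [mul_nonneg (neg_nonneg.2 hn) hp]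
  have h2 : ∑ j, ∑ i, (simpleRoot Γ i j : ℚ) * δ i * δ j * (y i ^ 2 + y j ^ 2) / 2 =
      ∑ j, δ j * y j ^ 2 * ((∑ i, δ i * simpleRoot Γ i j : ℤ) : ℚ) := by
    have e1 : ∀ j i, (simpleRoot Γ i j : ℚ) * δ i * δ j * (y i ^ 2 + y j ^ 2) / 2 =
        (simpleRoot Γ i j : ℚ) * δ i * δ j * y i ^ 2 / 2 +
        (simpleRoot Γ i j : ℚ) * δ i * δ j * y j ^ 2 / 2 := fun j i => by ring
    simp only [e1, Finset.sum_add_distrib]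
    rw [Finset.sum_comm, ← Finset.sum_add_distrib]
    refine Finset.sum_congr rfl fun j _ => ?_
    rw [← Finset.sum_add_distrib]
    push_cast
    rw [Finset.mul_sum]
    refine Finset.sum_congr rfl fun i _ => ?_
    rw [simpleRoot_comm Γ j i]; ring
  have h3 : (0 : ℚ) < ∑ j, δ j * y j ^ 2 * ((∑ i, δ i * simpleRoot Γ i j : ℤ) : ℚ) := by
    obtain ⟨k, hk⟩ := Function.ne_iff.1 hx
    have hA' : ∀ j, (0 : ℚ) < ((∑ i, δ i * simpleRoot Γ i j : ℤ) : ℚ) := fun j => by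
      exact_mod_cast hA j
    refine Finset.sum_pos' (fun j _ => ?_) ⟨k, Finset.mem_univ _, ?_⟩
    · exact mul_nonneg (mul_nonneg (hδ' j).le (sq_nonneg _)) (hA' j).le
    · have : y k ≠ 0 := by
        have hk' : (x k : ℚ) ≠ 0 := by exact_mod_cast hk
        exact div_ne_zero hk' (hδ' k).ne'
      exact mul_pos (mul_pos (hδ' k) (by positivity)) (hA' k)
  have h4 : (0 : ℚ) < rootNorm Γ x := by
    rw [h0]
    refine h3.trans_le (h2 ▸ ?_)
    exact Finset.sum_le_sum fun j _ => Finset.sum_le_sum fun i _ => h1 i j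
  exact_mod_cast h4

theorem toWeight_injective (hΓ : IsFiniteType Γ) : Function.Injective (toWeight Γ) := by
  rw [injective_iff_map_eq_zero]
  intro x hx
  by_contra h
  have := rootNorm_pos hΓ h
  simp [rootNorm, hx] at this

theorem two_le_rootNorm (hΓ : IsFiniteType Γ) {x : V → ℤ} (hx : x ≠ 0) : 2 ≤ rootNorm Γ x := by
  have h1 := rootNorm_pos hΓ hx
  obtain ⟨k, hk⟩ := even_rootNorm Γ x
  omega

/-- The positive and negative parts of x have disjoint supports, so their inner product is
nonpositive. If both were nonzero, each would have norm at least 2, and x would have norm at least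
4. -/
theorem nonneg_or_nonpos_of_rootNorm (hΓ : IsFiniteType Γ) {x : V → ℤ} (hx : rootNorm Γ x = 2) :
    0 ≤ x ∨ x ≤ 0 := by
  have hd : x = x⁺ + -x⁻ := by rw [← sub_eq_add_neg]; exact (posPart_sub_negPart x).symm
  have hB : toWeight Γ x⁺ ⬝ᵥ x⁻ ≤ 0 := by
    simp only [dotProduct, toWeight_apply, Finset.sum_mul]
    refine Finset.sum_nonpos fun j _ => Finset.sum_nonpos fun i _ => ?_
    have hi : 0 ≤ x⁺ i := posPart_nonneg x i
    have hj : 0 ≤ x⁻ j := negPart_nonneg x j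
    rcases eq_or_ne i j with rfl | hij
    · have : x⁺ i = 0 ∨ x⁻ i = 0 := by
        rw [Pi.posPart_apply, Pi.negPart_apply]
        rcases le_total 0 (x i) with h | h
        · exact Or.inr (negPart_eq_zero.2 h)
        · exact Or.inl (posPart_eq_zero.2 h)
      rcases this with h | h <;> simp [h]
    · have := mul_nonneg (mul_nonneg hi hj) (neg_nonneg.2 (simpleRoot_nonpos (Γ := Γ) hij))
      nlinarith
  by_contra! hcon
  have hp : x⁺ ≠ 0 := fun h => hcon.2 (posPart_eq_zero.1 h)
  have hn : x⁻ ≠ 0 := fun h => hcon.1 (negPart_eq_zero.1 h)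
  have h1 := two_le_rootNorm hΓ hp
  have h2 := two_le_rootNorm hΓ hn
  have h3 : rootNorm Γ x = rootNorm Γ x⁺ + rootNorm Γ x⁻ - 2 * (toWeight Γ x⁺ ⬝ᵥ x⁻) := by
    conv_lhs => rw [hd]
    rw [rootNorm_add, rootNorm_neg, dotProduct_neg]; ring
  omega

variable (Γ) in
/-- `β` is a vector of norm `2` of the root lattice. -/
def IsRoot (β : V → ℤ) : Prop := ∃ x, rootNorm Γ x = 2 ∧ β = toWeight Γ x

variable (Γ) in
/-- `β` is a vector of norm `2` of the root lattice, with nonnegative coordinates. -/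
def IsPosRoot (β : V → ℤ) : Prop := ∃ x, rootNorm Γ x = 2 ∧ 0 ≤ x ∧ β = toWeight Γ x

theorem IsPosRoot.isRoot {β : V → ℤ} (h : IsPosRoot Γ β) : IsRoot Γ β := by
  obtain ⟨x, h1, -, h2⟩ := h; exact ⟨x, h1, h2⟩

theorem isPosRoot_simpleRoot (i : V) : IsPosRoot Γ (simpleRoot Γ i) :=
  ⟨Pi.single i 1, by simp, by simp, by simp⟩

theorem IsRoot.neg {β : V → ℤ} (h : IsRoot Γ β) : IsRoot Γ (-β) := by
  obtain ⟨x, h1, h2⟩ := h; exact ⟨-x, by rw [rootNorm_neg, h1], by rw [h2, map_neg]⟩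

theorem IsRoot.wordProd {β : V → ℤ} (h : IsRoot Γ β) (w : List V) :
    IsRoot Γ (wordProd Γ w β) := by
  obtain ⟨x, h1, rfl⟩ := h
  exact ⟨wordAct Γ w x, by rw [rootNorm_wordAct, h1], by rw [toWeight_wordAct]⟩

theorem IsRoot.isPosRoot_or (hΓ : IsFiniteType Γ) {β : V → ℤ} (h : IsRoot Γ β) :
    IsPosRoot Γ β ∨ IsPosRoot Γ (-β) := by
  obtain ⟨x, h1, rfl⟩ := h
  rcases nonneg_or_nonpos_of_rootNorm hΓ h1 with h | h
  · exact Or.inl ⟨x, h1, h, rfl⟩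
  · exact Or.inr ⟨-x, by rw [rootNorm_neg, h1], neg_nonneg.2 h, by rw [map_neg]⟩

theorem IsPosRoot.map_pos {β : V → ℤ} (h : IsPosRoot Γ β) (E : (V → ℤ) →ₗ[ℤ] ℤ)
    (hE : ∀ i, 0 < E (simpleRoot Γ i)) : 0 < E β := by
  obtain ⟨x, h1, h2, rfl⟩ := h
  rw [toWeight_eq_sum, map_sum]
  simp only [map_smul, smul_eq_mul]
  have hx : x ≠ 0 := by rintro rfl; simp [rootNorm] at h1
  obtain ⟨k, hk⟩ := Function.ne_iff.1 hx
  exact Finset.sum_pos' (fun i _ => mul_nonneg (h2 i) (hE i).le)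
    ⟨k, Finset.mem_univ _, mul_pos (lt_of_le_of_ne (h2 k) (Ne.symm hk)) (hE k)⟩

theorem IsPosRoot.not_neg (hΓ : IsFiniteType Γ) {β : V → ℤ} (h : IsPosRoot Γ β) :
    ¬ IsPosRoot Γ (-β) := by
  obtain ⟨x, h1, h2, rfl⟩ := h
  rintro ⟨y, h3, h4, h5⟩
  rw [← map_neg] at h5
  have := toWeight_injective hΓ h5
  have hx : x = 0 := le_antisymm (neg_nonneg.1 (this ▸ h4)) h2
  simp [hx, rootNorm] at h1

theorem IsRoot.not_isPosRoot_iff (hΓ : IsFiniteType Γ) {β : V → ℤ} (h : IsRoot Γ β) :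
    ¬ IsPosRoot Γ β ↔ IsPosRoot Γ (-β) :=
  ⟨fun h' => (h.isPosRoot_or hΓ).resolve_left h', fun h' h'' => h''.not_neg hΓ h'⟩

theorem IsRoot.isPosRoot_of_map_pos (hΓ : IsFiniteType Γ) {β : V → ℤ} (h : IsRoot Γ β)
    (E : (V → ℤ) →ₗ[ℤ] ℤ) (hE : ∀ i, 0 < E (simpleRoot Γ i)) (hβ : 0 < E β) : IsPosRoot Γ β := by
  by_contra hcon
  have := ((h.not_isPosRoot_iff hΓ).1 hcon).map_pos E hE
  rw [map_neg] at this
  omega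

/-- Only the i-th coordinate changes. If the result were nonpositive, all other coordinates of the
root would vanish, and norm 2 would leave only α_i. -/
theorem IsPosRoot.simpleReflection (hΓ : IsFiniteType Γ) {β : V → ℤ} (h : IsPosRoot Γ β) {i : V}
    (hi : β ≠ simpleRoot Γ i) : IsPosRoot Γ (simpleReflection Γ i β) := by
  obtain ⟨x, h1, h2, rfl⟩ := h
  refine ⟨rootRefl Γ i x, by rw [rootNorm_rootRefl, h1], ?_, by rw [toWeight_rootRefl]⟩
  refine (nonneg_or_nonpos_of_rootNorm hΓ
    (by rw [rootNorm_rootRefl, h1])).resolve_right fun hneg => hi ?_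
  have hx : x = x i • Pi.single i 1 := by
    funext j
    rcases eq_or_ne j i with rfl | hj
    · simp
    · have := hneg j
      simp only [rootRefl, Pi.sub_apply, Pi.smul_apply, Pi.single_eq_of_ne hj, smul_zero,
        sub_zero, Pi.zero_apply] at this
      simpa [Pi.single_eq_of_ne hj] using le_antisymm this (h2 j)
  have h3 : x i * (x i * 2) = 2 := by
    rw [hx, rootNorm_smul, rootNorm_single] at h1; simpa using h1
  have h4 : x i = 1 := by
    have := h2 i
    simp only [Pi.zero_apply] at this
    nlinarith
  rw [hx, h4, one_smul, toWeight_single]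

end FiniteType

end QData

namespace QData

/-! ### Reduced words, the longest element and the involution * -/

section Reduced

variable {V : Type*} [Fintype V] [DecidableEq V] {Γ : SimpleGraph V}

theorem IsFiniteType.exists_functional (hΓ : IsFiniteType Γ) :
    ∃ E : (V → ℤ) →ₗ[ℤ] ℤ, ∀ i, 0 < E (simpleRoot Γ i) := by
  obtain ⟨δ, -, hδ⟩ := hΓ
  refine ⟨dotProductBilin ℤ ℤ δ, fun j => ?_⟩
  have := hδ j
  simpa [dotProduct, simpleRoot_comm Γ j] using this

/-- Conjugation of a reflection. The invariant pairing shows that the ϖ_j-coefficient of w λ is the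
ϖ_i-coefficient of λ. -/
theorem wordProd_mul_simpleReflection (hΓ : IsFiniteType Γ) {w : List V} {i j : V}
    (h : wordProd Γ w (simpleRoot Γ i) = simpleRoot Γ j) :
    wordProd Γ w * simpleReflection Γ i = simpleReflection Γ j * wordProd Γ w := by
  have h1 : wordAct Γ w (Pi.single i 1) = Pi.single j 1 := by
    apply toWeight_injective hΓ
    rw [toWeight_wordAct, toWeight_single, toWeight_single, h]
  ext l : 1
  have h2 := wordProd_dotProduct_wordAct Γ w l (Pi.single i 1)
  rw [h1, dotProduct_single, dotProduct_single, mul_one, mul_one] at h2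
  rw [LinearEquiv.mul_apply, LinearEquiv.mul_apply, simpleReflection_apply,
    simpleReflection_apply, map_sub, map_smul, h, h2]

/-- The deletion condition. Read from the right, the image of α_i first stops being positive at some
letter j; just before, it equals α_j, so the letter j cancels against the new letter i. -/
theorem exists_shorter_word (hΓ : IsFiniteType Γ) {i : V} :
    ∀ {w : List V}, ¬ IsPosRoot Γ (wordProd Γ w (simpleRoot Γ i)) →
    ∃ w', wordProd Γ w' = wordProd Γ w * simpleReflection Γ i ∧ w'.length + 1 = w.length
  | [], h => (h (by simpa using isPosRoot_simpleRoot i)).elim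
  | j :: w, h => by
    by_cases hw : IsPosRoot Γ (wordProd Γ w (simpleRoot Γ i))
    · have hj : wordProd Γ w (simpleRoot Γ i) = simpleRoot Γ j := by
        by_contra hne
        exact h (by simpa using hw.simpleReflection hΓ hne)
      refine ⟨w, ?_, by simp⟩
      rw [wordProd_cons, mul_assoc, wordProd_mul_simpleReflection hΓ hj, ← mul_assoc,
        simpleReflection_mul_self, one_mul]
    · obtain ⟨w', h1, h2⟩ := exists_shorter_word hΓ hw
      exact ⟨j :: w', by rw [wordProd_cons, h1, wordProd_cons, mul_assoc], by simp [h2]⟩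

variable (Γ) in
/-- `w` is a reduced word for its product. -/
def IsReduced (w : List V) : Prop := IsReducedWord Γ w (wordProd Γ w)

theorem IsReduced.length_le {w w' : List V} (h : IsReduced Γ w)
    (h' : wordProd Γ w' = wordProd Γ w) : w.length ≤ w'.length := h.2 w' h'

theorem isReduced_of_length_le {w : List V}
    (h : ∀ w', wordProd Γ w' = wordProd Γ w → w.length ≤ w'.length) : IsReduced Γ w := ⟨rfl, h⟩

theorem isReduced_append_singleton (hΓ : IsFiniteType Γ) {w : List V} {i : V} :
    IsReduced Γ (w ++ [i]) ↔ IsReduced Γ w ∧ IsPosRoot Γ (wordProd Γ w (simpleRoot Γ i)) := by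
  constructor
  · intro h
    refine ⟨isReduced_of_length_le fun w' hw' => ?_, ?_⟩
    · have := h.length_le (w' := w' ++ [i]) (by simp [hw'])
      simpa using this
    · by_contra hneg
      obtain ⟨w', h1, h2⟩ := exists_shorter_word hΓ hneg
      have := h.length_le (w' := w') (by simp [h1])
      simp only [List.length_append, List.length_singleton] at this
      omega
  · rintro ⟨hw, hpos⟩
    refine isReduced_of_length_le fun v hv => ?_
    have hv' : wordProd Γ v = wordProd Γ w * simpleReflection Γ i := by simpa using hv
    by_contra hlt
    have hneg : ¬ IsPosRoot Γ (wordProd Γ v (simpleRoot Γ i)) := by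
      rw [hv', LinearEquiv.mul_apply, simpleReflection_simpleRoot_self, map_neg]
      exact hpos.not_neg hΓ
    obtain ⟨v', h1, h2⟩ := exists_shorter_word hΓ hneg
    have := hw.length_le (w' := v')
      (by rw [h1, hv', mul_assoc, simpleReflection_mul_self, mul_one])
    simp only [List.length_append, List.length_singleton] at hlt
    omega

theorem isReduced_iff_forall_split (hΓ : IsFiniteType Γ) {w : List V} :
    IsReduced Γ w ↔ ∀ u i v, w = u ++ i :: v → IsPosRoot Γ (wordProd Γ u (simpleRoot Γ i)) := by
  induction w using List.reverseRecOn with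
  | nil =>
    refine ⟨fun _ u i v h => by simp at h, fun _ => isReduced_of_length_le fun _ _ => by simp⟩
  | append_singleton w i ih =>
    rw [isReduced_append_singleton hΓ, ih]
    constructor
    · rintro ⟨h1, h2⟩ u j v h
      rcases List.eq_nil_or_concat v with rfl | ⟨v', k, rfl⟩
      · obtain ⟨rfl, h'⟩ := List.append_inj' h rfl
        simp only [List.cons.injEq, and_true] at h'
        exact h' ▸ h2
      · simp only [List.concat_eq_append] at h
        rw [← List.cons_append, ← List.append_assoc] at h
        obtain ⟨h', -⟩ := List.append_inj' h rfl
        exact h1 u j v' h'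
    · intro h
      refine ⟨fun u j v huv => h u j (v ++ [i]) (by simp [huv]), h w i [] rfl⟩

theorem IsReduced.of_append_right {u v : List V} (h : IsReduced Γ (u ++ v)) :
    IsReduced Γ v := by
  refine isReduced_of_length_le fun w' hw' => ?_
  have := h.length_le (w' := u ++ w') (by simp [hw'])
  simpa using this

theorem IsReduced.of_cons {i : V} {v : List V} (h : IsReduced Γ (i :: v)) : IsReduced Γ v :=
  IsReduced.of_append_right (u := [i]) h

theorem IsReduced.reverse {w : List V} (h : IsReduced Γ w) : IsReduced Γ w.reverse := by
  refine isReduced_of_length_le fun w' hw' => ?_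
  have := h.length_le (w' := w'.reverse)
    (by rw [wordProd_reverse, hw', wordProd_reverse, inv_inv])
  simpa using this

theorem IsReduced.isPosRoot_inv_of_cons (hΓ : IsFiniteType Γ) {i : V} {v : List V}
    (h : IsReduced Γ (i :: v)) : IsPosRoot Γ ((wordProd Γ v)⁻¹ (simpleRoot Γ i)) := by
  have := h.reverse
  rw [List.reverse_cons, isReduced_append_singleton hΓ, wordProd_reverse] at this
  exact this.2

theorem exists_isReduced {g : (V → ℤ) ≃ₗ[ℤ] (V → ℤ)} (hg : g ∈ weylGroup Γ) :
    ∃ w, wordProd Γ w = g ∧ IsReduced Γ w ∧ w.length = weylLength Γ g := by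
  obtain ⟨w, hw⟩ := (mem_weylGroup_iff Γ g).1 hg
  have hne : {l | ∃ w : List V, wordProd Γ w = g ∧ w.length = l}.Nonempty := ⟨_, w, hw, rfl⟩
  obtain ⟨u, hu, hl⟩ := Nat.sInf_mem hne
  exact ⟨u, hu, isReduced_of_length_le fun v hv => hl.trans_le (Nat.sInf_le ⟨v, hv.trans hu, rfl⟩),
    hl⟩

theorem IsReduced.length_eq {w w' : List V} (h : IsReduced Γ w) (h' : IsReduced Γ w')
    (he : wordProd Γ w = wordProd Γ w') : w.length = w'.length :=
  le_antisymm (h.length_le he.symm) (h'.length_le he)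

theorem IsReduced.weylLength_eq {w : List V} (h : IsReduced Γ w) :
    weylLength Γ (wordProd Γ w) = w.length := by
  obtain ⟨u, h1, h2, h3⟩ := exists_isReduced ((mem_weylGroup_iff Γ _).2 ⟨w, rfl⟩)
  rw [← h3]
  exact h2.length_eq h h1

theorem isPosRoot_neg_wordProd (hΓ : IsFiniteType Γ) {w : List V}
    (hw : ∀ i, IsPosRoot Γ (-wordProd Γ w (simpleRoot Γ i))) {β : V → ℤ}
    (hβ : IsPosRoot Γ β) : IsPosRoot Γ (-wordProd Γ w β) := by
  obtain ⟨E, hE⟩ := hΓ.exists_functional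
  refine (hβ.isRoot.wordProd w).neg.isPosRoot_of_map_pos hΓ E hE ?_
  have := hβ.map_pos (-(E.comp (wordProd Γ w).toLinearMap))
    (fun i => by simpa using (hw i).map_pos E hE)
  simpa using this

/-- Multiplying on the right by u lowers the length of w by one for each letter of u: the next root
of u is positive, and w makes it negative, so `exists_shorter_word` applies. -/
theorem exists_complement (hΓ : IsFiniteType Γ) {w : List V} (hred : IsReduced Γ w)
    (hw : ∀ i, IsPosRoot Γ (-wordProd Γ w (simpleRoot Γ i))) {u : List V} (hu : IsReduced Γ u) :
    ∃ v, IsReduced Γ v ∧ wordProd Γ v = wordProd Γ w * wordProd Γ u ∧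
      v.length + u.length = w.length := by
  induction u using List.reverseRecOn with
  | nil => exact ⟨w, hred, by simp, by simp⟩
  | append_singleton u i ih =>
    obtain ⟨h1, h2⟩ := (isReduced_append_singleton hΓ).1 hu
    obtain ⟨v, hv, hv1, hv2⟩ := ih h1
    have hneg : ¬ IsPosRoot Γ (wordProd Γ v (simpleRoot Γ i)) := by
      rw [hv1, LinearEquiv.mul_apply]
      have := (isPosRoot_neg_wordProd hΓ hw h2).not_neg hΓ
      rwa [neg_neg] at this
    obtain ⟨v', h3, h4⟩ := exists_shorter_word hΓ hneg
    refine ⟨v', isReduced_of_length_le fun x hx => ?_, by simp [h3, hv1, mul_assoc],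
      by simp only [List.length_append, List.length_singleton]; omega⟩
    have := hv.length_le (w' := x ++ [i])
      (by simp [hx, h3, mul_assoc, simpleReflection_mul_self])
    simp only [List.length_append, List.length_singleton] at this
    omega

/-- `longestElement` is chosen by `Classical.epsilon`, so uniqueness is required. The complement of
an element of maximal length is empty, so w times any such element is 1; this applies to w itself as
well. -/
theorem wordProd_eq_longestElement_of_isReduced (hΓ : IsFiniteType Γ) {w : List V}
    (hred : IsReduced Γ w) (hw : ∀ i, IsPosRoot Γ (-wordProd Γ w (simpleRoot Γ i))) :
    wordProd Γ w = longestElement Γ ∧ wordProd Γ w * wordProd Γ w = 1 := by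
  have hmax : ∀ g ∈ weylGroup Γ, weylLength Γ g ≤ w.length := by
    intro g hg
    obtain ⟨u, rfl, hu, hl⟩ := exists_isReduced hg
    obtain ⟨v, -, -, h⟩ := exists_complement hΓ hred hw hu
    omega
  have hlong : IsLongest Γ (wordProd Γ w) :=
    ⟨(mem_weylGroup_iff Γ _).2 ⟨w, rfl⟩, fun g hg => hred.weylLength_eq ▸ hmax g hg⟩
  have huniq : ∀ g, IsLongest Γ g → wordProd Γ w * g = 1 := by
    intro g hg
    obtain ⟨u, rfl, hu, hl⟩ := exists_isReduced hg.1
    obtain ⟨v, -, h1, h2⟩ := exists_complement hΓ hred hw hu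
    have h3 := hg.2 _ hlong.1
    rw [hred.weylLength_eq, ← hl] at h3
    have : v = [] := List.length_eq_zero_iff.1 (by omega)
    rw [← h1, this, wordProd_nil]
  have hself := huniq _ hlong
  refine ⟨?_, hself⟩
  have := huniq _ (Classical.epsilon_spec ⟨_, hlong⟩)
  exact mul_left_cancel (hself.trans this.symm)

/-- The Weyl group contains an element which maps all simple roots to negative roots. -/
def HasLongest (Γ : SimpleGraph V) : Prop :=
  ∃ w, ∀ i, IsPosRoot Γ (-wordProd Γ w (simpleRoot Γ i))

theorem wordProd_eq_longestElement (hΓ : IsFiniteType Γ) {w : List V}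
    (hw : ∀ i, IsPosRoot Γ (-wordProd Γ w (simpleRoot Γ i))) :
    wordProd Γ w = longestElement Γ := by
  obtain ⟨u, h1, h2, -⟩ := exists_isReduced ((mem_weylGroup_iff Γ _).2 ⟨w, rfl⟩)
  rw [← h1]
  exact (wordProd_eq_longestElement_of_isReduced hΓ h2 (fun i => h1 ▸ hw i)).1

theorem IsReducedWord.isReduced {w : List V} {g : (V → ℤ) ≃ₗ[ℤ] (V → ℤ)}
    (h : IsReducedWord Γ w g) : IsReduced Γ w := by
  obtain ⟨rfl, h⟩ := h; exact ⟨rfl, h⟩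

theorem IsReduced.isReducedWord {w : List V} {g : (V → ℤ) ≃ₗ[ℤ] (V → ℤ)} (h : IsReduced Γ w)
    (hg : wordProd Γ w = g) : IsReducedWord Γ w g := hg ▸ h

variable (Γ) in
theorem exists_isReducedWord_longestElement (hΓ : IsFiniteType Γ) (hL : HasLongest Γ) :
    ∃ w, IsReducedWord Γ w (longestElement Γ) := by
  obtain ⟨w, hw⟩ := hL
  obtain ⟨u, h1, h2, -⟩ := exists_isReduced ((mem_weylGroup_iff Γ _).2 ⟨w, rfl⟩)
  exact ⟨u, h2.isReducedWord (h1.trans (wordProd_eq_longestElement hΓ hw))⟩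

theorem isPosRoot_neg_longestElement (hΓ : IsFiniteType Γ) (hL : HasLongest Γ) {β : V → ℤ}
    (hβ : IsPosRoot Γ β) : IsPosRoot Γ (-longestElement Γ β) := by
  obtain ⟨w, hw⟩ := hL
  rw [← wordProd_eq_longestElement hΓ hw]
  exact isPosRoot_neg_wordProd hΓ hw hβ

theorem longestElement_mul_self (hΓ : IsFiniteType Γ) (hL : HasLongest Γ) :
    longestElement Γ * longestElement Γ = 1 := by
  obtain ⟨w, hw⟩ := exists_isReducedWord_longestElement Γ hΓ hL
  have h := (wordProd_eq_longestElement_of_isReduced hΓ hw.isReduced (fun i => by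
    rw [hw.1]; exact isPosRoot_neg_longestElement hΓ hL (isPosRoot_simpleRoot i))).2
  rwa [hw.1] at h

theorem longestElement_apply_apply (hΓ : IsFiniteType Γ) (hL : HasLongest Γ) (l : V → ℤ) :
    longestElement Γ (longestElement Γ l) = l := by
  rw [← LinearEquiv.mul_apply, longestElement_mul_self hΓ hL]; rfl

/-- Let Y be the nonnegative integer matrix of -w_0 in the simple roots. As Y² = 1 and all row sums
are at least 1, summing a row of Y² shows that each row sum is 1, so each row is a unit vector. -/
theorem exists_longestElement_simpleRoot (hΓ : IsFiniteType Γ) (hL : HasLongest Γ) (i : V) :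
    ∃ j, longestElement Γ (simpleRoot Γ i) = -simpleRoot Γ j := by
  have hpos : ∀ j, IsPosRoot Γ (-longestElement Γ (simpleRoot Γ j)) := fun j =>
    isPosRoot_neg_longestElement hΓ hL (isPosRoot_simpleRoot j)
  choose y hy0 hy1 hy2 using hpos
  have hysum : ∀ j, 1 ≤ ∑ k, y j k := by
    intro j
    have hne : y j ≠ 0 := fun h => by have := hy0 j; simp [h, rootNorm] at this
    obtain ⟨k, hk⟩ := Function.ne_iff.1 hne
    have : 0 < ∑ k, y j k := Finset.sum_pos' (fun k _ => hy1 j k)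
      ⟨k, Finset.mem_univ _, lt_of_le_of_ne (hy1 j k) (Ne.symm hk)⟩
    omega
  have hcomp : ∑ k, y i k • y k = Pi.single i 1 := by
    apply toWeight_injective hΓ
    rw [toWeight_single, map_sum]
    simp only [map_smul, ← hy2]
    have h1 := longestElement_apply_apply hΓ hL (simpleRoot Γ i)
    have h2 : longestElement Γ (simpleRoot Γ i) = -toWeight Γ (y i) := by rw [← hy2, neg_neg]
    conv_rhs => rw [← h1, h2, toWeight_eq_sum, map_neg, map_sum, ← Finset.sum_neg_distrib]
    exact Finset.sum_congr rfl fun k _ => by rw [map_smul, smul_neg]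
  have htot : ∑ k, y i k * ∑ j, y k j = 1 := by
    have := congrArg (fun z : V → ℤ => ∑ j, z j) hcomp
    simp only [Finset.sum_apply, Pi.smul_apply, smul_eq_mul, Finset.sum_pi_single',
      Finset.mem_univ, if_true] at this
    rw [← this, Finset.sum_comm]
    exact Finset.sum_congr rfl fun k _ => by rw [Finset.mul_sum]
  have hle : ∑ k, y i k ≤ 1 := by
    rw [← htot]
    exact Finset.sum_le_sum fun k _ => le_mul_of_one_le_right (hy1 i k) (hysum k)
  have hne : y i ≠ 0 := fun h => by have := hysum i; simp [h] at this
  obtain ⟨j, hj⟩ := Function.ne_iff.1 hne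
  have hj1 : 1 ≤ y i j := by
    have := hy1 i j
    simp only [Pi.zero_apply] at this hj
    omega
  have hzero : ∀ k, k ≠ j → y i k = 0 := by
    intro k hk
    have h1 : y i j + y i k ≤ ∑ k, y i k := by
      rw [← Finset.sum_pair (Ne.symm hk)]
      exact Finset.sum_le_sum_of_subset_of_nonneg (Finset.subset_univ _) fun _ _ _ => hy1 i _
    have := hy1 i k
    simp only [Pi.zero_apply] at this
    omega
  have h1 : y i j = 1 := by
    have : y i j ≤ ∑ k, y i k :=
      Finset.single_le_sum (f := y i) (fun k _ => hy1 i k) (Finset.mem_univ j)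
    omega
  refine ⟨j, ?_⟩
  have hy : y i = Pi.single j 1 := by
    funext k
    rcases eq_or_ne k j with rfl | hk
    · simp [h1]
    · simp [hzero k hk, Pi.single_eq_of_ne hk]
  rw [← toWeight_single Γ j, ← hy, ← hy2, neg_neg]

theorem longestElement_simpleRoot (hΓ : IsFiniteType Γ) (hL : HasLongest Γ) (i : V) :
    longestElement Γ (simpleRoot Γ i) = -simpleRoot Γ (starInvolution Γ i) :=
  @Classical.epsilon_spec V (fun j => longestElement Γ (simpleRoot Γ i) = -simpleRoot Γ j)
    (exists_longestElement_simpleRoot hΓ hL i)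

theorem starInvolution_eq (hΓ : IsFiniteType Γ) (hL : HasLongest Γ) {i j : V}
    (h : longestElement Γ (simpleRoot Γ i) = -simpleRoot Γ j) : starInvolution Γ i = j :=
  simpleRoot_injective Γ (neg_injective ((longestElement_simpleRoot hΓ hL i).symm.trans h))

theorem starInvolution_starInvolution (hΓ : IsFiniteType Γ) (hL : HasLongest Γ) (i : V) :
    starInvolution Γ (starInvolution Γ i) = i := by
  apply starInvolution_eq hΓ hL
  have h := longestElement_apply_apply hΓ hL (simpleRoot Γ i)
  rw [longestElement_simpleRoot hΓ hL, map_neg] at h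
  rw [← h, neg_neg]

theorem longestElement_mul_simpleReflection (hΓ : IsFiniteType Γ) (hL : HasLongest Γ) (i : V) :
    longestElement Γ * simpleReflection Γ (starInvolution Γ i) =
      simpleReflection Γ i * longestElement Γ := by
  obtain ⟨w, hw⟩ := exists_isReducedWord_longestElement Γ hΓ hL
  -- The element w_0 sends α_{i*} to -α_i; the additional letter i* corrects the sign, so that
  -- `wordProd_mul_simpleReflection` applies.
  have h : wordProd Γ (w ++ [starInvolution Γ i]) (simpleRoot Γ (starInvolution Γ i)) =
      simpleRoot Γ i := by
    rw [wordProd_append, hw.1, LinearEquiv.mul_apply, wordProd_cons, wordProd_nil, mul_one,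
      simpleReflection_simpleRoot_self, map_neg, longestElement_simpleRoot hΓ hL, neg_neg,
      starInvolution_starInvolution hΓ hL]
  have h1 := wordProd_mul_simpleReflection hΓ h
  simp only [wordProd_append, wordProd_cons, wordProd_nil, mul_one, hw.1, mul_assoc,
    simpleReflection_mul_self] at h1
  conv_rhs => rw [h1, ← mul_assoc, simpleReflection_mul_self, one_mul]

theorem starInvolution_adj (hΓ : IsFiniteType Γ) (hL : HasLongest Γ) (i j : V) :
    Γ.Adj (starInvolution Γ i) (starInvolution Γ j) ↔ Γ.Adj i j := by
  obtain ⟨w, hw⟩ := exists_isReducedWord_longestElement Γ hΓ hL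
  have hact : ∀ j, wordAct Γ w (Pi.single j 1) = -Pi.single (starInvolution Γ j) 1 := by
    intro j
    apply toWeight_injective hΓ
    rw [toWeight_wordAct, hw.1, toWeight_single, map_neg, toWeight_single,
      longestElement_simpleRoot hΓ hL]
  have key : ∀ i j, simpleRoot Γ (starInvolution Γ i) (starInvolution Γ j) =
      simpleRoot Γ i j := by
    intro i j
    have := wordProd_dotProduct_wordAct Γ w (simpleRoot Γ i) (Pi.single j 1)
    rwa [hw.1, longestElement_simpleRoot hΓ hL, hact, neg_dotProduct_neg, dotProduct_single,
      dotProduct_single, mul_one, mul_one] at this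
  have adj_iff : ∀ i j, Γ.Adj i j ↔ simpleRoot Γ i j = -1 := by
    intro i j
    refine ⟨simpleRoot_of_adj, fun h => by_contra fun h' => ?_⟩
    rcases eq_or_ne i j with rfl | hij
    · rw [simpleRoot_self] at h; norm_num at h
    · rw [simpleRoot_of_not_adj hij h'] at h; norm_num at h
  rw [adj_iff, adj_iff, key]

end Reduced

/-! ### Diagram automorphisms acting on weights -/

section DiagramAut

variable {V : Type*} {Γ : SimpleGraph V}

/-- The action on the weight lattice of a permutation of the vertices. -/
def permWeight (σ : Equiv.Perm V) : (V → ℤ) ≃ₗ[ℤ] (V → ℤ) := LinearEquiv.funCongrLeft ℤ ℤ σ⁻¹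

theorem permWeight_apply (σ : Equiv.Perm V) (l : V → ℤ) (j : V) :
    permWeight σ l j = l (σ⁻¹ j) := rfl

theorem permWeight_mul (σ τ : Equiv.Perm V) :
    permWeight (σ * τ) = permWeight σ * permWeight τ := by
  ext l j; simp [permWeight_apply, LinearEquiv.mul_apply]

theorem permWeight_one : permWeight (1 : Equiv.Perm V) = 1 := by
  ext l j; simp [permWeight_apply]

theorem permWeight_simpleRoot {σ : Equiv.Perm V} (hσ : ∀ i j, Γ.Adj (σ i) (σ j) ↔ Γ.Adj i j)
    (i : V) : permWeight σ (simpleRoot Γ i) = simpleRoot Γ (σ i) := by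
  funext j
  have h1 : σ⁻¹ j = i ↔ j = σ i := by rw [Equiv.Perm.inv_eq_iff_eq, eq_comm]
  have h2 : Γ.Adj i (σ⁻¹ j) ↔ Γ.Adj (σ i) j := by rw [← hσ]; simp
  simp only [permWeight_apply, simpleRoot]
  split_ifs <;> first | rfl | tauto

theorem permWeight_mul_simpleReflection {σ : Equiv.Perm V}
    (hσ : ∀ i j, Γ.Adj (σ i) (σ j) ↔ Γ.Adj i j) (i : V) :
    permWeight σ * simpleReflection Γ i = simpleReflection Γ (σ i) * permWeight σ := by
  ext l : 1
  rw [LinearEquiv.mul_apply, LinearEquiv.mul_apply, simpleReflection_apply,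
    simpleReflection_apply, map_sub, map_smul, permWeight_simpleRoot hσ, permWeight_apply σ l]
  simp

theorem wordProd_map {σ : Equiv.Perm V} (hσ : ∀ i j, Γ.Adj (σ i) (σ j) ↔ Γ.Adj i j)
    (w : List V) : wordProd Γ (w.map σ) * permWeight σ = permWeight σ * wordProd Γ w := by
  induction w with
  | nil => simp
  | cons i w ih =>
    rw [List.map_cons, wordProd_cons, wordProd_cons, mul_assoc, ih, ← mul_assoc, ← mul_assoc,
      permWeight_mul_simpleReflection hσ]

/-- The conjugate of w_0 by σ also sends simple roots to negatives of simple roots, hence equals w_0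
by uniqueness. -/
theorem starInvolution_perm [Fintype V] [DecidableEq V] (hΓ : IsFiniteType Γ)
    (hL : HasLongest Γ) {σ : Equiv.Perm V} (hσ : ∀ i j, Γ.Adj (σ i) (σ j) ↔ Γ.Adj i j) (i : V) :
    starInvolution Γ (σ i) = σ (starInvolution Γ i) := by
  obtain ⟨w, hw⟩ := exists_isReducedWord_longestElement Γ hΓ hL
  have h1 : ∀ i, wordProd Γ (w.map σ) (simpleRoot Γ (σ i)) =
      -simpleRoot Γ (σ (starInvolution Γ i)) := by
    intro i
    rw [← permWeight_simpleRoot hσ, ← LinearEquiv.mul_apply, wordProd_map hσ,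
      LinearEquiv.mul_apply, hw.1, longestElement_simpleRoot hΓ hL, map_neg,
      permWeight_simpleRoot hσ]
  apply starInvolution_eq hΓ hL
  rw [← h1, ← wordProd_eq_longestElement hΓ (w := w.map σ)]
  intro j
  obtain ⟨i, rfl⟩ := σ.surjective j
  rw [h1, neg_neg]
  exact isPosRoot_simpleRoot _

end DiagramAut

/-! ### The positive roots enumerated by a reduced word -/

section WordRoots

variable {V : Type*} [Fintype V] [DecidableEq V] {Γ : SimpleGraph V}

theorem split_at (w : List V) (k : Fin w.length) :
    w = w.take k ++ w.get k :: w.drop (k + 1) := by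
  simp

theorem isPosRoot_wordRoot (hΓ : IsFiniteType Γ) {w : List V} (hw : IsReduced Γ w)
    (k : Fin w.length) : IsPosRoot Γ (wordRoot Γ w k) :=
  (isReduced_iff_forall_split hΓ).1 hw _ _ _ (split_at w k)

/-- When the letters of w are applied to β from the left, β can leave the positive roots only by
being the simple root of the current letter, and then it is the root of that position. -/
theorem exists_wordRoot_eq (hΓ : IsFiniteType Γ) :
    ∀ (w : List V) {β : V → ℤ}, IsPosRoot Γ β → ¬ IsPosRoot Γ ((wordProd Γ w)⁻¹ β) →
      ∃ k, wordRoot Γ w k = β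
  | [], β, h1, h2 => (h2 (by simpa using h1)).elim
  | i :: w, β, h1, h2 => by
    by_cases h : β = simpleRoot Γ i
    · exact ⟨⟨0, by simp⟩, by simp [wordRoot, h]⟩
    · have h3 : ¬ IsPosRoot Γ ((wordProd Γ w)⁻¹ (simpleReflection Γ i β)) := by
        rwa [wordProd_cons, mul_inv_rev, simpleReflection_inv, LinearEquiv.mul_apply] at h2
      obtain ⟨k, hk⟩ := exists_wordRoot_eq hΓ w (h1.simpleReflection hΓ h) h3
      refine ⟨⟨k + 1, by simp⟩, ?_⟩
      have : wordRoot Γ (i :: w) ⟨k + 1, by simp⟩ = simpleReflection Γ i (wordRoot Γ w k) := by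
        simp [wordRoot]
      rw [this, hk, ← LinearEquiv.mul_apply, simpleReflection_mul_self]; rfl

/-- If positions j < k had equal roots, the letters strictly between them would carry the simple
root of position k to a negative root, although this segment followed by the k-th letter is reduced.
-/
theorem wordRoot_injective (hΓ : IsFiniteType Γ) {w : List V} (hw : IsReduced Γ w) :
    Function.Injective (wordRoot Γ w) := by
  have key : ∀ j k : Fin w.length, j < k → wordRoot Γ w j ≠ wordRoot Γ w k := by
    intro j k hjk h
    obtain ⟨v, hv⟩ : ∃ v, w.take k = w.take j ++ w.get j :: v := by
      have h1 : (w.take k).take j = w.take j := by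
        rw [List.take_take, min_eq_left (Fin.le_def.1 hjk.le)]
      have h2 := split_at (w.take k) ⟨j, by simpa using Fin.lt_def.1 hjk⟩
      simp only [h1] at h2
      exact ⟨_, by simpa using h2⟩
    have hw1 : w = w.take j ++ ([w.get j] ++ v ++ w.get k :: w.drop (k + 1)) := by
      conv_lhs => rw [split_at w k, hv]
      simp
    have h2 : simpleRoot Γ (w.get j) =
        wordProd Γ (w.get j :: v) (simpleRoot Γ (w.get k)) := by
      have := h
      simp only [wordRoot, hv, wordProd_append, LinearEquiv.mul_apply] at this
      exact (wordProd Γ _).injective this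
    have hred : IsReduced Γ (v ++ w.get k :: w.drop (k + 1)) := by
      rw [hw1] at hw
      exact hw.of_append_right.of_cons
    have h3 := (isReduced_iff_forall_split hΓ).1 hred _ _ _ rfl
    have h4 : wordProd Γ v (simpleRoot Γ (w.get k)) = -simpleRoot Γ (w.get j) := by
      rw [← simpleReflection_simpleRoot_self, h2, wordProd_cons, LinearEquiv.mul_apply,
        ← LinearEquiv.mul_apply, simpleReflection_mul_self]; rfl
    rw [h4] at h3
    exact (isPosRoot_simpleRoot _).not_neg hΓ h3
  intro j k h
  rcases lt_trichotomy j k with hlt | heq | hlt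
  · exact (key j k hlt h).elim
  · exact heq
  · exact (key k j hlt h.symm).elim

theorem mem_closure_simpleRoot_iff {β : V → ℤ} :
    β ∈ AddSubmonoid.closure (Set.range (simpleRoot Γ)) ↔ ∃ x, 0 ≤ x ∧ β = toWeight Γ x := by
  constructor
  · intro h
    induction h using AddSubmonoid.closure_induction with
    | mem β hβ =>
      obtain ⟨i, rfl⟩ := hβ
      exact ⟨Pi.single i 1, by simp, by simp⟩
    | zero => exact ⟨0, le_rfl, by simp⟩
    | add a b _ _ ha hb =>
      obtain ⟨x, hx, rfl⟩ := ha
      obtain ⟨y, hy, rfl⟩ := hb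
      exact ⟨x + y, add_nonneg hx hy, by simp⟩
  · rintro ⟨x, hx, rfl⟩
    rw [toWeight_eq_sum]
    refine sum_mem fun i _ => ?_
    obtain ⟨n, hn⟩ := Int.eq_ofNat_of_zero_le (hx i)
    rw [hn, natCast_zsmul]
    exact nsmul_mem (AddSubmonoid.subset_closure (Set.mem_range_self i)) n

theorem isPosRoot_of_mem_positiveRoots (hΓ : IsFiniteType Γ) {β : V → ℤ}
    (h : β ∈ positiveRoots Γ) : IsPosRoot Γ β := by
  obtain ⟨⟨g, hg, i, rfl⟩, h2⟩ := h
  obtain ⟨w, rfl⟩ := (mem_weylGroup_iff Γ g).1 hg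
  obtain ⟨x, hx, hx'⟩ := mem_closure_simpleRoot_iff.1 h2
  obtain ⟨y, hy, hy'⟩ := (isPosRoot_simpleRoot i).isRoot.wordProd w
  have := toWeight_injective hΓ (hy'.symm.trans hx')
  exact ⟨y, hy, this ▸ hx, hy'⟩

theorem wordRoot_mem_positiveRoots (hΓ : IsFiniteType Γ) {w : List V} (hw : IsReduced Γ w)
    (k : Fin w.length) : wordRoot Γ w k ∈ positiveRoots Γ := by
  refine ⟨⟨wordProd Γ (w.take k), (mem_weylGroup_iff Γ _).2 ⟨_, rfl⟩, w.get k, rfl⟩, ?_⟩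
  obtain ⟨x, -, h1, h2⟩ := isPosRoot_wordRoot hΓ hw k
  rw [h2, SetLike.mem_coe]
  exact mem_closure_simpleRoot_iff.2 ⟨x, h1, rfl⟩

/-- The positions of a reduced word for the longest element correspond to the positive roots. -/
theorem wordRoot_bijective (hΓ : IsFiniteType Γ) (hL : HasLongest Γ) {w : List V}
    (hw : IsReducedWord Γ w (longestElement Γ)) :
    Function.Bijective fun k : Fin w.length =>
      (⟨wordRoot Γ w k, wordRoot_mem_positiveRoots hΓ hw.isReduced k⟩ : positiveRoots Γ) := by
  constructor
  · intro j k h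
    exact wordRoot_injective hΓ hw.isReduced (congrArg Subtype.val h)
  · rintro ⟨β, hβ⟩
    have h1 := isPosRoot_of_mem_positiveRoots hΓ hβ
    have h2 : (wordProd Γ w)⁻¹ = longestElement Γ := by
      rw [hw.1]; exact inv_eq_of_mul_eq_one_left (longestElement_mul_self hΓ hL)
    obtain ⟨k, hk⟩ := exists_wordRoot_eq hΓ w h1 (by
      rw [h2]
      have := (isPosRoot_neg_longestElement hΓ hL h1).not_neg hΓ
      rwa [neg_neg] at this)
    exact ⟨k, Subtype.ext hk⟩

end WordRoots

end QData

namespace QData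

/-! ### Cuts of the repetition quiver and adapted words -/

section Cuts

variable {V : Type*} [Fintype V] [DecidableEq V] (Γ : SimpleGraph V) (σ : Equiv.Perm V)

variable {σ} in
theorem orbitSize_eq_of_sameCycle {i j : V} (h : σ.SameCycle i j) :
    orbitSize σ i = orbitSize σ j := by
  have : {k | σ.SameCycle i k} = {k | σ.SameCycle j k} := by
    ext k; exact ⟨fun h' => h.symm.trans h', fun h' => h.trans h'⟩
  rw [orbitSize, this, orbitSize]

theorem orbitSize_apply (i : V) : orbitSize σ (σ i) = orbitSize σ i :=
  (orbitSize_eq_of_sameCycle ⟨1, by simp⟩).symm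

theorem orbitSize_pos (i : V) : 0 < orbitSize σ i :=
  (Set.ncard_pos (Set.toFinite _)).2 ⟨i, Equiv.Perm.SameCycle.refl σ i⟩

theorem orbitSize_cast_pos (i : V) : 0 < (orbitSize σ i : ℤ) := by
  exact_mod_cast orbitSize_pos σ i

/-- The height functions of Q-data, described as the upper boundaries of the order ideals of the
repetition quiver; the sizes of the orbits of adjacent vertices have to divide one another. -/
structure IsCut (ξ : V → ℤ) : Prop where
  orbit_dvd : ∀ i j, Γ.Adj i j → orbitSize σ i ≤ orbitSize σ j → orbitSize σ i ∣ orbitSize σ j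
  shift : ∀ i, 2 * (orbitSize σ i : ℤ) ∣ ξ (σ i) - ξ i + 2
  dvd : ∀ i j, Γ.Adj i j → orbitSize σ i ≤ orbitSize σ j →
    2 * (orbitSize σ i : ℤ) ∣ ξ j - ξ i - orbitSize σ i
  le_add : ∀ i j, Γ.Adj i j → orbitSize σ i ≤ orbitSize σ j → ξ j ≤ ξ i + orbitSize σ i
  le_add' : ∀ i j, Γ.Adj i j → orbitSize σ i ≤ orbitSize σ j →
    ξ i ≤ ξ j + 2 * orbitSize σ j - orbitSize σ i

/-- Heights of adjacent vertices differ by odd multiples of the smaller orbit size d; this is how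
strict inequalities become gaps of at least d. -/
theorem le_of_odd_multiple {d x : ℤ} (hd : 0 < d) (h : 2 * d ∣ x - d) (hx : 0 < x) : d ≤ x := by
  obtain ⟨k, hk⟩ := h
  by_contra hlt
  rcases lt_or_ge k 0 with h' | h'
  · have : d * (k + 1) ≤ 0 := mul_nonpos_of_nonneg_of_nonpos hd.le (by omega)
    nlinarith
  · have := mul_nonneg hd.le h'
    nlinarith

theorem dvd_of_dvd_of_eq {a b c : ℤ} (h : a ∣ b) (e : c = b) : a ∣ c := e ▸ h

theorem odd_multiple_neg {d x : ℤ} (h : 2 * d ∣ x - d) : 2 * d ∣ -x - d := by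
  have h2 := (dvd_add h (dvd_refl (2 * d))).neg_right
  exact dvd_of_dvd_of_eq (h2) (by ring)

theorem odd_multiple_ne_zero {d x : ℤ} (hd : 0 < d) (h : 2 * d ∣ x - d) : x ≠ 0 := by
  rintro rfl
  obtain ⟨k, hk⟩ := h
  rcases lt_trichotomy k 0 with h' | h' | h'
  · have := mul_nonneg hd.le (show 0 ≤ -1 - k by omega); nlinarith
  · subst h'; omega
  · have := mul_pos hd h'; nlinarith

variable {Γ σ} {ξ : V → ℤ}

namespace IsCut

/-- The congruence for adjacent vertices, in a form symmetric in the two orbit sizes. -/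
theorem dvd_min (h : IsCut Γ σ ξ) {i j : V} (hij : Γ.Adj i j) :
    2 * min (orbitSize σ i : ℤ) (orbitSize σ j) ∣
      ξ j - ξ i - min (orbitSize σ i : ℤ) (orbitSize σ j) := by
  rcases le_total (orbitSize σ i) (orbitSize σ j) with hd | hd
  · rw [min_eq_left (by exact_mod_cast hd)]
    exact h.dvd i j hij hd
  · rw [min_eq_right (by exact_mod_cast hd)]
    have := odd_multiple_neg (h.dvd j i hij.symm hd)
    rwa [neg_sub] at this

theorem min_pos (i j : V) : 0 < min (orbitSize σ i : ℤ) (orbitSize σ j) :=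
  lt_min (orbitSize_cast_pos σ i) (orbitSize_cast_pos σ j)

/-- The number ξ_i + 2d_i is the first vertex of column i outside the ideal; it must lie at least
min(d_i, d_j) above the top of column j. This one form covers `le_add` and `le_add'`. -/
theorem le_bound (h : IsCut Γ σ ξ) {i j : V} (hij : Γ.Adj i j) :
    ξ j ≤ ξ i + 2 * orbitSize σ i - min (orbitSize σ i : ℤ) (orbitSize σ j) := by
  rcases le_total (orbitSize σ i) (orbitSize σ j) with hd | hd
  · rw [min_eq_left (by exact_mod_cast hd)]
    have := h.le_add i j hij hd
    omega
  · rw [min_eq_right (by exact_mod_cast hd)]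
    exact h.le_add' j i hij.symm hd

theorem of_bounds
    (h0 : ∀ i j, Γ.Adj i j → orbitSize σ i ≤ orbitSize σ j → orbitSize σ i ∣ orbitSize σ j)
    (h1 : ∀ i, 2 * (orbitSize σ i : ℤ) ∣ ξ (σ i) - ξ i + 2)
    (h2 : ∀ i j, Γ.Adj i j → 2 * min (orbitSize σ i : ℤ) (orbitSize σ j) ∣
      ξ j - ξ i - min (orbitSize σ i : ℤ) (orbitSize σ j))
    (h3 : ∀ i j, Γ.Adj i j →
      ξ j ≤ ξ i + 2 * orbitSize σ i - min (orbitSize σ i : ℤ) (orbitSize σ j)) :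
    IsCut Γ σ ξ where
  orbit_dvd := h0
  shift := h1
  dvd i j hij hd := by
    have := h2 i j hij
    rwa [min_eq_left (by exact_mod_cast hd)] at this
  le_add i j hij hd := by
    have := h3 i j hij
    rw [min_eq_left (by exact_mod_cast hd)] at this
    omega
  le_add' i j hij hd := by
    have := h3 j i hij.symm
    rwa [min_eq_right (by exact_mod_cast hd)] at this

theorem ne (h : IsCut Γ σ ξ) {i j : V} (hij : Γ.Adj i j) : ξ i ≠ ξ j := by
  intro he
  exact odd_multiple_ne_zero (min_pos i j) (h.dvd_min hij) (by omega)

theorem add_min_le (h : IsCut Γ σ ξ) {i j : V} (hij : Γ.Adj i j) (hlt : ξ j < ξ i) :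
    ξ j + min (orbitSize σ i : ℤ) (orbitSize σ j) ≤ ξ i := by
  have h1 := odd_multiple_neg (h.dvd_min hij)
  have h2 := le_of_odd_multiple (min_pos i j) h1 (by omega)
  omega

theorem congr_of_dvd {ξ' : V → ℤ} (h : IsCut Γ σ ξ) (h' : ∀ i, 2 * (orbitSize σ i : ℤ) ∣ ξ' i - ξ i)
    (h3 : ∀ i j, Γ.Adj i j →
      ξ' j ≤ ξ' i + 2 * orbitSize σ i - min (orbitSize σ i : ℤ) (orbitSize σ j)) :
    IsCut Γ σ ξ' := by
  refine of_bounds h.orbit_dvd (fun i => ?_) (fun i j hij => ?_) h3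
  · have h4 := h' (σ i)
    rw [orbitSize_apply] at h4
    have h5 := dvd_add (dvd_sub h4 (h' i)) (h.shift i)
    exact dvd_of_dvd_of_eq (h5) (by ring)
  · have h4 : 2 * min (orbitSize σ i : ℤ) (orbitSize σ j) ∣ 2 * (orbitSize σ i : ℤ) ∧
        2 * min (orbitSize σ i : ℤ) (orbitSize σ j) ∣ 2 * (orbitSize σ j : ℤ) := by
      rcases le_total (orbitSize σ i) (orbitSize σ j) with hle | hle
      · rw [min_eq_left (by exact_mod_cast hle)]
        exact ⟨dvd_rfl, mul_dvd_mul_left 2 (by exact_mod_cast h.orbit_dvd i j hij hle)⟩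
      · rw [min_eq_right (by exact_mod_cast hle)]
        exact ⟨mul_dvd_mul_left 2 (by exact_mod_cast h.orbit_dvd j i hij.symm hle), dvd_rfl⟩
    have h5 := dvd_add (dvd_sub (h4.2.trans (h' j)) (h4.1.trans (h' i))) (h.dvd_min hij)
    exact dvd_of_dvd_of_eq (h5) (by ring)

theorem add_const (h : IsCut Γ σ ξ) (c : ℤ) : IsCut Γ σ (fun i => ξ i + c) := by
  refine of_bounds h.orbit_dvd (fun i => ?_) (fun i j hij => ?_) (fun i j hij => ?_)
  · exact dvd_of_dvd_of_eq (h.shift i) (by ring)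
  · exact dvd_of_dvd_of_eq (h.dvd_min hij) (by ring)
  · have := h.le_bound hij; omega

end IsCut

variable (σ) in
/-- The height function obtained from `ξ` by applying the letters of `u`. -/
noncomputable def heightAfter (ξ : V → ℤ) (u : List V) : V → ℤ :=
  fun i => ξ i - 2 * (orbitSize σ i : ℤ) * u.count i

@[simp] theorem heightAfter_nil (ξ : V → ℤ) : heightAfter σ ξ [] = ξ := by
  funext i; simp [heightAfter]

theorem heightAfter_cons (ξ : V → ℤ) (i : V) (u : List V) :
    heightAfter σ ξ (i :: u) = heightAfter σ (reflectHeight σ ξ i) u := by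
  funext j
  simp only [heightAfter, reflectHeight, List.count_cons, beq_iff_eq]
  split_ifs <;> push_cast <;> ring

theorem heightAfter_append (ξ : V → ℤ) (u v : List V) :
    heightAfter σ ξ (u ++ v) = heightAfter σ (heightAfter σ ξ u) v := by
  funext j
  simp only [heightAfter, List.count_append]
  push_cast; ring

theorem heightAfter_add_const (ξ : V → ℤ) (c : ℤ) (u : List V) :
    heightAfter σ (fun i => ξ i + c) u = fun i => heightAfter σ ξ u i + c := by
  funext j; simp only [heightAfter]; ring

theorem heightAfter_le (ξ : V → ℤ) (u : List V) (i : V) : heightAfter σ ξ u i ≤ ξ i := by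
  have := mul_nonneg (mul_nonneg zero_le_two (orbitSize_cast_pos σ i).le)
    (Int.natCast_nonneg (u.count i))
  simp only [heightAfter]; linarith

theorem heightAfter_of_notMem (ξ : V → ℤ) {u : List V} {i : V} (h : i ∉ u) :
    heightAfter σ ξ u i = ξ i := by
  simp [heightAfter, List.count_eq_zero_of_not_mem h]

theorem reflectHeight_of_ne (ξ : V → ℤ) {i j : V} (h : i ≠ j) :
    reflectHeight σ ξ i j = ξ j := by
  simp [reflectHeight, h]

theorem reflectHeight_self (ξ : V → ℤ) (i : V) :
    reflectHeight σ ξ i i = ξ i - 2 * orbitSize σ i := by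
  simp [reflectHeight]

theorem reflectHeight_le (ξ : V → ℤ) (i j : V) : reflectHeight σ ξ i j ≤ ξ j := by
  rw [← heightAfter_nil (σ := σ) (reflectHeight σ ξ i), ← heightAfter_cons]
  exact heightAfter_le ξ [i] j

theorem adapted_append (ξ : V → ℤ) (u v : List V) :
    Adapted Γ σ ξ (u ++ v) ↔ Adapted Γ σ ξ u ∧ Adapted Γ σ (heightAfter σ ξ u) v := by
  induction u generalizing ξ with
  | nil => simp [Adapted]
  | cons i u ih => simp only [List.cons_append, Adapted, ih, heightAfter_cons, and_assoc]

theorem adapted_singleton (ξ : V → ℤ) (i : V) : Adapted Γ σ ξ [i] ↔ IsSource Γ ξ i := by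
  simp [Adapted]

theorem adapted_iff_forall_split (ξ : V → ℤ) (w : List V) :
    Adapted Γ σ ξ w ↔ ∀ u i v, w = u ++ i :: v → IsSource Γ (heightAfter σ ξ u) i := by
  constructor
  · rintro h u i v rfl
    exact ((adapted_append ξ u (i :: v)).1 h).2.1
  · induction w generalizing ξ with
    | nil => simp [Adapted]
    | cons j w ih =>
      intro h
      refine ⟨by simpa using h [] j w rfl, ih _ fun u i v huv => ?_⟩
      have := h (j :: u) i v (by rw [huv]; rfl)
      rwa [heightAfter_cons] at this

theorem IsCut.reflectHeight (h : IsCut Γ σ ξ) {i : V}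
    (hi : IsSource Γ ξ i) : IsCut Γ σ (reflectHeight σ ξ i) := by
  refine h.congr_of_dvd (fun j => ?_) (fun a b hab => ?_)
  · simp only [QData.reflectHeight]
    split_ifs
    · exact ⟨-1, by ring⟩
    · simp
  · rcases eq_or_ne i a with rfl | ha
    · rw [reflectHeight_self, reflectHeight_of_ne _ hab.ne]
      have := h.add_min_le hab (hi b hab)
      omega
    · rw [reflectHeight_of_ne _ ha]
      have := h.le_bound hab
      have := reflectHeight_le (σ := σ) ξ i b
      omega

theorem IsCut.heightAfter (h : IsCut Γ σ ξ) {u : List V} (hu : Adapted Γ σ ξ u) :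
    IsCut Γ σ (heightAfter σ ξ u) := by
  induction u generalizing ξ with
  | nil => simpa using h
  | cons i u ih =>
    rw [heightAfter_cons]
    exact ih (h.reflectHeight hu.1) hu.2

/-! ### Commutation of adapted words -/

theorem isSource_reflectHeight_iff {i j : V} (hij : i ≠ j) (h : ¬ Γ.Adj i j) :
    IsSource Γ (reflectHeight σ ξ i) j ↔ IsSource Γ ξ j := by
  refine forall_congr' fun k => imp_congr_right fun hk => ?_
  rw [reflectHeight_of_ne _ hij, reflectHeight_of_ne _ (fun e : i = k => h (e ▸ hk.symm))]

theorem CommStep.cons {w w' : List V} (i : V) (h : CommStep Γ w w') :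
    CommStep Γ (i :: w) (i :: w') := by
  obtain ⟨u, v, a, b, hab⟩ := h
  exact CommStep.swap (i :: u) v a b hab

theorem eqvGen_commStep_cons {w w' : List V} (i : V)
    (h : Relation.EqvGen (CommStep Γ) w w') :
    Relation.EqvGen (CommStep Γ) (i :: w) (i :: w') := by
  induction h with
  | rel _ _ h => exact .rel _ _ (h.cons i)
  | refl => exact .refl _
  | symm _ _ _ ih => exact .symm _ _ ih
  | trans _ _ _ _ _ ih1 ih2 => exact .trans _ _ _ ih1 ih2

/-- A property which is invariant under the exchange of commuting entries is constant on
commutation classes. -/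
theorem eqvGen_commStep_invariant {α : Sort*} (f : List V → α)
    (hf : ∀ u v i j, ¬ Γ.Adj i j → f (u ++ i :: j :: v) = f (u ++ j :: i :: v)) {w w' : List V}
    (h : Relation.EqvGen (CommStep Γ) w w') : f w = f w' := by
  induction h with
  | rel _ _ h => obtain ⟨u, v, i, j, hij⟩ := h; exact hf u v i j hij
  | refl => rfl
  | symm _ _ _ ih => exact ih.symm
  | trans _ _ _ _ _ ih1 ih2 => exact ih1.trans ih2

theorem wordProd_eq_of_eqvGen {w w' : List V} (h : Relation.EqvGen (CommStep Γ) w w') :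
    wordProd Γ w = wordProd Γ w' := by
  refine eqvGen_commStep_invariant (wordProd Γ) (fun u v i j hij => ?_) h
  simp only [wordProd_append, wordProd_cons]
  rw [← mul_assoc (simpleReflection Γ i), simpleReflection_commute hij, mul_assoc]

theorem length_eq_of_eqvGen {w w' : List V} (h : Relation.EqvGen (CommStep Γ) w w') :
    w.length = w'.length :=
  eqvGen_commStep_invariant List.length (fun u v i j hij => by simp) h

theorem count_eq_of_eqvGen {w w' : List V} (h : Relation.EqvGen (CommStep Γ) w w') (k : V) :
    w.count k = w'.count k :=
  eqvGen_commStep_invariant (List.count k)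
    (fun u v i j hij => by simp only [List.count_append, List.count_cons]; ring) h

theorem heightAfter_eq_of_eqvGen {w w' : List V} (h : Relation.EqvGen (CommStep Γ) w w')
    (ξ : V → ℤ) : heightAfter σ ξ w = heightAfter σ ξ w' := by
  funext i; simp only [QData.heightAfter, count_eq_of_eqvGen h]

theorem adapted_iff_of_eqvGen {w w' : List V} (h : Relation.EqvGen (CommStep Γ) w w')
    (ξ : V → ℤ) : Adapted Γ σ ξ w ↔ Adapted Γ σ ξ w' := by
  refine iff_of_eq (eqvGen_commStep_invariant (Adapted Γ σ ξ) (fun u v i j hij => ?_) h)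
  rcases eq_or_ne i j with rfl | hne
  · rfl
  rw [adapted_append, adapted_append]
  generalize QData.heightAfter σ ξ u = ζ
  have hcomm : QData.reflectHeight σ (QData.reflectHeight σ ζ i) j =
      QData.reflectHeight σ (QData.reflectHeight σ ζ j) i := by
    funext k; simp only [QData.reflectHeight]; ring
  simp only [Adapted, isSource_reflectHeight_iff hne hij,
    isSource_reflectHeight_iff hne.symm (fun h => hij h.symm), hcomm]
  exact propext (by tauto)

theorem isReducedWord_iff_of_eqvGen {w w' : List V} (h : Relation.EqvGen (CommStep Γ) w w')
    (g : (V → ℤ) ≃ₗ[ℤ] (V → ℤ)) : IsReducedWord Γ w g ↔ IsReducedWord Γ w' g := by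
  simp only [IsReducedWord, wordProd_eq_of_eqvGen h, length_eq_of_eqvGen h]

theorem eqvGen_move_front {i : V} {a : List V} (ha : ∀ j ∈ a, ¬ Γ.Adj i j) (b : List V) :
    Relation.EqvGen (CommStep Γ) (a ++ i :: b) (i :: (a ++ b)) := by
  induction a with
  | nil => exact .refl _
  | cons j a ih =>
    refine .trans _ _ _ (eqvGen_commStep_cons j (ih fun k hk => ha k (List.mem_cons_of_mem _ hk)))
      (.rel _ _ (CommStep.swap [] (a ++ b) j i fun h => ha j List.mem_cons_self h.symm))

/-- Two sources are never adjacent, and reflecting at one leaves the other a source. So a source i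
stays a source, and commutes with every letter applied, until i itself occurs. -/
theorem not_adj_of_isSource {i : V} {a : List V} (hi : IsSource Γ ξ i)
    (ha : Adapted Γ σ ξ a) (hia : i ∉ a) : ∀ j ∈ a, ¬ Γ.Adj i j := by
  induction a generalizing ξ with
  | nil => simp
  | cons k a ih =>
    obtain ⟨hk, ha⟩ := ha
    have hik : i ≠ k := fun e => hia (e ▸ List.mem_cons_self)
    have h1 : ¬ Γ.Adj i k := fun h => lt_asymm (hi k h) (hk i h.symm)
    have h2 : IsSource Γ (QData.reflectHeight σ ξ k) i :=
      (isSource_reflectHeight_iff hik.symm fun h => h1 h.symm).2 hi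
    intro j hj
    rcases List.mem_cons.1 hj with rfl | hj
    · exact h1
    · exact ih h2 ha (fun h => hia (List.mem_cons_of_mem _ h)) j hj

theorem exists_eqvGen_cons {i : V} {w : List V} (hi : IsSource Γ ξ i) (hw : Adapted Γ σ ξ w)
    (hiw : i ∈ w) : ∃ u, Relation.EqvGen (CommStep Γ) w (i :: u) := by
  obtain ⟨a, b, rfl, ha⟩ := List.eq_append_cons_of_mem hiw
  exact ⟨a ++ b, eqvGen_move_front
    (not_adj_of_isSource hi ((adapted_append ξ a (i :: b)).1 hw).1 ha) b⟩

theorem wordProd_simpleRoot_of_not_mem {i : V} {w : List V} (hiw : i ∉ w)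
    (h : ∀ j ∈ w, ¬ Γ.Adj i j) : wordProd Γ w (simpleRoot Γ i) = simpleRoot Γ i := by
  induction w with
  | nil => rfl
  | cons j w ih =>
    rw [wordProd_cons, LinearEquiv.mul_apply, ih (fun h' => hiw (List.mem_cons_of_mem _ h'))
      (fun k hk => h k (List.mem_cons_of_mem _ hk)), simpleReflection_simpleRoot_of_not_adj]
    · rintro rfl; exact hiw List.mem_cons_self
    · exact fun h' => h j List.mem_cons_self h'.symm

/-- Adapted words with the same content are commutation equivalent. -/
theorem eqvGen_of_perm {w w' : List V} (hw : Adapted Γ σ ξ w) (hw' : Adapted Γ σ ξ w')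
    (h : w.Perm w') : Relation.EqvGen (CommStep Γ) w w' := by
  induction w generalizing ξ w' with
  | nil => rw [List.nil_perm] at h; rw [h]; exact .refl _
  | cons i w ih =>
    obtain ⟨u, hu⟩ := exists_eqvGen_cons hw.1 hw' (h.subset List.mem_cons_self)
    have hperm : (i :: w).Perm (i :: u) := h.trans (List.perm_iff_count.2 (count_eq_of_eqvGen hu))
    refine .trans _ _ _ (eqvGen_commStep_cons i (ih hw.2 ?_ hperm.cons_inv)) (.symm _ _ hu)
    exact ((adapted_iff_of_eqvGen hu ξ).1 hw').2

/-- Adapted reduced words for the same element are commutation equivalent. -/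
theorem eqvGen_of_wordProd_eq (hΓ : IsFiniteType Γ) {w w' : List V} (hw : Adapted Γ σ ξ w)
    (hw' : Adapted Γ σ ξ w') (hred : IsReduced Γ w) (hred' : IsReduced Γ w')
    (h : wordProd Γ w = wordProd Γ w') : Relation.EqvGen (CommStep Γ) w w' := by
  induction w generalizing ξ w' with
  | nil =>
    have := hred.length_eq hred' h
    rw [List.length_nil, eq_comm, List.length_eq_zero_iff] at this
    rw [this]; exact .refl _
  | cons i w ih =>
    -- Otherwise i commutes with all of w', so the common product fixes α_i. Then w sends α_i to
    -- -α_i, whereas reducedness of i :: w requires its inverse to send α_i to a positive root.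
    have hi : i ∈ w' := by
      by_contra hi
      have h1 := wordProd_simpleRoot_of_not_mem hi (not_adj_of_isSource hw.1 hw' hi)
      have h2 := hred.isPosRoot_inv_of_cons hΓ
      have h3 : (wordProd Γ w)⁻¹ (simpleRoot Γ i) = -simpleRoot Γ i := by
        rw [← h, wordProd_cons, LinearEquiv.mul_apply] at h1
        have h4 : simpleReflection Γ i (simpleRoot Γ i) =
            wordProd Γ w (simpleRoot Γ i) := by
          have h5 := congrArg (simpleReflection Γ i) h1
          rw [← LinearEquiv.mul_apply, simpleReflection_mul_self] at h5
          exact h5.symm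
        rw [simpleReflection_simpleRoot_self] at h4
        have h5 : (wordProd Γ w)⁻¹ (-simpleRoot Γ i) = simpleRoot Γ i := by
          rw [h4, ← LinearEquiv.mul_apply, inv_mul_cancel]; rfl
        rw [map_neg] at h5
        exact neg_eq_iff_eq_neg.1 h5
      rw [h3] at h2
      exact (isPosRoot_simpleRoot i).not_neg hΓ h2
    obtain ⟨u, hu⟩ := exists_eqvGen_cons hw.1 hw' hi
    have hp := wordProd_eq_of_eqvGen hu
    refine .trans _ _ _ (eqvGen_commStep_cons i (ih hw.2
      ((adapted_iff_of_eqvGen hu ξ).1 hw').2 hred.of_cons ?_ ?_)) (.symm _ _ hu)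
    · exact ((isReducedWord_iff_of_eqvGen hu _).1 hred').isReduced.of_cons
    · rw [← h, wordProd_cons, wordProd_cons] at hp
      exact mul_left_cancel hp

variable (Γ σ) in
/-- The set of the reduced words for the longest element which are adapted to `ξ`. -/
def adaptedWords (ξ : V → ℤ) : Set (List V) :=
  {w | IsReducedWord Γ w (longestElement Γ) ∧ Adapted Γ σ ξ w}

theorem adaptedWords_eq_commClass (hΓ : IsFiniteType Γ) {w : List V}
    (hw : w ∈ adaptedWords Γ σ ξ) : adaptedWords Γ σ ξ = commClass Γ w := by
  ext w'
  constructor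
  · intro hw'
    exact eqvGen_of_wordProd_eq hΓ hw.2 hw'.2 hw.1.isReduced hw'.1.isReduced
      (hw.1.1.trans hw'.1.1.symm)
  · intro h
    exact ⟨(isReducedWord_iff_of_eqvGen h _).1 hw.1, (adapted_iff_of_eqvGen h ξ).1 hw.2⟩

theorem mem_of_isSource (hΓ : IsFiniteType Γ) (hL : HasLongest Γ) {w : List V}
    (hw : w ∈ adaptedWords Γ σ ξ) {i : V} (hi : IsSource Γ ξ i) : i ∈ w := by
  by_contra hiw
  have h1 := wordProd_simpleRoot_of_not_mem hiw (not_adj_of_isSource hi hw.2 hiw)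
  have h2 := isPosRoot_neg_longestElement hΓ hL (isPosRoot_simpleRoot i)
  rw [← hw.1.1, h1] at h2
  exact (isPosRoot_simpleRoot i).not_neg hΓ h2

/-! ### Reflections of adapted words -/

variable (Γ σ) in
/-- There is a reduced word for the longest element which is adapted to `ξ` and which shifts `ξ`
by `-c`, up to the involution of the diagram. -/
def IsGood (c : ℤ) (ξ : V → ℤ) : Prop :=
  ∃ w ∈ adaptedWords Γ σ ξ, ∀ i, heightAfter σ ξ w i = ξ (starInvolution Γ i) - c

theorem IsGood.heightAfter_eq (hΓ : IsFiniteType Γ) {c : ℤ} (h : IsGood Γ σ c ξ) {w : List V}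
    (hw : w ∈ adaptedWords Γ σ ξ) (i : V) :
    QData.heightAfter σ ξ w i = ξ (starInvolution Γ i) - c := by
  obtain ⟨w', hw', h'⟩ := h
  rw [adaptedWords_eq_commClass hΓ hw'] at hw
  rw [← h', heightAfter_eq_of_eqvGen hw]

theorem isReducedWord_rotate (hΓ : IsFiniteType Γ) (hL : HasLongest Γ) {i : V} {w : List V} :
    IsReducedWord Γ (w ++ [starInvolution Γ i]) (longestElement Γ) ↔
      IsReducedWord Γ (i :: w) (longestElement Γ) := by
  have h := longestElement_mul_simpleReflection hΓ hL i
  have h1 : wordProd Γ (w ++ [starInvolution Γ i]) = longestElement Γ ↔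
      wordProd Γ (i :: w) = longestElement Γ := by
    rw [wordProd_append, wordProd_cons, wordProd_cons, wordProd_nil, mul_one]
    constructor
    · intro h'
      rw [← mul_left_inj (simpleReflection Γ (starInvolution Γ i)), mul_assoc, h', h]
    · intro h'
      rw [← mul_right_inj (simpleReflection Γ i), ← mul_assoc, h', h]
  simp only [IsReducedWord, h1, List.length_append, List.length_cons, List.length_nil, zero_add]

theorem isSource_starInvolution (hΓ : IsFiniteType Γ) (hL : HasLongest Γ) {c : ℤ} {ζ : V → ℤ}
    (hζ : ∀ j, ζ j = ξ (starInvolution Γ j) - c) {i : V} (hi : IsSource Γ ξ i) :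
    IsSource Γ ζ (starInvolution Γ i) := by
  intro j hj
  rw [hζ, hζ, starInvolution_starInvolution hΓ hL]
  have := hi (starInvolution Γ j) (by
    rw [← starInvolution_adj hΓ hL, starInvolution_starInvolution hΓ hL]; exact hj)
  omega

variable (hσ : ∀ i j, Γ.Adj (σ i) (σ j) ↔ Γ.Adj i j)

include hσ in
theorem orbitSize_starInvolution (hΓ : IsFiniteType Γ) (hL : HasLongest Γ) (i : V) :
    orbitSize σ (starInvolution Γ i) = orbitSize σ i := by
  have hinv := starInvolution_starInvolution hΓ hL
  have hcomm := starInvolution_perm hΓ hL hσ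
  have key : ∀ i j, σ.SameCycle i j → σ.SameCycle (starInvolution Γ i) (starInvolution Γ j) := by
    rintro i _ ⟨n, rfl⟩
    let s : Equiv.Perm V := ⟨starInvolution Γ, starInvolution Γ, hinv, hinv⟩
    have hs : Commute s σ := Equiv.ext fun i => hcomm i
    refine ⟨n, ?_⟩
    exact (congrArg (fun e : Equiv.Perm V => e i) (hs.zpow_right n).eq).symm
  refine Set.ncard_congr (fun j _ => starInvolution Γ j) (fun j hj => ?_) (fun a b _ _ hab => ?_)
    (fun j hj => ⟨starInvolution Γ j, ?_, hinv j⟩)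
  · have := key _ _ hj
    rwa [hinv] at this
  · rw [← hinv a, hab, hinv]
  · exact key _ _ hj

include hσ in
theorem IsCut.star (hΓ : IsFiniteType Γ) (hL : HasLongest Γ) (h : IsCut Γ σ ξ) (c : ℤ) :
    IsCut Γ σ (fun i => ξ (starInvolution Γ i) + c) := by
  have hd := orbitSize_starInvolution hσ hΓ hL
  refine IsCut.add_const (IsCut.of_bounds h.orbit_dvd (fun i => ?_) (fun i j hij => ?_)
    (fun i j hij => ?_)) c
  · have := h.shift (starInvolution Γ i)
    rwa [hd, ← starInvolution_perm hΓ hL hσ] at this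
  · have := h.dvd_min ((starInvolution_adj hΓ hL i j).2 hij)
    rwa [hd, hd] at this
  · have := h.le_bound ((starInvolution_adj hΓ hL i j).2 hij)
    rwa [hd, hd] at this

include hσ in
theorem reflectHeight_star (hΓ : IsFiniteType Γ) (hL : HasLongest Γ) (c : ℤ) (i j : V) :
    reflectHeight σ (fun k => ξ (starInvolution Γ k) + c) i j =
      reflectHeight σ ξ (starInvolution Γ i) (starInvolution Γ j) + c := by
  have hinv := starInvolution_starInvolution hΓ hL
  have h1 : starInvolution Γ i = starInvolution Γ j ↔ i = j :=
    ⟨fun h => by rw [← hinv i, h, hinv], fun h => h ▸ rfl⟩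
  simp only [reflectHeight, h1, orbitSize_starInvolution hσ hΓ hL]
  split_ifs <;> ring

include hσ in
/-- Rotation of an adapted reduced word for the longest element. -/
theorem IsGood.rotate (hΓ : IsFiniteType Γ) (hL : HasLongest Γ) {c : ℤ} (h : IsGood Γ σ c ξ)
    {i : V} {u : List V} (hu : i :: u ∈ adaptedWords Γ σ ξ) :
    u ++ [starInvolution Γ i] ∈ adaptedWords Γ σ (reflectHeight σ ξ i) ∧
      ∀ j, heightAfter σ (reflectHeight σ ξ i) (u ++ [starInvolution Γ i]) j =
        reflectHeight σ ξ i (starInvolution Γ j) - c := by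
  have h1 := h.heightAfter_eq hΓ hu
  rw [heightAfter_cons] at h1
  -- After i :: u the heights are ξ∘* - c, and * is a diagram automorphism; so the source i of ξ
  -- becomes the source i* there, and the letter i* may be appended.
  have h2 := isSource_starInvolution hΓ hL h1 hu.2.1
  refine ⟨⟨(isReducedWord_rotate hΓ hL).2 hu.1,
    (adapted_append _ _ _).2 ⟨hu.2.2, (adapted_singleton _ _).2 h2⟩⟩, fun j => ?_⟩
  have h3 : heightAfter σ (reflectHeight σ ξ i) u =
      fun k => ξ (starInvolution Γ k) + -c := by funext k; rw [h1]; ring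
  rw [heightAfter_append, heightAfter_cons, heightAfter_nil, h3, reflectHeight_star hσ hΓ hL,
    starInvolution_starInvolution hΓ hL]
  ring

include hσ in
theorem IsGood.reflectHeight (hΓ : IsFiniteType Γ) (hL : HasLongest Γ) {c : ℤ}
    (h : IsGood Γ σ c ξ) {i : V} (hi : IsSource Γ ξ i) :
    IsGood Γ σ c (reflectHeight σ ξ i) := by
  obtain ⟨w, hw, -⟩ := id h
  obtain ⟨u, hu⟩ := exists_eqvGen_cons hi hw.2 (mem_of_isSource hΓ hL hw hi)
  have hu' : i :: u ∈ adaptedWords Γ σ ξ := by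
    rw [adaptedWords_eq_commClass hΓ hw]; exact hu
  exact ⟨_, (h.rotate hσ hΓ hL hu').1, (h.rotate hσ hΓ hL hu').2⟩

include hσ in
theorem IsGood.heightAfter (hΓ : IsFiniteType Γ) (hL : HasLongest Γ) {c : ℤ}
    (h : IsGood Γ σ c ξ) {u : List V} (hu : Adapted Γ σ ξ u) :
    IsGood Γ σ c (heightAfter σ ξ u) := by
  induction u generalizing ξ with
  | nil => simpa using h
  | cons i u ih => rw [heightAfter_cons]; exact ih (h.reflectHeight hσ hΓ hL hu.1) hu.2

theorem adaptedWords_add_const (c : ℤ) :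
    adaptedWords Γ σ (fun i => ξ i + c) = adaptedWords Γ σ ξ := by
  ext w; simp only [adaptedWords, Set.mem_ofPred_eq, adapted_add_const]

theorem IsGood.add_const {c : ℤ} (h : IsGood Γ σ c ξ) (k : ℤ) :
    IsGood Γ σ c (fun i => ξ i + k) := by
  obtain ⟨w, hw, h⟩ := h
  refine ⟨w, by rwa [adaptedWords_add_const], fun i => ?_⟩
  simp only [heightAfter_add_const, h]; ring

/-- Any lower cut with the same parity can be reached by reflections at sources. -/
theorem IsCut.exists_adapted {ξ' : V → ℤ} (h' : IsCut Γ σ ξ') (n : ℕ) :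
    ∀ ξ : V → ℤ, IsCut Γ σ ξ → (∀ i, 2 * (orbitSize σ i : ℤ) ∣ ξ i - ξ' i) → (∀ i, ξ' i ≤ ξ i) →
      ∑ i, (ξ i - ξ' i) ≤ n → ∃ u, Adapted Γ σ ξ u ∧ QData.heightAfter σ ξ u = ξ' := by
  induction n with
  | zero =>
    intro ξ _ _ hle hsum
    have h0 : ∀ i ∈ Finset.univ, 0 ≤ ξ i - ξ' i := fun i _ => sub_nonneg.2 (hle i)
    have h1 := (Finset.sum_eq_zero_iff_of_nonneg h0).1
      (le_antisymm (by simpa using hsum) (Finset.sum_nonneg h0))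
    exact ⟨[], trivial, by funext i; rw [heightAfter_nil]; have := h1 i (Finset.mem_univ i); omega⟩
  | succ n ih =>
    intro ξ h hdvd hle hsum
    by_cases hall : ∀ i, ξ i = ξ' i
    · exact ⟨[], trivial, by funext i; rw [heightAfter_nil, hall]⟩
    have hne : (Finset.univ.filter fun i => ξ' i < ξ i).Nonempty := by
      push Not at hall
      obtain ⟨i, hi⟩ := hall
      exact ⟨i, by simpa using lt_of_le_of_ne (hle i) (Ne.symm hi)⟩
    -- The vertex i is the highest among those not yet lowered to ξ'. A higher neighbour j would
    -- already be at ξ'_j, which the cut condition of ξ' keeps below ξ'_i + 2d_i ≤ ξ_i. Hence i is a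
    -- source.
    obtain ⟨i, hi, hmax⟩ := Finset.exists_max_image _ ξ hne
    simp only [Finset.mem_filter, Finset.mem_univ, true_and] at hi hmax
    have hstep : ξ' i + 2 * orbitSize σ i ≤ ξ i := by
      have := Int.le_of_dvd (by omega) (hdvd i)
      omega
    have hsrc : IsSource Γ ξ i := by
      intro j hij
      by_contra hlt
      have h1 := h.ne hij
      have h2 : ξ j = ξ' j := by
        by_contra h3
        have := hmax j (lt_of_le_of_ne (hle j) (Ne.symm h3))
        omega
      have h3 := h'.le_bound hij
      have h4 := IsCut.min_pos (σ := σ) i j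
      omega
    have hpos := orbitSize_cast_pos σ i
    have hA : ∀ j, 2 * (orbitSize σ j : ℤ) ∣ QData.reflectHeight σ ξ i j - ξ' j := by
      intro j
      rcases eq_or_ne i j with rfl | hij
      · rw [reflectHeight_self]
        exact dvd_of_dvd_of_eq (dvd_sub (hdvd i) (dvd_refl _)) (by ring)
      · rw [reflectHeight_of_ne _ hij]; exact hdvd j
    have hB : ∀ j, ξ' j ≤ QData.reflectHeight σ ξ i j := by
      intro j
      rcases eq_or_ne i j with rfl | hij
      · rw [reflectHeight_self]; omega
      · rw [reflectHeight_of_ne _ hij]; exact hle j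
    have hC : ∑ j, (QData.reflectHeight σ ξ i j - ξ' j) < ∑ j, (ξ j - ξ' j) := by
      refine Finset.sum_lt_sum (fun j _ => ?_) ⟨i, Finset.mem_univ i, ?_⟩
      · have := reflectHeight_le (σ := σ) ξ i j; omega
      · rw [reflectHeight_self]; omega
    push_cast at hsum
    obtain ⟨u, hu1, hu2⟩ := ih (QData.reflectHeight σ ξ i) (h.reflectHeight hsrc) hA hB (by omega)
    exact ⟨i :: u, ⟨hsrc, hu1⟩, by rw [heightAfter_cons, hu2]⟩

/-- Up to a shift, any cut with the same parity can be reached by reflections at sources. -/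
theorem exists_adapted_to_shift {ξ' : V → ℤ} (h : IsCut Γ σ ξ) (h' : IsCut Γ σ ξ')
    (hdvd : ∀ i, 2 * (orbitSize σ i : ℤ) ∣ ξ i - ξ' i) {r : ℤ} (hr : 0 < r)
    (hd : ∀ i, (orbitSize σ i : ℤ) ∣ r) :
    ∃ (m : ℤ) (u : List V), Adapted Γ σ ξ u ∧
      QData.heightAfter σ ξ u = fun i => ξ' i + 2 * r * m := by
  obtain ⟨M, hM⟩ : ∃ M : ℤ, ∀ i, ξ' i - ξ i ≤ M := by
    refine ⟨∑ i, |ξ' i - ξ i|, fun i => (le_abs_self _).trans ?_⟩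
    exact Finset.single_le_sum (f := fun i => |ξ' i - ξ i|) (fun i _ => abs_nonneg _)
      (Finset.mem_univ i)
  -- Since r ≥ 1, lowering ξ' by 2r|M| puts it below ξ; the parity is kept because every d_i divides
  -- r.
  have hcut := h'.add_const (2 * r * (-|M|))
  have hA : ∀ i, 2 * (orbitSize σ i : ℤ) ∣ ξ i - (ξ' i + 2 * r * (-|M|)) := by
    intro i
    have h1 : 2 * (orbitSize σ i : ℤ) ∣ 2 * r * |M| :=
      Dvd.dvd.mul_right (mul_dvd_mul_left 2 (hd i)) _
    exact dvd_of_dvd_of_eq (dvd_add (hdvd i) h1) (by ring)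
  have hB : ∀ i, ξ' i + 2 * r * (-|M|) ≤ ξ i := by
    intro i
    have h1 := hM i
    have h2 := le_abs_self M
    have h3 := abs_nonneg M
    nlinarith
  obtain ⟨u, hu1, hu2⟩ := hcut.exists_adapted _ ξ h hA hB (Int.self_le_toNat _)
  exact ⟨-|M|, u, hu1, hu2⟩

end Cuts

end QData

namespace QData

/-! ### Height functions of Q-data are cuts, and conversely -/

section Heights

variable {V : Type*} [Fintype V] [DecidableEq V] {Γ : SimpleGraph V} {σ : Equiv.Perm V}

theorem exists_lt_orderOf_of_sameCycle {i j : V} (h : σ.SameCycle i j) :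
    ∃ l < orderOf σ, (σ ^ l) i = j := by
  obtain ⟨n, rfl⟩ := h
  have hpos : 0 < (orderOf σ : ℤ) := by exact_mod_cast orderOf_pos σ
  have h1 := Int.emod_nonneg n hpos.ne'
  have h2 := Int.emod_lt_of_pos n hpos
  refine ⟨(n % orderOf σ).toNat, by omega, ?_⟩
  rw [← zpow_natCast, Int.toNat_of_nonneg h1, zpow_mod_orderOf]

theorem sameCycle_pow (l : ℕ) (i : V) : σ.SameCycle i ((σ ^ l) i) := ⟨l, by simp⟩

theorem orbitSize_pow_apply (l : ℕ) (i : V) : orbitSize σ ((σ ^ l) i) = orbitSize σ i :=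
  (orbitSize_eq_of_sameCycle (sameCycle_pow l i)).symm

theorem apply_eq_of_orbitSize_eq_one {i : V} (h : orbitSize σ i = 1) : σ i = i := by
  obtain ⟨a, ha⟩ := Set.ncard_eq_one.1 h
  have h1 : i ∈ {j | σ.SameCycle i j} := Equiv.Perm.SameCycle.refl σ i
  have h2 : σ i ∈ {j | σ.SameCycle i j} := ⟨1, by simp⟩
  rw [ha, Set.mem_singleton_iff] at h1 h2
  rw [h2, ← h1]

theorem pow_apply_eq_of_fixed {i : V} (h : σ i = i) (l : ℕ) : (σ ^ l) i = i :=
  Function.IsFixedPt.perm_pow h l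

variable (hσ : ∀ i j, Γ.Adj (σ i) (σ j) ↔ Γ.Adj i j)

include hσ in
theorem adj_pow_iff (l : ℕ) (i j : V) : Γ.Adj ((σ ^ l) i) ((σ ^ l) j) ↔ Γ.Adj i j := by
  induction l with
  | zero => simp
  | succ l ih => rw [pow_succ', Equiv.Perm.mul_apply, Equiv.Perm.mul_apply, hσ, ih]

variable (hd : ∀ i, orbitSize σ i = 1 ∨ orbitSize σ i = orderOf σ)

include hd in
theorem orbitSize_dvd_orderOf (i : V) : (orbitSize σ i : ℤ) ∣ orderOf σ := by
  rcases hd i with h | h <;> simp [h]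

include hd in
theorem orbitSize_dvd_of_le {i j : V} (h : orbitSize σ i ≤ orbitSize σ j) :
    orbitSize σ i ∣ orbitSize σ j := by
  rcases hd i with hi | hi
  · simp [hi]
  · rcases hd j with hj | hj
    · have := orbitSize_pos σ i
      rw [show orbitSize σ i = 1 by omega]; exact one_dvd _
    · rw [hi, hj]

include hd in
theorem orbitSize_eq_of_lt {i j : V} (h : orbitSize σ i < orbitSize σ j) :
    orbitSize σ i = 1 ∧ orbitSize σ j = orderOf σ := by
  have hi := orbitSize_pos σ i
  rcases hd j with hj | hj
  · omega
  · rcases hd i with hi | hi <;> omega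

variable {ε : V → ℤ}

-- For an edge with d_i < d_j, (H2) gives ξ_j = ξ_{j°} - 2l with 0 ≤ l < r and |ξ_i - ξ_{j°}| = 1,
-- which yields both inequalities of a cut. The congruences come from the parity function.
include hd in
theorem QDatum.isCut (hε : IsParityFunction Γ σ ε) (Q : QDatum Γ σ ε) :
    IsCut Γ σ Q.height := by
  obtain ⟨-, -, hε2, hε3⟩ := hε
  have hbound : ∀ i j, Γ.Adj i j → orbitSize σ i ≤ orbitSize σ j →
      Q.height j ≤ Q.height i + orbitSize σ i ∧
        Q.height i ≤ Q.height j + 2 * orbitSize σ j - orbitSize σ i := by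
    intro i j hij hle
    rcases hle.lt_or_eq with hlt | heq
    · obtain ⟨j₀, ⟨h1, h2, h3⟩, -⟩ := Q.isHeight.2 i j hij hlt
      obtain ⟨l, hl, rfl⟩ := exists_lt_orderOf_of_sameCycle h1.symm
      obtain ⟨h4, h5⟩ := orbitSize_eq_of_lt hd hlt
      rw [h3 l hl, h4, h5]
      rw [abs_eq one_pos.le] at h2
      push_cast
      omega
    · have h1 := Q.isHeight.1 i j hij heq
      rw [abs_eq (orbitSize_cast_pos σ i).le] at h1
      rw [← heq]
      have := orbitSize_cast_pos σ i
      omega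
  refine ⟨fun i j _ h => orbitSize_dvd_of_le hd h, fun i => ?_, fun i j hij hle => ?_,
    fun i j hij hle => (hbound i j hij hle).1, fun i j hij hle => (hbound i j hij hle).2⟩
  · have h1 := Q.parity (σ i)
    rw [orbitSize_apply] at h1
    have h2 := (hε2 i 1).dvd
    rw [zpow_one] at h2
    exact dvd_of_dvd_of_eq (dvd_sub (dvd_sub h1 (Q.parity i)) h2) (by ring)
  · have h1 : 2 * (orbitSize σ i : ℤ) ∣ 2 * (orbitSize σ j : ℤ) :=
      mul_dvd_mul_left 2 (by exact_mod_cast orbitSize_dvd_of_le hd hle)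
    have h2 := (hε3 i j hij).dvd
    rw [min_eq_left (by exact_mod_cast hle)] at h2
    have h3 := dvd_sub (dvd_add (dvd_sub (h1.trans (Q.parity j)) (Q.parity i)) h2)
      (dvd_refl (2 * (orbitSize σ i : ℤ)))
    exact dvd_of_dvd_of_eq h3 (by ring)

theorem IsCut.shift_pow {ξ : V → ℤ} (h : IsCut Γ σ ξ) (i : V) (l : ℕ) :
    2 * (orbitSize σ i : ℤ) ∣ ξ ((σ ^ l) i) - ξ i + 2 * l := by
  induction l with
  | zero => simp
  | succ l ih =>
    have h1 := h.shift ((σ ^ l) i)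
    rw [orbitSize_pow_apply] at h1
    rw [pow_succ', Equiv.Perm.mul_apply]
    exact dvd_of_dvd_of_eq (dvd_add ih h1) (by push_cast; ring)

-- On a mixed edge, the cut condition confines the heights of the orbit of j to a window of length
-- 2r - 2 around ξ_i, while ξ at σ^l(j) is determined modulo 2r. So j° has to be the highest member
-- of the orbit, and the heights descend from it in steps of 2.
include hσ hd in
theorem IsCut.isHeightFunction {ξ : V → ℤ} (h : IsCut Γ σ ξ) : IsHeightFunction Γ σ ξ := by
  constructor
  · intro i j hij heq
    have h1 := h.dvd i j hij heq.le
    have h2 := h.le_add i j hij heq.le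
    have h3 := h.le_add' i j hij heq.le
    have hpos := orbitSize_cast_pos σ i
    rw [abs_eq hpos.le]
    rw [← heq] at h3
    rcases lt_or_gt_of_ne (h.ne hij) with hlt | hlt
    · have := le_of_odd_multiple hpos h1 (by omega)
      omega
    · have := le_of_odd_multiple hpos (odd_multiple_neg h1) (by omega)
      omega
  · intro i j hij hlt
    obtain ⟨hi, hj⟩ := orbitSize_eq_of_lt hd hlt
    have hfix := apply_eq_of_orbitSize_eq_one hi
    have hbound : ∀ k, σ.SameCycle j k → ξ k ≤ ξ i + 1 ∧ ξ i ≤ ξ k + 2 * orderOf σ - 1 ∧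
        2 ∣ ξ k - ξ i - 1 := by
      intro k hk
      obtain ⟨l, -, rfl⟩ := exists_lt_orderOf_of_sameCycle hk
      have hadj : Γ.Adj i ((σ ^ l) j) := by
        rw [← adj_pow_iff hσ l, pow_apply_eq_of_fixed hfix] at hij
        exact hij
      have hle : orbitSize σ i ≤ orbitSize σ ((σ ^ l) j) := by
        rw [orbitSize_pow_apply]; exact hlt.le
      have h1 := h.le_add _ _ hadj hle
      have h2 := h.le_add' _ _ hadj hle
      have h3 := h.dvd _ _ hadj hle
      rw [orbitSize_pow_apply, hj, hi] at h2
      rw [hi] at h1 h3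
      rw [Nat.cast_one] at h1 h2 h3
      rw [mul_one] at h3
      exact ⟨h1, h2, h3⟩
    obtain ⟨j₀, hj₀, hmax⟩ := Finset.exists_max_image
      (Finset.univ.filter fun k => σ.SameCycle j k) ξ
      ⟨j, by simpa using Equiv.Perm.SameCycle.refl σ j⟩
    simp only [Finset.mem_filter, Finset.mem_univ, true_and] at hj₀ hmax
    have hchain : ∀ l : ℕ, l < orderOf σ → ξ ((σ ^ l) j₀) = ξ j₀ - 2 * l := by
      intro l hl
      rcases Nat.eq_zero_or_pos l with rfl | hl0
      · simp
      have hcyc := hj₀.trans (sameCycle_pow l j₀)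
      obtain ⟨k, hk⟩ := h.shift_pow j₀ l
      rw [← orbitSize_eq_of_sameCycle hj₀, hj] at hk
      have h1 := hmax _ hcyc
      have h2 := (hbound _ hcyc).2.1
      have h3 := (hbound _ hj₀).1
      have hlr : (l : ℤ) < orderOf σ := by exact_mod_cast hl
      have hl0' : (0 : ℤ) < l := by exact_mod_cast hl0
      have : k = 0 := by
        by_contra hk0
        rcases lt_or_gt_of_ne hk0 with hk0 | hk0
        · have : (orderOf σ : ℤ) * k ≤ orderOf σ * (-1) :=
            mul_le_mul_of_nonneg_left (by omega) (by omega)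
          nlinarith
        · have : (orderOf σ : ℤ) * 1 ≤ orderOf σ * k :=
            mul_le_mul_of_nonneg_left (by omega) (by omega)
          nlinarith
      subst this
      omega
    refine ⟨j₀, ⟨hj₀, ?_, hchain⟩, ?_⟩
    -- The lowest member, l = r - 1, obeys the lower end of the window; this forces ξ_i ≤ ξ_{j°} +
    -- 1.
    · have hr := orderOf_pos σ
      have h1 := hchain (orderOf σ - 1) (by omega)
      have h2 := (hbound _ (hj₀.trans (sameCycle_pow (orderOf σ - 1) j₀))).2.1
      rw [h1] at h2
      have h3 := hbound _ hj₀
      rw [abs_eq one_pos.le]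
      push_cast [hr] at h2
      omega
    -- Going from one candidate to the other and back lowers the height by 2l + 2m, so l = 0.
    · rintro j₁ ⟨hj₁, -, hchain₁⟩
      obtain ⟨l, hl, rfl⟩ := exists_lt_orderOf_of_sameCycle (hj₀.symm.trans hj₁)
      have h1 := hchain l hl
      obtain ⟨m, hm, hm'⟩ := exists_lt_orderOf_of_sameCycle (hj₁.symm.trans hj₀)
      have h2 := hchain₁ m hm
      rw [hm'] at h2
      have : l = 0 := by omega
      simp [this]

end Heights

/-! ### Occurrences of a letter in a word -/

section Occurrences

variable {V : Type*} [DecidableEq V]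

theorem exists_split_of_lt_count {i : V} :
    ∀ {w : List V} {n : ℕ}, n < w.count i → ∃ u v, w = u ++ i :: v ∧ u.count i = n
  | [], n, h => by simp at h
  | j :: w, n, h => by
    by_cases hj : j = i
    · subst hj
      rcases n with _ | n
      · exact ⟨[], w, rfl, rfl⟩
      · rw [List.count_cons_self] at h
        obtain ⟨u, v, rfl, h2⟩ := exists_split_of_lt_count (Nat.lt_of_succ_lt_succ h)
        exact ⟨j :: u, v, rfl, by rw [List.count_cons_self, h2]⟩
    · rw [List.count_cons_of_ne hj] at h
      obtain ⟨u, v, rfl, h2⟩ := exists_split_of_lt_count h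
      exact ⟨j :: u, v, rfl, by rw [List.count_cons_of_ne hj, h2]⟩

theorem exists_position_of_lt_count {i : V} {w : List V} {n : ℕ} (h : n < w.count i) :
    ∃ k : Fin w.length, w.get k = i ∧ (w.take k).count i = n := by
  obtain ⟨u, v, rfl, rfl⟩ := exists_split_of_lt_count h
  exact ⟨⟨u.length, by simp⟩, by simp, by simp⟩

theorem count_take_succ (w : List V) (k : Fin w.length) (i : V) :
    (w.take (k + 1)).count i = (w.take k).count i + if w.get k = i then 1 else 0 := by
  rw [List.take_add_one, List.count_append, List.getElem?_eq_getElem k.2]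
  simp [List.count_singleton]

theorem count_take_mono (w : List V) {a b : ℕ} (hab : a ≤ b) (i : V) :
    (w.take a).count i ≤ (w.take b).count i :=
  (List.take_sublist_take_left hab).count_le i

theorem count_take_of_ne (w : List V) {a b : ℕ} (hab : a ≤ b) (hb : b ≤ w.length) (i : V)
    (h : ∀ l : Fin w.length, a ≤ l → l < b → w.get l ≠ i) :
    (w.take b).count i = (w.take a).count i := by
  induction b, hab using Nat.le_induction with
  | base => rfl
  | succ b hab ih =>
    have h1 := count_take_succ w ⟨b, hb⟩ i
    rw [if_neg (h ⟨b, hb⟩ hab (Nat.lt_succ_self b)), add_zero] at h1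
    rw [h1]
    exact ih (by omega) fun l hl hl' => h l hl (by omega)

theorem count_take_lt (w : List V) {l : Fin w.length} {b : ℕ} (h : (l : ℕ) < b) :
    (w.take l).count (w.get l) + 1 ≤ (w.take b).count (w.get l) := by
  have h1 := count_take_succ w l (w.get l)
  rw [if_pos rfl] at h1
  rw [← h1]
  exact count_take_mono w h _

variable (Γ : SimpleGraph V)

/-- The root at the `n`-th occurrence of the letter `i` in a word. -/
noncomputable def occRoot : List V → V → ℕ → (V → ℤ)
  | [], _, _ => 0
  | j :: w, i, 0 => if j = i then simpleRoot Γ i else simpleReflection Γ j (occRoot w i 0)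
  | j :: w, i, n + 1 =>
    if j = i then simpleReflection Γ j (occRoot w i n) else simpleReflection Γ j (occRoot w i (n + 1))

theorem occRoot_cons_self_zero (w : List V) (i : V) :
    occRoot Γ (i :: w) i 0 = simpleRoot Γ i := by simp [occRoot]

theorem occRoot_cons_self_succ (w : List V) (i : V) (n : ℕ) :
    occRoot Γ (i :: w) i (n + 1) = simpleReflection Γ i (occRoot Γ w i n) := by simp [occRoot]

theorem occRoot_cons_of_ne (w : List V) {i j : V} (h : j ≠ i) (n : ℕ) :
    occRoot Γ (j :: w) i n = simpleReflection Γ j (occRoot Γ w i n) := by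
  cases n <;> simp [occRoot, h]

theorem wordRoot_eq_occRoot (w : List V) (k : Fin w.length) :
    wordRoot Γ w k = occRoot Γ w (w.get k) ((w.take k).count (w.get k)) := by
  induction w with
  | nil => exact k.elim0
  | cons j w ih =>
    obtain ⟨k, hk⟩ := k
    rcases k with _ | k
    · simp [wordRoot, occRoot]
    · have hk' : k < w.length := Nat.lt_of_succ_lt_succ hk
      have h1 : wordRoot Γ (j :: w) ⟨k + 1, hk⟩ = simpleReflection Γ j (wordRoot Γ w ⟨k, hk'⟩) := by
        simp [wordRoot]
      rw [h1, ih]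
      simp only [List.get_eq_getElem, List.getElem_cons_succ, List.take_succ_cons]
      by_cases hj : j = w[k]
      · rw [← hj, List.count_cons_self, occRoot_cons_self_succ]
      · rw [List.count_cons_of_ne hj, occRoot_cons_of_ne _ _ hj]

-- Commutations move positions but preserve the numbering of the occurrences of each letter. This
-- makes the isomorphism of quivers independent of the chosen adapted word.
variable {Γ} in
theorem occRoot_eq_of_eqvGen [Fintype V] {w w' : List V}
    (h : Relation.EqvGen (CommStep Γ) w w') : occRoot Γ w = occRoot Γ w' := by
  refine eqvGen_commStep_invariant (occRoot Γ) (fun u v i j hij => ?_) h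
  induction u with
  | nil =>
    rcases eq_or_ne i j with rfl | hne
    · rfl
    funext k n
    have hcomm := fun l => LinearEquiv.congr_fun (simpleReflection_commute hij) l
    simp only [LinearEquiv.mul_apply] at hcomm
    have h1 := simpleReflection_simpleRoot_of_not_adj hne hij
    have h2 := simpleReflection_simpleRoot_of_not_adj hne.symm fun h' => hij h'.symm
    simp only [List.nil_append]
    by_cases hi : i = k
    · subst hi
      rw [occRoot_cons_of_ne _ _ hne.symm]
      cases n with
      | zero => rw [occRoot_cons_self_zero, occRoot_cons_self_zero, h2]
      | succ n =>
        rw [occRoot_cons_self_succ, occRoot_cons_self_succ, occRoot_cons_of_ne _ _ hne.symm, hcomm]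
    · rw [occRoot_cons_of_ne _ _ hi]
      by_cases hj : j = k
      · subst hj
        cases n with
        | zero => rw [occRoot_cons_self_zero, occRoot_cons_self_zero, h1]
        | succ n =>
          rw [occRoot_cons_self_succ, occRoot_cons_self_succ, occRoot_cons_of_ne _ _ hi, hcomm]
      · rw [occRoot_cons_of_ne _ _ hj, occRoot_cons_of_ne _ _ hj, occRoot_cons_of_ne _ _ hi, hcomm]
  | cons a u ih =>
    funext k n
    simp only [List.cons_append]
    by_cases ha : a = k
    · subst ha
      cases n with
      | zero => rw [occRoot_cons_self_zero, occRoot_cons_self_zero]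
      | succ n => rw [occRoot_cons_self_succ, occRoot_cons_self_succ, ih]
    · rw [occRoot_cons_of_ne _ _ ha, occRoot_cons_of_ne _ _ ha, ih]

end Occurrences

end QData

namespace QData

/-! ### The isomorphism between the twisted and the combinatorial Auslander-Reiten quivers -/

section Quiver

variable {V : Type*} [Fintype V] [DecidableEq V] {Γ : SimpleGraph V} {σ : Equiv.Perm V}
  {ξ : V → ℤ} {w : List V}

variable (σ ξ w) in
/-- The vertex of the repetition quiver attached to a position of a word adapted to `ξ`. -/
noncomputable def positionVertex (k : Fin w.length) : V × ℤ :=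
  (w.get k, heightAfter σ ξ (w.take k) (w.get k))

theorem heightAfter_take_mono {a b : ℕ} (hab : a ≤ b) (i : V) :
    heightAfter σ ξ (w.take b) i ≤ heightAfter σ ξ (w.take a) i := by
  have h1 : ((w.take a).count i : ℤ) ≤ (w.take b).count i := by
    exact_mod_cast count_take_mono w hab i
  have h2 := mul_le_mul_of_nonneg_left h1
    (mul_nonneg zero_le_two (orbitSize_cast_pos σ i).le)
  simp only [heightAfter]; linarith

theorem heightAfter_take_lt {l : Fin w.length} {b : ℕ} (h : (l : ℕ) < b) :
    heightAfter σ ξ (w.take b) (w.get l) ≤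
      heightAfter σ ξ (w.take l) (w.get l) - 2 * orbitSize σ (w.get l) := by
  have h1 : ((w.take l).count (w.get l) + 1 : ℤ) ≤ (w.take b).count (w.get l) := by
    exact_mod_cast count_take_lt w h
  have h2 := mul_le_mul_of_nonneg_left h1
    (mul_nonneg zero_le_two (orbitSize_cast_pos σ (w.get l)).le)
  simp only [heightAfter]; linarith

theorem heightAfter_take_of_ne {a b : ℕ} (hab : a ≤ b) (hb : b ≤ w.length) (i : V)
    (h : ∀ l : Fin w.length, a ≤ l → l < b → w.get l ≠ i) :
    heightAfter σ ξ (w.take b) i = heightAfter σ ξ (w.take a) i := by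
  simp only [heightAfter, count_take_of_ne w hab hb i h]

theorem isCut_take (hξ : IsCut Γ σ ξ) (hw : Adapted Γ σ ξ w) (a : ℕ) :
    IsCut Γ σ (heightAfter σ ξ (w.take a)) := by
  refine hξ.heightAfter ?_
  rw [← List.take_append_drop a w, adapted_append] at hw
  exact hw.1

theorem isSource_take (hw : Adapted Γ σ ξ w) (k : Fin w.length) :
    IsSource Γ (heightAfter σ ξ (w.take k)) (w.get k) :=
  (adapted_iff_forall_split ξ w).1 hw _ _ _ (split_at w k)

/-- The arrows of the repetition quiver between the vertices of an adapted word. -/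
theorem repetitionArrow_positionVertex_iff (hξ : IsCut Γ σ ξ) (hw : Adapted Γ σ ξ w)
    (k j : Fin w.length) :
    QDatum.RepetitionArrow Γ σ (positionVertex σ ξ w k) (positionVertex σ ξ w j) ↔
      j < k ∧ Γ.Adj (w.get j) (w.get k) ∧
        ∀ l : Fin w.length, j < l → l < k → w.get l ≠ w.get j ∧ w.get l ≠ w.get k := by
  have hd := fun i : V => orbitSize_cast_pos σ i
  simp only [QDatum.RepetitionArrow, positionVertex]
  have hsj := isSource_take hw j
  have hsk := isSource_take hw k
  have hcj := isCut_take hξ hw j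
  constructor
  · rintro ⟨hadj, heq⟩
    have hmin := IsCut.min_pos (σ := σ) (w.get k) (w.get j)
    have hjk : j < k := by
      rcases lt_trichotomy j k with h | h | h
      · exact h
      · subst h; exact (hadj.ne rfl).elim
      · have h1 := heightAfter_take_mono (σ := σ) (ξ := ξ) (w := w) (Fin.le_def.1 h.le) (w.get j)
        have h2 := hsk _ hadj.symm
        omega
    have hlow := hcj.add_min_le hadj (hsj _ hadj)
    rw [min_comm] at hlow
    -- A further occurrence of either letter in between would lower its height by 2d, which places
    -- position k too far below position j for the arrow to exist.
    refine ⟨hjk, hadj, fun l hjl hlk => ⟨fun hl => ?_, fun hl => ?_⟩⟩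
    · have h1 := heightAfter_take_lt (σ := σ) (ξ := ξ) (w := w) (Fin.lt_def.1 hjl)
      have h2 := isSource_take hw l (w.get k) (hl ▸ hadj)
      have h3 := heightAfter_take_mono (σ := σ) (ξ := ξ) (w := w) (Fin.le_def.1 hlk.le) (w.get k)
      rw [hl] at h2
      have := min_le_right (orbitSize σ (w.get k) : ℤ) (orbitSize σ (w.get j))
      have := hd (w.get j)
      omega
    · have h1 := heightAfter_take_lt (σ := σ) (ξ := ξ) (w := w) (l := l) (Fin.lt_def.1 hlk)
      rw [hl] at h1
      have h2 := heightAfter_take_mono (σ := σ) (ξ := ξ) (w := w) (Fin.le_def.1 hjl.le) (w.get k)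
      have := hd (w.get k)
      omega
  · rintro ⟨hjk, hadj, hno⟩
    refine ⟨hadj, ?_⟩
    have h1 : heightAfter σ ξ (w.take k) (w.get k) = heightAfter σ ξ (w.take j) (w.get k) := by
      refine heightAfter_take_of_ne (Fin.le_def.1 hjk.le) k.2.le _ fun l hjl hlk => ?_
      rcases (Fin.le_def.2 hjl).eq_or_lt with rfl | hlt
      · exact hadj.ne
      · exact (hno l hlt hlk).2
    have h2 : heightAfter σ ξ (w.take k) (w.get j) =
        heightAfter σ ξ (w.take j) (w.get j) - 2 * orbitSize σ (w.get j) := by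
      rw [heightAfter_take_of_ne (a := j + 1) hjk k.2.le _ fun l hjl hlk => (hno l hjl hlk).1]
      simp only [heightAfter, count_take_succ, if_true]
      push_cast; ring
    rw [h1]
    have h3 := hsk _ hadj.symm
    rw [h1, h2] at h3
    -- Let a and b be the heights of i_j and i_k before position j. Then a - b is a positive odd
    -- multiple of the minimum, a - b < 2d_{i_j} because i_k is later a source, and a - b ≤ 2d_{i_k}
    -- - min. Whichever orbit is smaller, a - b is the minimum.
    have h4 := hcj.add_min_le hadj (hsj _ hadj)
    have h5 := hcj.le_bound hadj.symm
    have h6 := hcj.dvd_min hadj.symm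
    rw [min_comm] at h4
    generalize heightAfter σ ξ (w.take j) (w.get j) = a at *
    generalize heightAfter σ ξ (w.take j) (w.get k) = b at *
    by_contra hne
    have h7 := le_of_odd_multiple (x := a - b - 2 * min (orbitSize σ (w.get k) : ℤ)
      (orbitSize σ (w.get j))) (IsCut.min_pos (σ := σ) (w.get k) (w.get j))
      (dvd_of_dvd_of_eq (dvd_sub h6 (dvd_refl _)) (by ring)) (by
        by_contra hle
        obtain ⟨m, hm⟩ := h6
        have hmpos := IsCut.min_pos (σ := σ) (w.get k) (w.get j)
        have hm1 : 0 < m := by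
          by_contra hm0
          have : min (orbitSize σ (w.get k) : ℤ) (orbitSize σ (w.get j)) * m ≤ 0 :=
            mul_nonpos_of_nonneg_of_nonpos hmpos.le (by omega)
          have h8 : a - b - min (orbitSize σ (w.get k) : ℤ) (orbitSize σ (w.get j)) ≤ 0 := by
            rw [hm]; linarith
          omega
        have : min (orbitSize σ (w.get k) : ℤ) (orbitSize σ (w.get j)) * 1 ≤
            min (orbitSize σ (w.get k) : ℤ) (orbitSize σ (w.get j)) * m :=
          mul_le_mul_of_nonneg_left (by omega) hmpos.le
        linarith)
    rcases le_total (orbitSize σ (w.get k) : ℤ) (orbitSize σ (w.get j)) with hle | hle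
    · rw [min_eq_left hle] at *
      omega
    · rw [min_eq_right hle] at *
      omega

theorem positionVertex_injective : Function.Injective (positionVertex σ ξ w) := by
  have key : ∀ j k : Fin w.length, j < k → positionVertex σ ξ w j ≠ positionVertex σ ξ w k := by
    intro j k hjk h
    simp only [positionVertex, Prod.mk.injEq] at h
    have h1 := heightAfter_take_lt (σ := σ) (ξ := ξ) (w := w) (Fin.lt_def.1 hjk)
    have := orbitSize_cast_pos σ (w.get j)
    rw [← h.1] at h
    omega
  intro j k h
  rcases lt_trichotomy j k with hlt | heq | hlt
  · exact (key j k hlt h).elim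
  · exact heq
  · exact (key k j hlt h.symm).elim

variable {ε : V → ℤ}

/-- The bound r h^∨ + ξ_i - ξ_{i*} is the total drop of the height of i along w, that is 2d_i times
the number of letters i. So column i of Γ_Q has one vertex for each occurrence of i. -/
theorem mem_arVertices_iff {h : ℕ} (Q : QDatum Γ σ ε) {w : List V}
    (hw : ∀ i, heightAfter σ Q.height w i =
      Q.height (starInvolution Γ i) - (orderOf σ : ℤ) * h) (x : V × ℤ) :
    x ∈ Q.arVertices h ↔
      ∃ n < w.count x.1, x.2 = Q.height x.1 - 2 * (orbitSize σ x.1 : ℤ) * (n : ℕ) := by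
  have hpos := orbitSize_cast_pos σ x.1
  have h1 := hw x.1
  simp only [heightAfter] at h1
  constructor
  · rintro ⟨-, k, h2, h3, h4⟩
    have hk : 0 ≤ k := by
      by_contra hk
      have := mul_pos hpos (show 0 < -k by omega)
      nlinarith
    lift k to ℕ using hk
    refine ⟨k, ?_, h2⟩
    have h5 : (orbitSize σ x.1 : ℤ) * k < orbitSize σ x.1 * w.count x.1 := by linarith
    exact_mod_cast lt_of_mul_lt_mul_left h5 hpos.le
  · rintro ⟨n, hn, h2⟩
    have h3 : (orbitSize σ x.1 : ℤ) * n < orbitSize σ x.1 * w.count x.1 :=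
      mul_lt_mul_of_pos_left (by exact_mod_cast hn) hpos
    refine ⟨?_, n, h2, by positivity, by linarith⟩
    rw [QDatum.repetitionVertices, Set.mem_ofPred_eq, h2]
    exact dvd_of_dvd_of_eq (dvd_sub (Q.parity x.1) (dvd_mul_right _ (n : ℤ))) (by ring)

variable {h : ℕ} (Q : QDatum Γ σ ε)

/-- The positions of an adapted reduced word correspond to the vertices of the twisted
Auslander-Reiten quiver. -/
noncomputable def positionEquiv {w : List V}
    (hw : ∀ i, heightAfter σ Q.height w i =
      Q.height (starInvolution Γ i) - (orderOf σ : ℤ) * h) : Fin w.length ≃ Q.arVertices h :=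
  Equiv.ofBijective (fun k => ⟨positionVertex σ Q.height w k, (mem_arVertices_iff Q hw _).2
    ⟨(w.take k).count (w.get k),
      (count_take_lt w k.2).trans_eq (by rw [List.take_length]; rfl), rfl⟩⟩) <| by
    constructor
    · intro j k hjk
      exact positionVertex_injective (congrArg Subtype.val hjk)
    · rintro ⟨⟨i, p⟩, hx⟩
      obtain ⟨n, hn, hp⟩ := (mem_arVertices_iff Q hw _).1 hx
      obtain ⟨k, rfl, rfl⟩ := exists_position_of_lt_count hn
      exact ⟨k, Subtype.ext (Prod.ext rfl hp.symm)⟩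

/-- The isomorphism from the twisted Auslander-Reiten quiver to the combinatorial one. -/
noncomputable def arEquiv (hΓ : IsFiniteType Γ) (hL : HasLongest Γ) {w : List V}
    (hred : IsReducedWord Γ w (longestElement Γ))
    (hw : ∀ i, heightAfter σ Q.height w i =
      Q.height (starInvolution Γ i) - (orderOf σ : ℤ) * h) : Q.arVertices h ≃ positiveRoots Γ :=
  (positionEquiv Q hw).symm.trans (Equiv.ofBijective _ (wordRoot_bijective hΓ hL hred))

theorem arEquiv_positionEquiv (hΓ : IsFiniteType Γ) (hL : HasLongest Γ) {w : List V}
    (hred : IsReducedWord Γ w (longestElement Γ))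
    (hw : ∀ i, heightAfter σ Q.height w i =
      Q.height (starInvolution Γ i) - (orderOf σ : ℤ) * h) (k : Fin w.length) :
    (arEquiv Q hΓ hL hred hw (positionEquiv Q hw k)).1 = wordRoot Γ w k := by
  simp [arEquiv]

theorem arEquiv_apply (hΓ : IsFiniteType Γ) (hL : HasLongest Γ) {w : List V}
    (hred : IsReducedWord Γ w (longestElement Γ))
    (hw : ∀ i, heightAfter σ Q.height w i =
      Q.height (starInvolution Γ i) - (orderOf σ : ℤ) * h) (x : Q.arVertices h) {n : ℕ}
    (hn : x.1.2 = Q.height x.1.1 - 2 * (orbitSize σ x.1.1 : ℤ) * n) :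
    (arEquiv Q hΓ hL hred hw x).1 = occRoot Γ w x.1.1 n := by
  obtain ⟨k, rfl⟩ := (positionEquiv Q hw).surjective x
  rw [arEquiv_positionEquiv, wordRoot_eq_occRoot]
  have h1 : (positionEquiv Q hw k).1 = positionVertex σ Q.height w k := rfl
  rw [h1] at hn ⊢
  simp only [positionVertex, heightAfter] at hn ⊢
  have hpos := orbitSize_cast_pos σ (w.get k)
  have h2 : (orbitSize σ (w.get k) : ℤ) * (w.take k).count (w.get k) =
    orbitSize σ (w.get k) * n := by linarith
  have h3 := mul_left_cancel₀ hpos.ne' h2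
  congr 1
  exact_mod_cast h3

theorem arEquiv_eq_of_eqvGen (hΓ : IsFiniteType Γ) (hL : HasLongest Γ) {w w' : List V}
    (hred : IsReducedWord Γ w (longestElement Γ)) (hred' : IsReducedWord Γ w' (longestElement Γ))
    (hw : ∀ i, heightAfter σ Q.height w i =
      Q.height (starInvolution Γ i) - (orderOf σ : ℤ) * h)
    (hw' : ∀ i, heightAfter σ Q.height w' i =
      Q.height (starInvolution Γ i) - (orderOf σ : ℤ) * h)
    (hww' : Relation.EqvGen (CommStep Γ) w w') :
    arEquiv Q hΓ hL hred hw = arEquiv Q hΓ hL hred' hw' := by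
  ext x : 2
  obtain ⟨n, -, hn⟩ := (mem_arVertices_iff Q hw _).1 x.2
  rw [arEquiv_apply Q hΓ hL hred hw x hn, arEquiv_apply Q hΓ hL hred' hw' x hn,
    occRoot_eq_of_eqvGen hww']

theorem combArrow_wordRoot_iff (hΓ : IsFiniteType Γ) {w : List V} (hred : IsReduced Γ w)
    (k j : Fin w.length) : CombArrow Γ w (wordRoot Γ w k) (wordRoot Γ w j) ↔
      j < k ∧ Γ.Adj (w.get j) (w.get k) ∧
        ∀ l : Fin w.length, j < l → l < k → w.get l ≠ w.get j ∧ w.get l ≠ w.get k := by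
  constructor
  · rintro ⟨j', k', h1, h2, h3, h4⟩
    obtain rfl := wordRoot_injective hΓ hred h2
    obtain rfl := wordRoot_injective hΓ hred h3
    exact ⟨h1, h4⟩
  · rintro ⟨h1, h4⟩
    exact ⟨j, k, h1, rfl, rfl, h4⟩

theorem isARIso_arEquiv (hΓ : IsFiniteType Γ) (hL : HasLongest Γ) (hξ : IsCut Γ σ Q.height)
    {w : List V} (hred : w ∈ Q.adaptedClass)
    (hw : ∀ i, heightAfter σ Q.height w i =
      Q.height (starInvolution Γ i) - (orderOf σ : ℤ) * h) :
    Q.IsARIso h w (arEquiv Q hΓ hL hred.1 hw) := by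
  constructor
  · intro x y
    obtain ⟨k, rfl⟩ := (positionEquiv Q hw).surjective x
    obtain ⟨j, rfl⟩ := (positionEquiv Q hw).surjective y
    rw [arEquiv_positionEquiv, arEquiv_positionEquiv, combArrow_wordRoot_iff hΓ hred.1.isReduced]
    exact repetitionArrow_positionVertex_iff hξ hred.2 k j
  · intro x
    obtain ⟨k, rfl⟩ := (positionEquiv Q hw).surjective x
    exact ⟨k, arEquiv_positionEquiv Q hΓ hL hred.1 hw k, rfl⟩

end Quiver

/-! ### Rigidity of slabs of the repetition quiver -/

section Rigidity

variable {V : Type*} [Fintype V] [DecidableEq V] {Γ : SimpleGraph V} {σ : Equiv.Perm V}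
  {ξ ζ : V → ℤ}

variable (σ ξ ζ) in
/-- The vertices of the repetition quiver between two cuts. -/
def slab : Set (V × ℤ) :=
  {x | 2 * (orbitSize σ x.1 : ℤ) ∣ ξ x.1 - x.2 ∧ x.2 ≤ ξ x.1 ∧ ζ x.1 < x.2}

theorem le_of_dvd_of_lt {d a b : ℤ} (hd : 2 * d ∣ b - a) (h : a < b + 2 * d) :
    a ≤ b := by
  by_contra hlt
  have h1 := Int.le_of_dvd (by omega) ((dvd_neg.2 hd))
  omega

variable (hσ : ∀ i j, Γ.Adj (σ i) (σ j) ↔ Γ.Adj i j)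
  (hd : ∀ i, orbitSize σ i = 1 ∨ orbitSize σ i = orderOf σ)

include hσ hd in
/-- Two consecutive vertices of a column have a common neighbour. -/
theorem exists_common_neighbour (hξ : IsCut Γ σ ξ) (hζ : IsCut Γ σ ζ) {i j : V}
    (hij : Γ.Adj i j) (hle : orbitSize σ i ≤ orbitSize σ j) {p : ℤ} (hp : (i, p) ∈ slab σ ξ ζ)
    (hp' : (i, p - 2 * orbitSize σ i) ∈ slab σ ξ ζ) :
    ∃ j', Γ.Adj i j' ∧ orbitSize σ i ≤ orbitSize σ j' ∧
      (j', p - orbitSize σ i) ∈ slab σ ξ ζ := by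
  obtain ⟨hp1, hp2, -⟩ := hp
  obtain ⟨-, -, hp3⟩ := hp'
  simp only at hp1 hp2 hp3
  have key : ∃ j', Γ.Adj i j' ∧ orbitSize σ i ≤ orbitSize σ j' ∧
      2 * (orbitSize σ j' : ℤ) ∣ ξ j' - (p - orbitSize σ i) := by
    have h1 := hξ.dvd i j hij hle
    rcases hle.lt_or_eq with hlt | heq
    · obtain ⟨hi, hj⟩ := orbitSize_eq_of_lt hd hlt
      have hfix := apply_eq_of_orbitSize_eq_one hi
      have h2 := dvd_add h1 hp1
      rw [hi] at h2 ⊢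
      obtain ⟨t, ht⟩ := h2
      push_cast at ht
      have hr : (0 : ℤ) < orderOf σ := by exact_mod_cast orderOf_pos σ
      -- Here ξ_j = p + 1 + 2t, and ξ at σ^l(j) is ξ_j - 2l modulo 2r, so l ≡ t + 1 modulo r gives
      -- the required class of p - 1.
      have hadj := (adj_pow_iff hσ ((t + 1) % orderOf σ).toNat i j).2 hij
      rw [pow_apply_eq_of_fixed hfix] at hadj
      refine ⟨_, hadj, by rw [orbitSize_pow_apply]; omega, ?_⟩
      have h3 := hξ.shift_pow j ((t + 1) % orderOf σ).toNat
      rw [Int.toNat_of_nonneg (Int.emod_nonneg _ hr.ne')] at h3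
      rw [orbitSize_pow_apply]
      rw [hj] at h3 ⊢
      have h4 : 2 * (orderOf σ : ℤ) ∣ 2 * ((t + 1) - (t + 1) % orderOf σ) :=
        mul_dvd_mul_left 2 (Int.dvd_self_sub_emod)
      refine dvd_of_dvd_of_eq (dvd_add h3 h4) ?_
      push_cast
      linarith
    · refine ⟨j, hij, hle, ?_⟩
      rw [← heq]
      exact dvd_of_dvd_of_eq (dvd_add (dvd_add h1 hp1)
        (dvd_refl (2 * (orbitSize σ i : ℤ)))) (by ring)
  obtain ⟨j', hij', hle', hdvd⟩ := key
  have h1 := hξ.le_add' i j' hij' hle'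
  have h2 := hζ.le_add i j' hij' hle'
  have hpos := orbitSize_cast_pos σ i
  exact ⟨j', hij', hle', hdvd, le_of_dvd_of_lt hdvd (by dsimp only; omega), by dsimp only; omega⟩

include hσ hd in
/-- An automorphism of a slab of the repetition quiver which preserves the columns is trivial. -/
theorem slab_rigid (hξ : IsCut Γ σ ξ) (hζ : IsCut Γ σ ζ)
    (hξζ : ∀ i, 2 * (orbitSize σ i : ℤ) ∣ ξ i - ζ i) (θ : slab σ ξ ζ ≃ slab σ ξ ζ)
    (hcol : ∀ x, (θ x).1.1 = x.1.1)
    (harr : ∀ x y, QDatum.RepetitionArrow Γ σ x.1 y.1 →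
      QDatum.RepetitionArrow Γ σ (θ x).1 (θ y).1)
    (hisol : ∀ i, (∀ j, ¬ Γ.Adj i j) → ∀ x y : slab σ ξ ζ, x.1.1 = i → y.1.1 = i → x = y)
    (x : slab σ ξ ζ) : θ x = x := by
  have hpos := fun i : V => orbitSize_cast_pos σ i
  -- The difference of levels along an arrow depends only on the two columns, which θ preserves; so
  -- the displacement caused by θ is the same at both ends.
  have hδ : ∀ x y, QDatum.RepetitionArrow Γ σ x.1 y.1 →
      (θ x).1.2 - x.1.2 = (θ y).1.2 - y.1.2 := by
    intro x y hxy
    have h1 := (harr x y hxy).2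
    rw [hcol, hcol] at h1
    have h2 := hxy.2
    omega
  -- `Step i` says that consecutive vertices of column i are displaced equally; the whole column is
  -- then displaced by a constant.
  let Step : V → Prop := fun i => ∀ p (h1 : (i, p) ∈ slab σ ξ ζ)
    (h2 : (i, p - 2 * (orbitSize σ i : ℤ)) ∈ slab σ ξ ζ),
    (θ ⟨_, h1⟩).1.2 - p = (θ ⟨_, h2⟩).1.2 - (p - 2 * orbitSize σ i)
  have hconst : ∀ i, Step i → ∀ x y : slab σ ξ ζ, x.1.1 = i → y.1.1 = i →
      (θ x).1.2 - x.1.2 = (θ y).1.2 - y.1.2 := by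
    intro i hi
    have key : ∀ n : ℕ, ∀ p q, (h1 : (i, p) ∈ slab σ ξ ζ) → (h2 : (i, q) ∈ slab σ ξ ζ) →
        q = p - 2 * (orbitSize σ i : ℤ) * n → (θ ⟨_, h1⟩).1.2 - p = (θ ⟨_, h2⟩).1.2 - q := by
      intro n
      induction n with
      | zero =>
        intro p q h1 h2 hq
        have : q = p := by simpa using hq
        subst this; rfl
      | succ n ih =>
        intro p q h1 h2 hq
        push_cast at hq
        have hn := mul_nonneg (hpos i).le (Int.natCast_nonneg n)
        have h3 : (i, p - 2 * (orbitSize σ i : ℤ)) ∈ slab σ ξ ζ := by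
          refine ⟨?_, ?_, ?_⟩
          · exact dvd_of_dvd_of_eq (dvd_add h1.1 (dvd_refl _)) (by ring)
          · have := h1.2.1; have := hpos i; dsimp only at *; omega
          · have := h2.2.2; dsimp only at *; nlinarith
        rw [hi p h1 h3]
        exact ih _ _ h3 h2 (by rw [hq]; ring)
    have key' : ∀ x y : slab σ ξ ζ, x.1.1 = i → y.1.1 = i → y.1.2 ≤ x.1.2 →
        (θ x).1.2 - x.1.2 = (θ y).1.2 - y.1.2 := by
      rintro ⟨⟨a, p⟩, hp⟩ ⟨⟨b, q⟩, hq⟩ ha hb hle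
      simp only at ha hb hle
      subst ha hb
      obtain ⟨n, hn⟩ := dvd_sub hq.1 hp.1
      simp only at hn
      have hn0 : 0 ≤ n := by
        by_contra hneg
        have := mul_pos (hpos b) (show 0 < -n by omega)
        nlinarith
      lift n to ℕ using hn0
      exact key n p q hp hq (by linarith)
    intro x y hx hy
    rcases le_total y.1.2 x.1.2 with h | h
    · exact key' x y hx hy h
    · exact (key' y x hy hx h).symm
  have hstep1 : ∀ i j, Γ.Adj i j → orbitSize σ i ≤ orbitSize σ j → Step i := by
    intro i j hij hle p h1 h2
    obtain ⟨j', hij', hle', h3⟩ := exists_common_neighbour hσ hd hξ hζ hij hle h1 h2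
    have hle'' : (orbitSize σ i : ℤ) ≤ orbitSize σ j' := by exact_mod_cast hle'
    have h4 := hδ ⟨_, h3⟩ ⟨_, h1⟩ ⟨hij', by rw [min_eq_right hle'']; ring⟩
    have h5 := hδ ⟨_, h2⟩ ⟨_, h3⟩ ⟨hij'.symm, by rw [min_eq_left hle'']; ring⟩
    exact (h5.trans h4).symm
  -- The vertices (i, p) and (i, p - 2d_i) are linked through (j, p - d_j) and (j, p - 2d_i + d_j),
  -- and column j moves by a constant by `hstep1`.
  have hstep2 : ∀ i j, Γ.Adj i j → orbitSize σ j ≤ orbitSize σ i → Step i := by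
    intro i j hij hle p h1 h2
    have hle'' : (orbitSize σ j : ℤ) ≤ orbitSize σ i := by exact_mod_cast hle
    have hdv : 2 * (orbitSize σ j : ℤ) ∣ ξ j - (p - orbitSize σ j) := by
      have h3 := hξ.dvd j i hij.symm hle
      have h4 : 2 * (orbitSize σ j : ℤ) ∣ 2 * (orbitSize σ i : ℤ) :=
        mul_dvd_mul_left 2 (by exact_mod_cast orbitSize_dvd_of_le hd hle)
      exact dvd_of_dvd_of_eq (dvd_sub (h4.trans h1.1) h3) (by ring)
    have hx := h1.2.1
    have hz := h2.2.2
    have h5 := hξ.le_add j i hij.symm hle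
    have h6 := hζ.le_add' j i hij.symm hle
    have hpj := hpos j
    simp only at hx hz
    have hz' : 2 * (orbitSize σ i : ℤ) ∣ p - 2 * orbitSize σ i - ζ i :=
      dvd_of_dvd_of_eq (dvd_sub (hξζ i) h2.1) (by dsimp only; ring)
    have hz'' := Int.le_of_dvd (by omega) hz'
    have hA : (j, p - (orbitSize σ j : ℤ)) ∈ slab σ ξ ζ :=
      ⟨hdv, by dsimp only; omega, by dsimp only; omega⟩
    have hB : (j, p - 2 * orbitSize σ i + (orbitSize σ j : ℤ)) ∈ slab σ ξ ζ := by
      refine ⟨?_, by dsimp only; omega, by dsimp only; omega⟩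
      have h4 : 2 * (orbitSize σ j : ℤ) ∣ 2 * (orbitSize σ i : ℤ) :=
        mul_dvd_mul_left 2 (by exact_mod_cast orbitSize_dvd_of_le hd hle)
      exact dvd_of_dvd_of_eq (dvd_sub (dvd_add hdv h4) (dvd_refl (2 * (orbitSize σ j : ℤ))))
        (by ring)
    have h7 := hδ ⟨_, hA⟩ ⟨_, h1⟩ ⟨hij, by rw [min_eq_left hle'']; ring⟩
    have h8 := hδ ⟨_, h2⟩ ⟨_, hB⟩ ⟨hij.symm, by rw [min_eq_right hle'']; ring⟩
    have h9 := hconst j (hstep1 j i hij.symm hle) ⟨_, hA⟩ ⟨_, hB⟩ rfl rfl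
    exact (h7.symm.trans h9).trans h8.symm
  by_cases hnb : ∃ j, Γ.Adj x.1.1 j
  · obtain ⟨j, hij⟩ := hnb
    have hS : Step x.1.1 := (le_total (orbitSize σ x.1.1) (orbitSize σ j)).elim
      (hstep1 _ j hij) (hstep2 _ j hij)
    have hc := hconst _ hS
    have hxm := x.2
    -- A column displaced by a constant cannot move up, because its top vertex stays in the slab,
    -- nor down, because some vertex is mapped to the top.
    have htop : (x.1.1, ξ x.1.1) ∈ slab σ ξ ζ :=
      ⟨by simp, le_rfl, hxm.2.2.trans_le hxm.2.1⟩
    have hle : (θ x).1.2 - x.1.2 ≤ 0 := by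
      rw [hc x ⟨_, htop⟩ rfl rfl]
      have h1 := (θ ⟨_, htop⟩).2.2.1
      rw [hcol] at h1
      simp only at h1 ⊢
      omega
    have hge : 0 ≤ (θ x).1.2 - x.1.2 := by
      have h1 := (θ.symm ⟨_, htop⟩).2.2.1
      have h2 : (θ.symm ⟨_, htop⟩).1.1 = x.1.1 := by
        rw [← hcol, Equiv.apply_symm_apply]
      rw [h2] at h1
      rw [hc x (θ.symm ⟨_, htop⟩) rfl h2, Equiv.apply_symm_apply]
      simp only at h1 ⊢
      omega
    exact Subtype.ext (Prod.ext (hcol x) (by omega))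
  · push Not at hnb
    exact hisol _ hnb _ _ (hcol x) rfl

end Rigidity

/-! ### Uniqueness of the isomorphism -/

section Uniqueness

variable {V : Type*} [Fintype V] [DecidableEq V] {Γ : SimpleGraph V} {σ : Equiv.Perm V}
  {ε : V → ℤ} {h : ℕ} (Q : QDatum Γ σ ε)

theorem wordProd_simpleRoot_of_isolated {i : V} (hi : ∀ j, ¬ Γ.Adj i j) (u : List V) :
    wordProd Γ u (simpleRoot Γ i) = simpleRoot Γ i ∨
      wordProd Γ u (simpleRoot Γ i) = -simpleRoot Γ i := by
  induction u with
  | nil => exact Or.inl rfl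
  | cons j u ih =>
    rw [wordProd_cons, LinearEquiv.mul_apply]
    rcases eq_or_ne j i with rfl | hj
    · rcases ih with h | h
      · rw [h, simpleReflection_simpleRoot_self]; exact Or.inr rfl
      · rw [h, map_neg, simpleReflection_simpleRoot_self, neg_neg]; exact Or.inl rfl
    · have h1 := simpleReflection_simpleRoot_of_not_adj hj fun h' => hi j h'.symm
      rcases ih with h | h
      · rw [h, h1]; exact Or.inl rfl
      · rw [h, map_neg, h1]; exact Or.inr rfl

/-- An isolated vertex carries no arrows, so rigidity must come from its column having at most one
vertex: W sends its simple root only to ± itself, and each root occurs once. Among the connected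
diagrams this concerns only A_1. -/
theorem position_unique_of_isolated (hΓ : IsFiniteType Γ) {w : List V} (hred : IsReduced Γ w)
    {i : V} (hi : ∀ j, ¬ Γ.Adj i j) {k l : Fin w.length} (hk : w.get k = i) (hl : w.get l = i) :
    k = l := by
  have key : ∀ k : Fin w.length, w.get k = i → wordRoot Γ w k = simpleRoot Γ i := by
    intro k hk
    have h1 := isPosRoot_wordRoot hΓ hred k
    rw [wordRoot, hk] at h1 ⊢
    rcases wordProd_simpleRoot_of_isolated hi (w.take k) with h | h
    · exact h
    · rw [h] at h1
      exact ((isPosRoot_simpleRoot i).not_neg hΓ h1).elim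
  exact wordRoot_injective hΓ hred ((key k hk).trans (key l hl).symm)

variable (hσ : ∀ i j, Γ.Adj (σ i) (σ j) ↔ Γ.Adj i j)
  (hd : ∀ i, orbitSize σ i = 1 ∨ orbitSize σ i = orderOf σ)

theorem arVertices_eq_slab {w : List V} (hw : ∀ i, heightAfter σ Q.height w i =
      Q.height (starInvolution Γ i) - (orderOf σ : ℤ) * h) :
    Q.arVertices h = slab σ Q.height (heightAfter σ Q.height w) := by
  ext x
  rw [mem_arVertices_iff Q hw]
  have hpos := orbitSize_cast_pos σ x.1
  constructor
  · rintro ⟨n, hn, hx⟩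
    have h1 := mul_nonneg hpos.le (Int.natCast_nonneg n)
    have h2 : (orbitSize σ x.1 : ℤ) * n < orbitSize σ x.1 * w.count x.1 :=
      mul_lt_mul_of_pos_left (by exact_mod_cast hn) hpos
    exact ⟨⟨n, by linarith⟩, by linarith, by simp only [heightAfter]; linarith⟩
  · rintro ⟨⟨n, hn⟩, h1, h2⟩
    have hn0 : 0 ≤ n := by
      by_contra hneg
      have := mul_pos hpos (show 0 < -n by omega)
      nlinarith
    lift n to ℕ using hn0
    simp only [heightAfter] at h2
    have h5 : (orbitSize σ x.1 : ℤ) * n < orbitSize σ x.1 * w.count x.1 := by linarith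
    exact ⟨n, by exact_mod_cast lt_of_mul_lt_mul_left h5 hpos.le, by linarith⟩

include hσ hd in
theorem isARIso_unique (hΓ : IsFiniteType Γ) (hL : HasLongest Γ) (hξ : IsCut Γ σ Q.height)
    {w : List V} (hred : w ∈ Q.adaptedClass)
    (hw : ∀ i, heightAfter σ Q.height w i =
      Q.height (starInvolution Γ i) - (orderOf σ : ℤ) * h)
    {ψ : Q.arVertices h ≃ positiveRoots Γ} (hψ : Q.IsARIso h w ψ) :
    ψ = arEquiv Q hΓ hL hred.1 hw := by
  have hφ := isARIso_arEquiv Q hΓ hL hξ hred hw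
  set φ := arEquiv Q hΓ hL hred.1 hw with hφdef
  let θ : Q.arVertices h ≃ Q.arVertices h := ψ.trans φ.symm
  have hcol : ∀ x, (θ x).1.1 = x.1.1 := by
    intro x
    obtain ⟨k, hk1, hk2⟩ := hψ.2 x
    have h1 : θ x = positionEquiv Q hw k := by
      simp only [θ, Equiv.trans_apply, Equiv.symm_apply_eq]
      exact Subtype.ext (hk1.trans (arEquiv_positionEquiv Q hΓ hL hred.1 hw k).symm)
    rw [h1, ← hk2]; rfl
  have harr : ∀ x y, QDatum.RepetitionArrow Γ σ x.1 y.1 →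
      QDatum.RepetitionArrow Γ σ (θ x).1 (θ y).1 := by
    intro x y hxy
    rw [hφ.1]
    simpa [θ] using (hψ.1 x y).1 hxy
  have hisol : ∀ i, (∀ j, ¬ Γ.Adj i j) → ∀ x y : Q.arVertices h, x.1.1 = i → y.1.1 = i → x = y := by
    intro i hi x y hx hy
    obtain ⟨k, rfl⟩ := (positionEquiv Q hw).surjective x
    obtain ⟨l, rfl⟩ := (positionEquiv Q hw).surjective y
    rw [position_unique_of_isolated hΓ hred.1.isReduced hi hx hy]
  have hS := arVertices_eq_slab Q hw
  -- The vertex set is replaced by a variable, so that its equality with a slab can be substituted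
  -- in the type of θ.
  have hrigid : ∀ (S : Set (V × ℤ)), S = slab σ Q.height (heightAfter σ Q.height w) →
      ∀ θ : S ≃ S, (∀ x, (θ x).1.1 = x.1.1) →
      (∀ x y, QDatum.RepetitionArrow Γ σ x.1 y.1 →
        QDatum.RepetitionArrow Γ σ (θ x).1 (θ y).1) →
      (∀ i, (∀ j, ¬ Γ.Adj i j) → ∀ x y : S, x.1.1 = i → y.1.1 = i → x = y) →
      ∀ x, θ x = x := by
    rintro S rfl θ h1 h2 h3 x
    exact slab_rigid hσ hd hξ (hξ.heightAfter hred.2) (fun i => ⟨w.count i, by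
      simp only [heightAfter]; ring⟩) θ h1 h2 h3 x
  ext x : 1
  have := hrigid _ hS θ hcol harr hisol x
  simpa [θ, Equiv.symm_apply_eq] using this

end Uniqueness

end QData

namespace QData

/-! ### The classes of Q-data form an r-cluster point -/

section ClusterPoint

variable {V : Type*} [Fintype V] [DecidableEq V] {Γ : SimpleGraph V} {σ : Equiv.Perm V}
  {ξ : V → ℤ} {c : ℤ}

theorem wordAct_apply_of_not_mem {j : V} {w : List V} (hj : j ∉ w) (x : V → ℤ) :
    wordAct Γ w x j = x j := by
  induction w with
  | nil => rfl
  | cons i w ih =>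
    have hij : j ≠ i := fun h => hj (h ▸ List.mem_cons_self)
    have h1 : wordAct Γ (i :: w) x = rootRefl Γ i (wordAct Γ w x) := rfl
    rw [h1, rootRefl, Pi.sub_apply, Pi.smul_apply, Pi.single_eq_of_ne hij, smul_zero, sub_zero,
      ih fun h => hj (List.mem_cons_of_mem _ h)]

/-- Every letter occurs in a word for the longest element. -/
theorem mem_of_wordProd_eq_longestElement (hΓ : IsFiniteType Γ) (hL : HasLongest Γ) {w : List V}
    (hw : wordProd Γ w = longestElement Γ) (j : V) : j ∈ w := by
  by_contra hj
  obtain ⟨x, -, h1, h2⟩ := isPosRoot_neg_longestElement hΓ hL (isPosRoot_simpleRoot j)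
  rw [← hw, ← toWeight_single, ← toWeight_wordAct, ← map_neg] at h2
  -- A word without the letter j leaves coordinate j alone, so -w_0 α_j would have coordinate -1
  -- there.
  have h3 := congrFun (toWeight_injective hΓ h2) j
  rw [Pi.neg_apply, wordAct_apply_of_not_mem hj, Pi.single_eq_same] at h3
  have h4 := h1 j
  rw [← h3] at h4
  norm_num at h4

theorem mem_commClass_self (w : List V) : w ∈ commClass Γ w := Relation.EqvGen.refl w

variable (hσ : ∀ i j, Γ.Adj (σ i) (σ j) ↔ Γ.Adj i j)

include hσ in
theorem reflectionStep_adaptedWords (hΓ : IsFiniteType Γ) (hL : HasLongest Γ)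
    (h : IsGood Γ σ c ξ) {i : V} (hi : IsSource Γ ξ i) :
    ReflectionStep Γ (adaptedWords Γ σ ξ) (adaptedWords Γ σ (reflectHeight σ ξ i)) := by
  obtain ⟨w, hw, -⟩ := id h
  obtain ⟨u, hu⟩ := exists_eqvGen_cons hi hw.2 (mem_of_isSource hΓ hL hw hi)
  have hu' : i :: u ∈ adaptedWords Γ σ ξ := by
    rw [adaptedWords_eq_commClass hΓ hw]; exact hu
  exact ⟨i, u, hu'.1, adaptedWords_eq_commClass hΓ hu',
    adaptedWords_eq_commClass hΓ (h.rotate hσ hΓ hL hu').1⟩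

include hσ in
theorem exists_of_reflectionStep_left (hΓ : IsFiniteType Γ) (hL : HasLongest Γ)
    (h : IsGood Γ σ c ξ) {d : Set (List V)} (hd : ReflectionStep Γ (adaptedWords Γ σ ξ) d) :
    ∃ i, IsSource Γ ξ i ∧ d = adaptedWords Γ σ (reflectHeight σ ξ i) := by
  obtain ⟨i, w, -, h2, rfl⟩ := hd
  have hw : i :: w ∈ adaptedWords Γ σ ξ := h2 ▸ mem_commClass_self _
  exact ⟨i, hw.2.1, (adaptedWords_eq_commClass hΓ (h.rotate hσ hΓ hL hw).1).symm⟩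

-- The rotation is undone. If w followed by i* is adapted to ξ and ζ is the height function after w,
-- then ξ' = ζ∘* + c satisfies s_i ξ' = ξ, and i :: w is adapted to ξ'.
include hσ in
theorem exists_of_reflectionStep_right (hΓ : IsFiniteType Γ) (hL : HasLongest Γ)
    (hξ : IsCut Γ σ ξ) (h : IsGood Γ σ c ξ) {d : Set (List V)}
    (hd : ReflectionStep Γ d (adaptedWords Γ σ ξ)) :
    ∃ ξ' i, IsCut Γ σ ξ' ∧ reflectHeight σ ξ' i = ξ ∧ d = adaptedWords Γ σ ξ' := by
  obtain ⟨i, w, h1, rfl, h2⟩ := hd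
  have hw : w ++ [starInvolution Γ i] ∈ adaptedWords Γ σ ξ := h2 ▸ mem_commClass_self _
  have hfin := h.heightAfter_eq hΓ hw
  obtain ⟨ha, hs⟩ := (adapted_append _ _ _).1 hw.2
  rw [adapted_singleton] at hs
  set ζ := heightAfter σ ξ w with hζ
  have hinv := starInvolution_starInvolution hΓ hL
  have hre : reflectHeight σ (fun k => ζ (starInvolution Γ k) + c) i = ξ := by
    funext j
    rw [reflectHeight_star hσ hΓ hL]
    have := hfin (starInvolution Γ j)
    rw [heightAfter_append, heightAfter_cons, heightAfter_nil, ← hζ, hinv] at this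
    rw [this]; ring
  refine ⟨fun k => ζ (starInvolution Γ k) + c, i, (hξ.heightAfter ha).star hσ hΓ hL c, hre, ?_⟩
  refine (adaptedWords_eq_commClass hΓ ⟨h1, ⟨fun j hij => ?_, by rwa [hre]⟩⟩).symm
  have := hs (starInvolution Γ j) ((starInvolution_adj hΓ hL _ _).2 hij)
  omega

theorem dvd_reflectHeight_sub (i j : V) :
    2 * (orbitSize σ j : ℤ) ∣ reflectHeight σ ξ i j - ξ j := by
  simp only [reflectHeight]
  split_ifs
  · exact ⟨-1, by ring⟩
  · simp

include hσ in
theorem eqvGen_heightAfter (hΓ : IsFiniteType Γ) (hL : HasLongest Γ) {u : List V}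
    (h : IsGood Γ σ c ξ) (hu : Adapted Γ σ ξ u) :
    Relation.EqvGen (ReflectionStep Γ) (adaptedWords Γ σ ξ)
      (adaptedWords Γ σ (heightAfter σ ξ u)) := by
  induction u generalizing ξ with
  | nil => rw [heightAfter_nil]; exact .refl _
  | cons i u ih =>
    rw [heightAfter_cons]
    exact .trans _ _ _ (.rel _ _ (reflectionStep_adaptedWords hσ hΓ hL h hu.1))
      (ih (h.reflectHeight hσ hΓ hL hu.1) hu.2)

/-- Just before its first occurrence j is a source at its original height ξ_j. The cut condition
then puts i exactly d_i below it, after i has dropped by 2d_i for each of its occurrences. -/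
theorem height_sub_of_adapted (hξ : IsCut Γ σ ξ) {u v : List V} {i j : V}
    (hw : Adapted Γ σ ξ (u ++ j :: v)) (hj : j ∉ u) (hij : Γ.Adj i j)
    (hle : orbitSize σ i ≤ orbitSize σ j) :
    ξ j - ξ i = orbitSize σ i - 2 * (orbitSize σ i : ℤ) * u.count i := by
  obtain ⟨h1, h2, -⟩ := (adapted_append _ _ _).1 hw
  have hcut := hξ.heightAfter h1
  have h3 := hcut.le_add i j hij hle
  have h4 := hcut.add_min_le hij.symm (h2 i hij.symm)
  rw [min_eq_right (by exact_mod_cast hle)] at h4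
  rw [heightAfter_of_notMem ξ hj] at h3 h4
  simp only [heightAfter] at h3 h4
  omega

variable {ε : V → ℤ} (hd : ∀ i, orbitSize σ i = 1 ∨ orbitSize σ i = orderOf σ)

/-- The Q-datum attached to a cut. -/
def QDatum.ofCut (hσ : ∀ i j, Γ.Adj (σ i) (σ j) ↔ Γ.Adj i j)
    (hd : ∀ i, orbitSize σ i = 1 ∨ orbitSize σ i = orderOf σ) (hξ : IsCut Γ σ ξ)
    (hp : ∀ i, 2 * (orbitSize σ i : ℤ) ∣ ξ i - ε i) : QDatum Γ σ ε :=
  ⟨ξ, hξ.isHeightFunction hσ hd, hp⟩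

theorem eq_of_adj_eq (hconn : Γ.Preconnected) {f : V → ℤ}
    (hf : ∀ i j, Γ.Adj i j → f i = f j) (i j : V) : f i = f j := by
  obtain ⟨p⟩ := hconn i j
  induction p with
  | nil => rfl
  | cons h _ ih => exact (hf _ _ h).trans ih

include hd in
theorem exists_orbitSize_eq_orderOf [Nonempty V] : ∃ i, orbitSize σ i = orderOf σ := by
  by_contra! hne
  have h1 : σ = 1 := Equiv.ext fun i =>
    apply_eq_of_orbitSize_eq_one ((hd i).resolve_right (hne i))
  obtain ⟨i⟩ := ‹Nonempty V›
  have h2 := (hd i).resolve_right (hne i)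
  apply hne i
  rw [h2, h1, orderOf_one]

include hd in
/-- A Q-datum is determined up to a shift by its adapted words. -/
theorem QDatum.rel_of_mem_adaptedClass [Nonempty V] (hΓ : IsFiniteType Γ) (hL : HasLongest Γ)
    (hconn : Γ.Preconnected) (hε : IsParityFunction Γ σ ε) {Q Q' : QDatum Γ σ ε} {w : List V}
    (hw : w ∈ Q.adaptedClass) (hw' : w ∈ Q'.adaptedClass) : Q ≈ Q' := by
  have hQ := Q.isCut hd hε
  have hQ' := Q'.isCut hd hε
  have key : ∀ i j, Γ.Adj i j → orbitSize σ i ≤ orbitSize σ j →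
      Q.height j - Q.height i = Q'.height j - Q'.height i := by
    intro i j hij hle
    obtain ⟨u, v, rfl, hu⟩ := List.eq_append_cons_of_mem
      (mem_of_wordProd_eq_longestElement hΓ hL hw.1.1 j)
    rw [height_sub_of_adapted hQ hw.2 hu hij hle, height_sub_of_adapted hQ' hw'.2 hu hij hle]
  have hconst := eq_of_adj_eq hconn (f := fun i => Q'.height i - Q.height i) fun i j hij => by
    rcases le_total (orbitSize σ i) (orbitSize σ j) with hle | hle
    · have := key i j hij hle; omega
    · have := key j i hij.symm hle; omega
  -- The two height functions differ by a constant; parity at a vertex with orbit of size r shows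
  -- that this constant lies in 2rℤ.
  obtain ⟨i, hi⟩ := exists_orbitSize_eq_orderOf hd
  obtain ⟨m, hm⟩ := dvd_sub (Q'.parity i) (Q.parity i)
  rw [hi] at hm
  refine ⟨m, fun j => ?_⟩
  have := hconst i j
  linarith

variable (hgood : ∀ ξ, IsCut Γ σ ξ → (∀ i, 2 * (orbitSize σ i : ℤ) ∣ ξ i - ε i) → IsGood Γ σ c ξ)

include hσ hd hgood in
/-- The classes of Q-data form an r-cluster point. -/
theorem mem_range_adaptedClass_iff (hΓ : IsFiniteType Γ) (hL : HasLongest Γ)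
    (hε : IsParityFunction Γ σ ε) (Q : QDatum Γ σ ε) (d : Set (List V)) :
    d ∈ Set.range (QDatum.adaptedClass (Γ := Γ) (σ := σ) (ε := ε)) ↔
      Relation.EqvGen (ReflectionStep Γ) Q.adaptedClass d := by
  constructor
  · rintro ⟨Q', rfl⟩
    obtain ⟨m, u, hu1, hu2⟩ := exists_adapted_to_shift (Q.isCut hd hε) (Q'.isCut hd hε)
      (fun i => dvd_of_dvd_of_eq (dvd_sub (Q.parity i) (Q'.parity i)) (by ring))
      (by exact_mod_cast orderOf_pos σ) (orbitSize_dvd_orderOf hd)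
    have h1 := eqvGen_heightAfter hσ hΓ hL (hgood _ (Q.isCut hd hε) Q.parity) hu1
    rw [hu2, adaptedWords_add_const] at h1
    exact h1
  -- The generated equivalence relation also uses steps backwards, so the set of classes must be
  -- closed under reflections in both directions.
  · have key : ∀ a b, Relation.EqvGen (ReflectionStep Γ) a b →
        (a ∈ Set.range (QDatum.adaptedClass (Γ := Γ) (σ := σ) (ε := ε)) ↔
          b ∈ Set.range (QDatum.adaptedClass (Γ := Γ) (σ := σ) (ε := ε))) := by
      intro a b hab
      induction hab with
      | refl => rfl
      | symm _ _ _ ih => exact ih.symm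
      | trans _ _ _ _ _ ih1 ih2 => exact ih1.trans ih2
      | rel a b hab =>
        constructor
        · rintro ⟨Q, rfl⟩
          have hQ := Q.isCut hd hε
          obtain ⟨i, hi, rfl⟩ := exists_of_reflectionStep_left hσ hΓ hL
            (hgood _ hQ Q.parity) hab
          exact ⟨.ofCut hσ hd (hQ.reflectHeight hi) fun j => dvd_of_dvd_of_eq
            (dvd_add (dvd_reflectHeight_sub i j) (Q.parity j)) (by ring), rfl⟩
        · rintro ⟨Q, rfl⟩
          have hQ := Q.isCut hd hε
          obtain ⟨ξ', i, h1, h2, rfl⟩ := exists_of_reflectionStep_right hσ hΓ hL hQ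
            (hgood _ hQ Q.parity) hab
          refine ⟨.ofCut hσ hd h1 fun j => ?_, rfl⟩
          have h3 := dvd_reflectHeight_sub (σ := σ) (ξ := ξ') i j
          rw [h2] at h3
          exact dvd_of_dvd_of_eq (dvd_sub (Q.parity j) h3) (by ring)
    exact fun h => (key _ _ h).1 ⟨Q, rfl⟩

include hσ hd hgood in
theorem isRClusterPoint_range (hΓ : IsFiniteType Γ) (hL : HasLongest Γ)
    (hε : IsParityFunction Γ σ ε) (Q : QDatum Γ σ ε) :
    IsRClusterPoint Γ (Set.range (QDatum.adaptedClass (Γ := Γ) (σ := σ) (ε := ε))) := by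
  obtain ⟨w, hw, -⟩ := hgood _ (Q.isCut hd hε) Q.parity
  refine ⟨w, hw.1, Set.ext fun d => ?_⟩
  rw [mem_range_adaptedClass_iff hσ hd hgood hΓ hL hε Q]
  exact iff_of_eq (congrArg (fun a => Relation.EqvGen (ReflectionStep Γ) a d)
    (adaptedWords_eq_commClass hΓ hw))

theorem IsRClusterPoint.eq_of_mem {P P' : Set (Set (List V))} (h : IsRClusterPoint Γ P)
    (h' : IsRClusterPoint Γ P') {d : Set (List V)} (hd : d ∈ P) (hd' : d ∈ P') : P = P' := by
  obtain ⟨w, -, rfl⟩ := h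
  obtain ⟨w', -, rfl⟩ := h'
  have h1 : Relation.EqvGen (ReflectionStep Γ) (commClass Γ w) (commClass Γ w') :=
    .trans _ _ _ hd (.symm _ _ hd')
  ext e
  exact ⟨fun h => .trans _ _ _ (.symm _ _ h1) h, fun h => .trans _ _ _ h1 h⟩

include hd hgood in
theorem bijOn_classMap [Nonempty V] (hΓ : IsFiniteType Γ) (hL : HasLongest Γ)
    (hconn : Γ.Preconnected) (hε : IsParityFunction Γ σ ε) :
    Set.BijOn (QDatum.classMap Γ σ ε) Set.univ
      (Set.range (QDatum.adaptedClass (Γ := Γ) (σ := σ) (ε := ε))) := by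
  refine ⟨?_, ?_, ?_⟩
  · rintro ⟨Q⟩ -
    exact ⟨Q, rfl⟩
  · rintro ⟨Q⟩ - ⟨Q'⟩ - h
    obtain ⟨w, hw, -⟩ := hgood _ (Q.isCut hd hε) Q.parity
    have h' : Q.adaptedClass = Q'.adaptedClass := h
    exact Quotient.sound (QDatum.rel_of_mem_adaptedClass hd hΓ hL hconn hε hw (h' ▸ hw))
  · rintro _ ⟨Q, rfl⟩
    exact ⟨⟦Q⟧, trivial, rfl⟩

include hσ hd hgood in
/-- The first part of the main theorem: the class of a Q-datum and its quiver. -/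
theorem adaptedClass_and_quiver (hΓ : IsFiniteType Γ) (hL : HasLongest Γ)
    (hε : IsParityFunction Γ σ ε) {h : ℕ} (hc : c = (orderOf σ : ℤ) * h) (Q : QDatum Γ σ ε) :
    (∃ w, IsReducedWord Γ w (longestElement Γ) ∧ Q.adaptedClass = commClass Γ w) ∧
      ∃ φ : Q.arVertices h ≃ positiveRoots Γ,
        ∀ w ∈ Q.adaptedClass, ∀ ψ, Q.IsARIso h w ψ ↔ ψ = φ := by
  subst hc
  have hQ := Q.isCut hd hε
  have hg := hgood _ hQ Q.parity
  obtain ⟨w, hw, hfin⟩ := id hg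
  refine ⟨⟨w, hw.1, adaptedWords_eq_commClass hΓ hw⟩, arEquiv Q hΓ hL hw.1 hfin, ?_⟩
  intro w' hw' ψ
  have hfin' := hg.heightAfter_eq hΓ hw'
  have heqv : Relation.EqvGen (CommStep Γ) w w' := by
    have h1 : w' ∈ adaptedWords Γ σ Q.height := hw'
    rw [adaptedWords_eq_commClass hΓ hw] at h1
    exact h1
  rw [arEquiv_eq_of_eqvGen Q hΓ hL hw.1 hw'.1 hfin hfin' heqv]
  constructor
  · exact isARIso_unique Q hσ hd hΓ hL hQ hw' hfin'
  · rintro rfl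
    exact isARIso_arEquiv Q hΓ hL hQ hw' hfin'

end ClusterPoint

end QData

namespace QData

/-! ### Height functions with prescribed signs on orbit representatives -/

section OrbitSection

variable {V : Type*} [Fintype V] [DecidableEq V] {Γ : SimpleGraph V} {σ : Equiv.Perm V}

theorem orbitSize_le_of_pow_eq {i : V} {l : ℕ} (hl : 0 < l) (h : (σ ^ l) i = i) :
    orbitSize σ i ≤ l := by
  have hsub : {j | σ.SameCycle i j} ⊆ ((Finset.range l).image fun k => (σ ^ k) i : Finset V) := by
    intro j hj
    obtain ⟨n, -, rfl⟩ := exists_lt_orderOf_of_sameCycle hj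
    simp only [Finset.coe_image, Set.mem_image, Finset.coe_range, Set.mem_Iio]
    refine ⟨n % l, Nat.mod_lt _ hl, ?_⟩
    conv_rhs => rw [← Nat.mod_add_div n l, pow_add, pow_mul, Equiv.Perm.mul_apply,
      pow_apply_eq_of_fixed h]
  refine (Set.ncard_le_ncard hsub (Finset.finite_toSet _)).trans ?_
  rw [Set.ncard_coe_finset]
  exact Finset.card_image_le.trans (by simp)

theorem pow_apply_injOn {i : V} {l m : ℕ} (hl : l < orbitSize σ i) (hm : m < orbitSize σ i)
    (h : (σ ^ l) i = (σ ^ m) i) : l = m := by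
  have key : ∀ l m : ℕ, l < m → m < orbitSize σ i → (σ ^ l) i ≠ (σ ^ m) i := by
    intro l m hlm hm h
    obtain ⟨k, rfl⟩ := Nat.exists_eq_add_of_lt hlm
    rw [add_assoc, pow_add, Equiv.Perm.mul_apply] at h
    have := orbitSize_le_of_pow_eq (Nat.succ_pos k) ((σ ^ l).injective h).symm
    omega
  rcases lt_trichotomy l m with h' | h' | h'
  · exact (key l m h' hm h).elim
  · exact h'
  · exact (key m l h' hl h.symm).elim

variable (hd : ∀ i, orbitSize σ i = 1 ∨ orbitSize σ i = orderOf σ)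

include hd in
theorem pow_orbitSize_apply (i : V) : (σ ^ orbitSize σ i) i = i := by
  rcases hd i with h | h
  · rw [h, pow_one, apply_eq_of_orbitSize_eq_one h]
  · rw [h, pow_orderOf_eq_one]; rfl

include hd in
theorem exists_lt_orbitSize {i j : V} (h : σ.SameCycle i j) :
    ∃ l < orbitSize σ i, (σ ^ l) i = j := by
  obtain ⟨n, -, rfl⟩ := exists_lt_orderOf_of_sameCycle h
  refine ⟨n % orbitSize σ i, Nat.mod_lt _ (orbitSize_pos σ i), ?_⟩
  conv_rhs => rw [← Nat.mod_add_div n (orbitSize σ i), pow_add, pow_mul, Equiv.Perm.mul_apply,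
    pow_apply_eq_of_fixed (pow_orbitSize_apply hd i)]

variable (σ) in
/-- A choice of a representative in each orbit of `σ`. -/
structure OrbitSection where
  rep : V → V
  sameCycle : ∀ i, σ.SameCycle (rep i) i
  rep_eq : ∀ i j, σ.SameCycle i j → rep i = rep j

variable (Γ σ) in
/-- The diagram, modulo `σ`, is a rooted tree, and the orbits are not larger than their parents. -/
structure RootedFolding where
  depth : V → ℕ
  depth_perm : ∀ i, depth (σ i) = depth i
  depth_adj : ∀ i j, Γ.Adj i j → depth j + 1 = depth i ∨ depth i + 1 = depth j
  exists_parent : ∀ i, depth i ≠ 0 → ∃ j, Γ.Adj i j ∧ depth j + 1 = depth i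
  root : ∀ i j, depth i = 0 → depth j = 0 → σ.SameCycle i j
  parent_le : ∀ i j, Γ.Adj i j → depth j + 1 = depth i → orbitSize σ i ≤ orbitSize σ j
  parent_sameCycle : ∀ i j j', Γ.Adj i j → Γ.Adj i j' → depth j + 1 = depth i →
    depth j' + 1 = depth i → σ.SameCycle j j'
  parent_unique : ∀ i j j', Γ.Adj i j → Γ.Adj i j' → depth j + 1 = depth i →
    depth j' + 1 = depth i → orbitSize σ i = orbitSize σ j → j = j'

/-- Sum f along the path to the root; only vertices of nonzero depth contribute. -/
theorem exists_potential {depth : V → ℕ} {par : V → V}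
    (hpar : ∀ j, depth j ≠ 0 → depth (par j) + 1 = depth j) (f : V → ℤ) :
    ∃ x : V → ℤ, ∀ j, depth j ≠ 0 → x j = x (par j) + f j := by
  refine ⟨fun j => ∑ k ∈ Finset.range (depth j), f (par^[k] j), fun j hj => ?_⟩
  have h1 := hpar j hj
  dsimp only
  rw [← h1, Finset.sum_range_succ']
  rfl

variable (hσ : ∀ i j, Γ.Adj (σ i) (σ j) ↔ Γ.Adj i j)

namespace RootedFolding

variable (F : RootedFolding Γ σ)

theorem depth_pow (l : ℕ) (i : V) : F.depth ((σ ^ l) i) = F.depth i := by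
  induction l with
  | zero => rfl
  | succ l ih => rw [pow_succ', Equiv.Perm.mul_apply, F.depth_perm, ih]

theorem depth_eq_of_sameCycle {i j : V} (h : σ.SameCycle i j) : F.depth i = F.depth j := by
  obtain ⟨l, -, rfl⟩ := exists_lt_orderOf_of_sameCycle h
  rw [F.depth_pow]

include F hd in
/-- The congruences which define a parity function determine it up to a constant. -/
theorem exists_shift_parity [Nonempty V] {ξ ε : V → ℤ} (hξ : IsCut Γ σ ξ)
    (hε : IsParityFunction Γ σ ε) : ∃ c, ∀ i, 2 * (orbitSize σ i : ℤ) ∣ (ξ i + c) - ε i := by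
  obtain ⟨-, -, hε2, hε3⟩ := hε
  obtain ⟨i₀, hi₀⟩ : ∃ i, F.depth i = 0 := by
    obtain ⟨i⟩ := ‹Nonempty V›
    induction hn : F.depth i generalizing i with
    | zero => exact ⟨i, hn⟩
    | succ n ih =>
      obtain ⟨j, -, hj⟩ := F.exists_parent i (by omega)
      exact ih j (by omega)
  refine ⟨ε i₀ - ξ i₀, fun i => ?_⟩
  induction hn : F.depth i generalizing i with
  | zero =>
    obtain ⟨l, -, rfl⟩ := exists_lt_orderOf_of_sameCycle (F.root i₀ i hi₀ hn)
    have h1 := hξ.shift_pow i₀ l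
    have h2 := (hε2 i₀ l).dvd
    rw [zpow_natCast] at h2
    rw [orbitSize_pow_apply]
    exact dvd_of_dvd_of_eq (dvd_add h1 h2) (by ring)
  | succ n ih =>
    obtain ⟨j, hij, hj⟩ := F.exists_parent i (by omega)
    have hle := F.parent_le i j hij hj
    have h1 := ih j (by omega)
    have h2 := hξ.dvd i j hij hle
    have h3 := (hε3 i j hij).dvd
    rw [min_eq_left (by exact_mod_cast hle)] at h3
    have h4 : 2 * (orbitSize σ i : ℤ) ∣ 2 * (orbitSize σ j : ℤ) :=
      mul_dvd_mul_left 2 (by exact_mod_cast orbitSize_dvd_of_le hd hle)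
    exact dvd_of_dvd_of_eq (dvd_sub (dvd_add (dvd_sub (h4.trans h1) h2) h3)
      (dvd_refl (2 * (orbitSize σ i : ℤ)))) (by ring)

include F hσ hd in
/-- Height functions with prescribed signs on the edges between representatives. -/
theorem exists_isCut (S : OrbitSection σ) (b : V → V → Prop)
    (hb : ∀ i j, Γ.Adj i j → S.rep i = i → S.rep j = j → (b i j ↔ ¬ b j i)) :
    ∃ ξ, IsCut Γ σ ξ ∧
      (∀ i, ∀ l < orbitSize σ i, ξ ((σ ^ l) (S.rep i)) = ξ (S.rep i) - 2 * l) ∧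
      (∀ i j, Γ.Adj i j → S.rep i = i → S.rep j ≠ j → ξ j < ξ i) ∧
      ∀ i j, Γ.Adj i j → S.rep i = i → S.rep j = j →
        |ξ i - ξ j| = min (orbitSize σ i : ℤ) (orbitSize σ j) ∧ (ξ j < ξ i ↔ b i j) := by
  classical
  have hrepd : ∀ i, orbitSize σ (S.rep i) = orbitSize σ i := fun i =>
    orbitSize_eq_of_sameCycle (S.sameCycle i)
  have hrep2 : ∀ i, S.rep (S.rep i) = S.rep i := fun i => S.rep_eq _ _ (S.sameCycle i)
  have hex : ∀ i, ∃ l, l < orbitSize σ i ∧ (σ ^ l) (S.rep i) = i := by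
    intro i
    rw [← hrepd]
    exact exists_lt_orbitSize hd (S.sameCycle i)
  choose e he1 he2 using hex
  have he3 : ∀ i l, l < orbitSize σ i → (σ ^ l) (S.rep i) = i → e i = l := by
    intro i l hl h
    exact pow_apply_injOn (i := S.rep i) (by rw [hrepd]; exact he1 i) (by rwa [hrepd])
      ((he2 i).trans h.symm)
  have he0 : ∀ i, S.rep i = i ↔ e i = 0 := by
    intro i
    constructor
    · intro h; exact he3 i 0 (orbitSize_pos σ i) (by rw [pow_zero]; exact h)
    · intro h; have := he2 i; rwa [h] at this
  have hpow : ∀ i l, S.rep ((σ ^ l) i) = S.rep i := fun i l =>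
    (S.rep_eq _ _ (sameCycle_pow l i)).symm
  -- a parent of each representative
  have hpar : ∀ i, F.depth i ≠ 0 → ∃ j, Γ.Adj (S.rep i) j ∧ F.depth j + 1 = F.depth i := by
    intro i hi
    have h1 := F.depth_eq_of_sameCycle (S.sameCycle i)
    obtain ⟨j, h2, h3⟩ := F.exists_parent (S.rep i) (by rwa [h1])
    exact ⟨j, h2, by rw [h3, h1]⟩
  let par : V → V := fun i => if h : F.depth i ≠ 0 then (hpar i h).choose else i
  have hpar1 : ∀ i, F.depth i ≠ 0 → Γ.Adj (S.rep i) (par i) ∧ F.depth (par i) + 1 = F.depth i := by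
    intro i hi
    simp only [par, dif_pos hi]
    exact (hpar i hi).choose_spec
  -- Here e i counts the applications of σ leading from the representative to i. The number s i will
  -- be the height of a representative i over its parent, up to a correction when the parent's orbit
  -- is larger. Its sign follows b if l i = 0, and is positive otherwise, because representatives
  -- must lie above adjacent non-representatives.
  let l : V → ℕ := fun i => if orbitSize σ i = orbitSize σ (par i) then e (par i) else 0
  let s : V → ℤ := fun i => if l i = 0 ∧ ¬ b i (S.rep (par i)) then -(orbitSize σ i : ℤ)
    else orbitSize σ i
  obtain ⟨x, hx⟩ := exists_potential (depth := F.depth) (par := fun i => S.rep (par i))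
    (fun i hi => by
      rw [F.depth_eq_of_sameCycle (S.sameCycle (par i))]; exact (hpar1 i hi).2)
    (fun i => s i - 2 * l i)
  let ξ : V → ℤ := fun i => x (S.rep i) - 2 * e i
  -- the values on the two ends of an edge
  have hedge : ∀ i j, Γ.Adj i j → F.depth j + 1 = F.depth i →
      (orbitSize σ i = orbitSize σ j ∧ ∃ (m : ℕ) (z : ℤ), m < orbitSize σ i ∧
        (m ≠ 0 → z = orbitSize σ i) ∧
        (m = 0 → (b (S.rep i) (S.rep j) ∧ z = orbitSize σ i ∨
          ¬ b (S.rep i) (S.rep j) ∧ z = -orbitSize σ i)) ∧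
        (e j = e i + m ∧ ξ i - ξ j = z ∨
          e j + orbitSize σ i = e i + m ∧ ξ i - ξ j = z - 2 * orbitSize σ i)) ∨
      (orbitSize σ i < orbitSize σ j ∧ e i = 0 ∧ ∃ z : ℤ,
        (b (S.rep i) (S.rep j) ∧ z = 1 ∨ ¬ b (S.rep i) (S.rep j) ∧ z = -1) ∧
        ξ i - ξ j = z + 2 * e j) := by
    intro i j hij hdep
    have hi0 : F.depth (S.rep i) ≠ 0 := by
      rw [F.depth_eq_of_sameCycle (S.sameCycle i)]; omega
    obtain ⟨hp1, hp2⟩ := hpar1 (S.rep i) hi0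
    rw [hrep2] at hp1
    rw [F.depth_eq_of_sameCycle (S.sameCycle i)] at hp2
    set p := par (S.rep i) with hp
    have hp3 : Γ.Adj i ((σ ^ e i) p) := by
      have := (adj_pow_iff hσ (e i) _ _).2 hp1
      rwa [he2] at this
    have hp4 : F.depth ((σ ^ e i) p) + 1 = F.depth i := by rw [F.depth_pow]; exact hp2
    have hcyc := F.parent_sameCycle i j _ hij hp3 hdep hp4
    have hrepj : S.rep j = S.rep p := by rw [S.rep_eq _ _ hcyc, hpow]
    have hdj : orbitSize σ j = orbitSize σ p := by
      rw [orbitSize_eq_of_sameCycle hcyc, orbitSize_pow_apply]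
    have hξ : ξ i - ξ j = s (S.rep i) - 2 * l (S.rep i) - 2 * e i + 2 * e j := by
      simp only [ξ]
      rw [hx (S.rep i) hi0, hrepj]
      ring
    rcases (F.parent_le i j hij hdep).lt_or_eq with hlt | heq
    · right
      obtain ⟨hi1, -⟩ := orbitSize_eq_of_lt hd hlt
      have hei : e i = 0 := by have := he1 i; omega
      have hl : l (S.rep i) = 0 := if_neg (by rw [hrepd, ← hp, ← hdj]; exact hlt.ne)
      refine ⟨hlt, hei, s (S.rep i), ?_, by rw [hξ, hl, hei]; push_cast; ring⟩
      rw [hrepj]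
      by_cases hbb : b (S.rep i) (S.rep p)
      · left
        refine ⟨hbb, ?_⟩
        simp only [s]
        rw [if_neg (fun h => h.2 hbb), hrepd, hi1, Nat.cast_one]
      · right
        refine ⟨hbb, ?_⟩
        simp only [s]
        rw [if_pos ⟨hl, hbb⟩, hrepd, hi1, Nat.cast_one]
    · left
      have hj : j = (σ ^ e i) p := F.parent_unique i j _ hij hp3 hdep hp4 heq
      have hl : l (S.rep i) = e p := if_pos (by rw [hrepd, ← hp, ← hdj]; exact heq)
      have hlt : e p < orbitSize σ i := by rw [heq, hdj]; exact he1 p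
      have hjp : (σ ^ (e i + e p)) (S.rep j) = j := by
        rw [hrepj, pow_add, Equiv.Perm.mul_apply, he2, ← hj]
      refine ⟨heq, e p, s (S.rep i), hlt, fun h0 => ?_, fun h0 => ?_, ?_⟩
      · simp only [s]
        rw [if_neg (fun h => h0 (hl ▸ h.1)), hrepd]
      · rw [hrepj]
        by_cases hbb : b (S.rep i) (S.rep p)
        · left
          refine ⟨hbb, ?_⟩
          simp only [s]
          rw [if_neg (fun h => h.2 hbb), hrepd]
        · right
          refine ⟨hbb, ?_⟩
          simp only [s]
          rw [if_pos ⟨hl.trans h0, hbb⟩, hrepd]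
      · rw [hξ, hl]
        by_cases hsum : e i + e p < orbitSize σ i
        · left
          have hej := he3 j (e i + e p) (by rw [← heq]; exact hsum) hjp
          exact ⟨hej, by rw [hej]; push_cast; ring⟩
        -- The exponent passes the end of the orbit. Since e j < e i excludes m = 0 here, z = d_i,
        -- and the difference of heights is d_i - 2d_i = -d_i.
        · right
          have hei := he1 i
          have hej := he3 j (e i + e p - orbitSize σ i) (by rw [← heq]; omega) (by
            have h1 : e i + e p = (e i + e p - orbitSize σ i) + orbitSize σ (S.rep j) := by
              rw [hrepd, ← heq]; omega
            rw [h1, pow_add, Equiv.Perm.mul_apply, pow_orbitSize_apply hd] at hjp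
            exact hjp)
          refine ⟨by omega, ?_⟩
          have : (e j : ℤ) = e i + e p - orbitSize σ i := by omega
          rw [this]; ring
  have hcut : ∀ i j, Γ.Adj i j → F.depth j + 1 = F.depth i →
      (2 * (orbitSize σ i : ℤ) ∣ ξ j - ξ i - orbitSize σ i) ∧ ξ j ≤ ξ i + orbitSize σ i ∧
        ξ i ≤ ξ j + 2 * orbitSize σ j - orbitSize σ i := by
    intro i j hij hdep
    rcases hedge i j hij hdep with ⟨heq, m, z, hm, hz1, hz2, hz⟩ | ⟨hlt, -, z, hz1, hz⟩
    · have hzz : z = orbitSize σ i ∨ (z = -orbitSize σ i ∧ m = 0) := by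
        by_cases hm0 : m = 0
        · rcases hz2 hm0 with h | h
          · exact Or.inl h.2
          · exact Or.inr ⟨h.2, hm0⟩
        · exact Or.inl (hz1 hm0)
      have he := he1 i
      have hdiff : ξ i - ξ j = orbitSize σ i ∨ ξ i - ξ j = -orbitSize σ i := by omega
      rw [← heq]
      refine ⟨?_, by omega, by omega⟩
      rcases hdiff with h | h
      · exact ⟨-1, by linarith⟩
      · exact ⟨0, by linarith⟩
    · obtain ⟨h1, h2⟩ := orbitSize_eq_of_lt hd hlt
      have he := he1 j
      rw [h1]
      refine ⟨?_, by omega, by omega⟩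
      rcases hz1 with h | h <;> omega
  refine ⟨ξ, ⟨fun i j _ h => orbitSize_dvd_of_le hd h, fun i => ?_, fun i j hij hle => ?_,
    fun i j hij hle => ?_, fun i j hij hle => ?_⟩, fun i m hm => ?_, fun i j hij hi hj => ?_,
    fun i j hij hi hj => ?_⟩
  · have hrep : S.rep (σ i) = S.rep i := hpow i 1
    simp only [ξ, hrep]
    by_cases hlt : e i + 1 < orbitSize σ i
    · have := he3 (σ i) (e i + 1) (by rwa [orbitSize_apply])
        (by rw [hrep, pow_succ', Equiv.Perm.mul_apply, he2])
      rw [this]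
      exact ⟨0, by push_cast; ring⟩
    · have h1 := he1 i
      have h2 : e i + 1 = orbitSize σ (S.rep i) := by rw [hrepd]; omega
      have h3 : e (σ i) = 0 := (he0 _).1 (by
        rw [hrep, ← pow_orbitSize_apply hd (S.rep i), ← h2, pow_succ', Equiv.Perm.mul_apply, he2])
      rw [h3, ← hrepd i, ← h2]
      exact ⟨1, by push_cast; ring⟩
  · rcases F.depth_adj i j hij with hdep | hdep
    · exact (hcut i j hij hdep).1
    · have heq : orbitSize σ i = orbitSize σ j := le_antisymm hle (F.parent_le j i hij.symm hdep)
      have := odd_multiple_neg (hcut j i hij.symm hdep).1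
      rw [← heq, neg_sub] at this
      exact this
  · rcases F.depth_adj i j hij with hdep | hdep
    · exact (hcut i j hij hdep).2.1
    · have heq : orbitSize σ i = orbitSize σ j := le_antisymm hle (F.parent_le j i hij.symm hdep)
      have := (hcut j i hij.symm hdep).2.2
      rw [← heq] at this
      omega
  · rcases F.depth_adj i j hij with hdep | hdep
    · exact (hcut i j hij hdep).2.2
    · have heq : orbitSize σ i = orbitSize σ j := le_antisymm hle (F.parent_le j i hij.symm hdep)
      have := (hcut j i hij.symm hdep).2.1
      rw [← heq] at this ⊢
      omega
  · have h1 : e ((σ ^ m) (S.rep i)) = m := he3 _ m (by rwa [orbitSize_pow_apply, hrepd])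
      (by rw [hpow, hrep2])
    have h2 : e (S.rep i) = 0 := (he0 _).1 (hrep2 i)
    simp only [ξ, h1, h2, hpow]
    push_cast; ring
  · have hi' := (he0 i).1 hi
    have hj' : e j ≠ 0 := fun h => hj ((he0 j).2 h)
    have hej := he1 j
    rcases F.depth_adj i j hij with hdep | hdep
    · rcases hedge i j hij hdep with ⟨heq, m, z, hm, hz1, hz2, hz⟩ | ⟨hlt, -, z, hz1, hz⟩
      · have hm0 : m ≠ 0 := by omega
        have := hz1 hm0
        have := orbitSize_pos σ i
        omega
      · omega
    · rcases hedge j i hij.symm hdep with ⟨heq, m, z, hm, hz1, hz2, hz⟩ | ⟨hlt, h0, -⟩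
      · have hm0 : m ≠ 0 := by omega
        have := hz1 hm0
        have := orbitSize_pos σ j
        omega
      · exact (hj' h0).elim
  · have hi' := (he0 i).1 hi
    have hj' := (he0 j).1 hj
    have hpi := orbitSize_cast_pos σ i
    have hpj := orbitSize_cast_pos σ j
    rcases F.depth_adj i j hij with hdep | hdep
    · rw [min_eq_left (by exact_mod_cast F.parent_le i j hij hdep), abs_eq hpi.le]
      rcases hedge i j hij hdep with ⟨heq, m, z, hm, hz1, hz2, hz⟩ | ⟨hlt, -, z, hz1, hz⟩
      · have hm0 : m = 0 := by omega
        have hz2' := hz2 hm0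
        rw [hi, hj] at hz2'
        rcases hz2' with ⟨h1, h2⟩ | ⟨h1, h2⟩
        · exact ⟨by omega, ⟨fun _ => h1, fun _ => by omega⟩⟩
        · exact ⟨by omega, ⟨fun h => by omega, fun h => (h1 h).elim⟩⟩
      · rw [(orbitSize_eq_of_lt hd hlt).1]
        rw [hi, hj] at hz1
        rcases hz1 with ⟨h1, h2⟩ | ⟨h1, h2⟩
        · exact ⟨by omega, ⟨fun _ => h1, fun _ => by omega⟩⟩
        · exact ⟨by omega, ⟨fun h => by omega, fun h => (h1 h).elim⟩⟩
    · rw [min_eq_right (by exact_mod_cast F.parent_le j i hij.symm hdep), abs_eq hpj.le,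
        hb i j hij hi hj]
      rcases hedge j i hij.symm hdep with ⟨heq, m, z, hm, hz1, hz2, hz⟩ | ⟨hlt, -, z, hz1, hz⟩
      · have hm0 : m = 0 := by omega
        have hz2' := hz2 hm0
        rw [hi, hj] at hz2'
        rcases hz2' with ⟨h1, h2⟩ | ⟨h1, h2⟩
        · exact ⟨by omega, ⟨fun h => by omega, fun h => (h h1).elim⟩⟩
        · exact ⟨by omega, ⟨fun _ => h1, fun _ => by omega⟩⟩
      · rw [(orbitSize_eq_of_lt hd hlt).1]
        rw [hi, hj] at hz1
        rcases hz1 with ⟨h1, h2⟩ | ⟨h1, h2⟩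
        · exact ⟨by omega, ⟨fun h => by omega, fun h => (h h1).elim⟩⟩
        · exact ⟨by omega, ⟨fun _ => h1, fun _ => by omega⟩⟩

end RootedFolding

end OrbitSection

end QData

namespace QData

/-! ### Coxeter sequences, Dynkin quivers, and reduction to one good height function -/

section CoxeterSequence

variable {V : Type*} [Fintype V] [DecidableEq V] {Γ : SimpleGraph V} {σ : Equiv.Perm V}
  {ξ : V → ℤ} {t : List V}

theorem perm_inv_apply_self (τ : Equiv.Perm V) (i : V) : τ⁻¹ (τ i) = i := by
  rw [Equiv.Perm.inv_eq_iff_eq]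

/-- A sequence as long as the number of orbits that meets every orbit meets each exactly once. -/
theorem IsCoxeterSequence.get_injective (ht : IsCoxeterSequence σ t) {k l : Fin t.length}
    (h : σ.SameCycle (t.get k) (t.get l)) : k = l := by
  have hsurj : Function.Surjective fun k : Fin t.length =>
      Quotient.mk (Equiv.Perm.SameCycle.setoid σ) (t.get k) := by
    intro o
    obtain ⟨i, hi, ho⟩ := ht.2 o
    obtain ⟨k, hk⟩ := List.mem_iff_get.1 hi
    exact ⟨k, by dsimp only; rw [hk, ho]⟩
  have hbij := (Nat.bijective_iff_surjective_and_card _).2 ⟨hsurj, by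
    rw [Nat.card_eq_fintype_card, Fintype.card_fin]; exact ht.1⟩
  exact hbij.1 (Quotient.sound h)

theorem IsCoxeterSequence.nodup (ht : IsCoxeterSequence σ t) : t.Nodup := by
  rw [List.nodup_iff_injective_get]
  intro k l h
  refine ht.get_injective ?_
  rw [h]

theorem IsCoxeterSequence.eq_of_sameCycle (ht : IsCoxeterSequence σ t) {i j : V} (hi : i ∈ t)
    (hj : j ∈ t) (h : σ.SameCycle i j) : i = j := by
  obtain ⟨k, rfl⟩ := List.mem_iff_get.1 hi
  obtain ⟨l, rfl⟩ := List.mem_iff_get.1 hj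
  rw [ht.get_injective h]

theorem IsCoxeterSequence.exists_mem (ht : IsCoxeterSequence σ t) (i : V) :
    ∃ j ∈ t, σ.SameCycle j i := by
  obtain ⟨j, hj, h⟩ := ht.2 (Quotient.mk _ i)
  exact ⟨j, hj, Quotient.exact h⟩

/-- The members of a Coxeter sequence as representatives of the orbits. -/
noncomputable def IsCoxeterSequence.orbitSection (ht : IsCoxeterSequence σ t) :
    OrbitSection σ where
  rep i := (ht.exists_mem i).choose
  sameCycle i := (ht.exists_mem i).choose_spec.2
  rep_eq i j h := ht.eq_of_sameCycle (ht.exists_mem i).choose_spec.1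
    (ht.exists_mem j).choose_spec.1
    (((ht.exists_mem i).choose_spec.2.trans h).trans (ht.exists_mem j).choose_spec.2.symm)

theorem IsCoxeterSequence.rep_eq_self_iff (ht : IsCoxeterSequence σ t) (i : V) :
    ht.orbitSection.rep i = i ↔ i ∈ t := by
  have h := (ht.exists_mem i).choose_spec
  constructor
  · intro hi; rw [← hi]; exact h.1
  · intro hi; exact ht.eq_of_sameCycle h.1 hi h.2

theorem isCoxeterSequence_of_nodup (hmem : ∀ i, ∃ j ∈ t, σ.SameCycle j i)
    (hinj : t.Pairwise fun i j => ¬ σ.SameCycle i j) : IsCoxeterSequence σ t := by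
  have hsurj : Function.Surjective fun k : Fin t.length =>
      Quotient.mk (Equiv.Perm.SameCycle.setoid σ) (t.get k) := by
    rintro ⟨i⟩
    obtain ⟨j, hj, h⟩ := hmem i
    obtain ⟨k, rfl⟩ := List.mem_iff_get.1 hj
    exact ⟨k, Quotient.sound h⟩
  have hinj' : Function.Injective fun k : Fin t.length =>
      Quotient.mk (Equiv.Perm.SameCycle.setoid σ) (t.get k) := by
    intro k l h
    by_contra hkl
    have h1 : σ.SameCycle (t.get k) (t.get l) := Quotient.exact h
    rcases lt_or_gt_of_ne hkl with h2 | h2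
    · exact List.pairwise_iff_get.1 hinj k l h2 h1
    · exact List.pairwise_iff_get.1 hinj l k h2 h1.symm
  refine ⟨?_, fun o => ?_⟩
  · rw [← Nat.card_congr (Equiv.ofBijective _ ⟨hinj', hsurj⟩), Nat.card_eq_fintype_card,
      Fintype.card_fin]
  · obtain ⟨i, rfl⟩ := Quotient.exists_rep o
    obtain ⟨j, hj, h⟩ := hmem i
    exact ⟨j, hj, Quotient.sound h⟩

theorem iterateSequence_zero (t : List V) : iterateSequence σ 0 t = [] := rfl

theorem iterateSequence_succ (m : ℕ) (t : List V) :
    iterateSequence σ (m + 1) t = iterateSequence σ m t ++ t.map ⇑(σ ^ m) := by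
  simp [iterateSequence, List.range_succ]

theorem heightAfter_map_pow (ξ : V → ℤ) (m : ℕ) (w : List V) (i : V) :
    heightAfter σ (fun j => ξ ((σ ^ m)⁻¹ j)) (w.map ⇑(σ ^ m)) i =
      heightAfter σ ξ w ((σ ^ m)⁻¹ i) := by
  obtain ⟨j, rfl⟩ := (σ ^ m).surjective i
  simp only [heightAfter, perm_inv_apply_self, orbitSize_pow_apply,
    List.count_map_of_injective _ _ (σ ^ m).injective]

variable (hσ : ∀ i j, Γ.Adj (σ i) (σ j) ↔ Γ.Adj i j)

include hσ in
theorem adapted_map_pow (m : ℕ) (w : List V) :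
    ∀ ξ : V → ℤ, Adapted Γ σ ξ w →
      Adapted Γ σ (fun j => ξ ((σ ^ m)⁻¹ j)) (w.map ⇑(σ ^ m)) := by
  induction w with
  | nil => intro ξ _; trivial
  | cons i w ih =>
    intro ξ h
    refine ⟨fun j hij => ?_, ?_⟩
    · obtain ⟨j, rfl⟩ := (σ ^ m).surjective j
      simp only [perm_inv_apply_self]
      exact h.1 j ((adj_pow_iff hσ m i j).1 hij)
    · have h1 := ih _ h.2
      have h2 : (fun j => reflectHeight σ ξ i ((σ ^ m)⁻¹ j)) =
          reflectHeight σ (fun j => ξ ((σ ^ m)⁻¹ j)) ((σ ^ m) i) := by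
        funext j
        obtain ⟨j, rfl⟩ := (σ ^ m).surjective j
        simp only [reflectHeight, perm_inv_apply_self, orbitSize_pow_apply,
          EmbeddingLike.apply_eq_iff_eq]
      rw [h2] at h1
      exact h1

-- After one block the heights are ξ∘σ^{-1} - 2, to which σ(t) is adapted because t is adapted to ξ.
-- So the blocks can be concatenated indefinitely.
include hσ in
theorem adapted_iterateSequence (h1 : Adapted Γ σ ξ t)
    (h2 : ∀ i, heightAfter σ ξ t i = ξ (σ⁻¹ i) - 2) (m : ℕ) :
    Adapted Γ σ ξ (iterateSequence σ m t) ∧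
      ∀ i, heightAfter σ ξ (iterateSequence σ m t) i = ξ ((σ ^ m)⁻¹ i) - 2 * m := by
  induction m with
  | zero => exact ⟨trivial, fun i => by rw [iterateSequence_zero, heightAfter_nil]; simp⟩
  | succ m ih =>
    have h3 : heightAfter σ ξ (iterateSequence σ m t) =
        fun i => ξ ((σ ^ m)⁻¹ i) + -(2 * m : ℤ) := by
      funext i; rw [ih.2]; ring
    rw [iterateSequence_succ, adapted_append, heightAfter_append, h3]
    refine ⟨⟨ih.1, ?_⟩, fun i => ?_⟩
    · rw [adapted_add_const]; exact adapted_map_pow hσ m t ξ h1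
    · rw [heightAfter_add_const (fun i => ξ ((σ ^ m)⁻¹ i))]
      dsimp only
      rw [heightAfter_map_pow, h2,
        ← Equiv.Perm.mul_apply, ← mul_inv_rev, ← pow_succ]
      push_cast; ring

variable (hd : ∀ i, orbitSize σ i = 1 ∨ orbitSize σ i = orderOf σ) (F : RootedFolding Γ σ)

include hσ hd F in
/-- Every Coxeter sequence is adapted to a height function, and so are its iterates. -/
theorem IsCoxeterSequence.exists_isCut (ht : IsCoxeterSequence σ t) :
    ∃ ξ, IsCut Γ σ ξ ∧ ∀ m, Adapted Γ σ ξ (iterateSequence σ m t) ∧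
      ∀ i, heightAfter σ ξ (iterateSequence σ m t) i = ξ ((σ ^ m)⁻¹ i) - 2 * m := by
  have hrep := ht.rep_eq_self_iff
  obtain ⟨ξ, hξ, hpow, hnr, hrr⟩ := F.exists_isCut hd hσ ht.orbitSection
    -- An earlier letter of t must lie above its later neighbours in order to be a source first.
    (fun i j => t.idxOf i < t.idxOf j) (by
      intro i j hij hi hj
      have h1 : t.idxOf i ≠ t.idxOf j := fun h =>
        hij.ne ((List.idxOf_inj ((hrep i).1 hi)).1 h)
      omega)
  refine ⟨ξ, hξ, adapted_iterateSequence hσ ?_ fun i => ?_⟩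
  · rw [adapted_iff_forall_split]
    rintro u i v rfl j hij
    have hn := ht.nodup
    rw [List.nodup_append, List.nodup_cons] at hn
    have hiu : i ∉ u := fun h => hn.2.2 i h i List.mem_cons_self rfl
    have hit : i ∈ u ++ i :: v := by simp
    have hidx : (u ++ i :: v).idxOf i = u.length := by
      rw [List.idxOf_append_of_notMem hiu, List.idxOf_cons_self, add_zero]
    rw [heightAfter_of_notMem ξ hiu]
    by_cases hjt : j ∈ u ++ i :: v
    · obtain ⟨h1, h2⟩ := hrr i j hij ((hrep i).2 hit) ((hrep j).2 hjt)
      by_cases hju : j ∈ u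
      · have h3 : ¬ ξ j < ξ i := by
          rw [h2, hidx, List.idxOf_append_of_mem hju]
          have := List.idxOf_lt_length_of_mem hju
          omega
        have h4 := orbitSize_cast_pos σ j
        have h5 := min_le_right (orbitSize σ i : ℤ) (orbitSize σ j)
        rw [← h1, abs_of_nonpos (by omega)] at h5
        simp only [heightAfter, List.count_eq_one_of_mem hn.1 hju, Nat.cast_one]
        omega
      · rw [heightAfter_of_notMem ξ hju, h2, hidx, List.idxOf_append_of_notMem hju]
        rw [List.idxOf_cons_ne _ hij.ne]
        omega
    · exact lt_of_le_of_lt (heightAfter_le ξ u j)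
        (hnr i j hij ((hrep i).2 hit) (mt (hrep j).1 hjt))
  · set r := ht.orbitSection.rep i with hr
    have hri : ht.orbitSection.rep r = r := ht.orbitSection.rep_eq _ _ (ht.orbitSection.sameCycle i)
    obtain ⟨l, hl, hli⟩ := exists_lt_orbitSize hd (ht.orbitSection.sameCycle i)
    rw [← hr] at hl hli
    have hpow' : ∀ l < orbitSize σ r, ξ ((σ ^ l) r) = ξ r - 2 * l := fun l hl => by
      have := hpow r l hl
      rwa [hri] at this
    have hpos := orbitSize_pos σ r
    rcases l with - | l
    -- A representative drops by 2d; its predecessor under σ is the last member of its orbit, which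
    -- lies 2(d - 1) below it, and the remaining 2 is the shift.
    · have hir : i = r := hli.symm
      have hmem : r ∈ t := (hrep r).1 hri
      have h1 : σ⁻¹ r = (σ ^ (orbitSize σ r - 1)) r := by
        rw [Equiv.Perm.inv_eq_iff_eq, ← Equiv.Perm.mul_apply, ← pow_succ',
          Nat.sub_add_cancel hpos, pow_orbitSize_apply hd]
      rw [hir, h1, hpow' _ (by omega)]
      simp only [heightAfter, List.count_eq_one_of_mem ht.nodup hmem]
      rw [Nat.cast_sub hpos]
      push_cast; ring
    · have h1 : σ⁻¹ i = (σ ^ l) r := by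
        rw [Equiv.Perm.inv_eq_iff_eq, ← Equiv.Perm.mul_apply, ← pow_succ', hli]
      have h2 : i ∉ t := by
        rw [← hrep, ← hr]
        intro h
        have := pow_apply_injOn (i := r) (l := l + 1) (m := 0) hl hpos (by rw [hli, pow_zero, h]; rfl)
        omega
      rw [heightAfter_of_notMem ξ h2, h1, hpow' l (by omega), ← hli, hpow' _ hl]
      push_cast; ring

theorem orbitSize_one (i : V) : orbitSize (1 : Equiv.Perm V) i = 1 := by
  have := orbitSize_le_of_pow_eq (σ := (1 : Equiv.Perm V)) (i := i) one_pos rfl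
  have := orbitSize_pos (1 : Equiv.Perm V) i
  omega

theorem isCut_one_iff {ξ : V → ℤ} :
    IsCut Γ (1 : Equiv.Perm V) ξ ↔ ∀ i j, Γ.Adj i j → |ξ i - ξ j| = 1 := by
  constructor
  · intro h i j hij
    have h1 := h.ne hij
    have h2 := h.le_bound hij
    have h3 := h.le_bound hij.symm
    simp only [orbitSize_one] at h2 h3
    rw [abs_eq one_pos.le]
    omega
  · intro h
    refine IsCut.of_bounds (fun i j _ _ => by simp [orbitSize_one]) (fun i => ?_)
      (fun i j hij => ?_) fun i j hij => ?_
    · simp [orbitSize_one]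
    · have := h i j hij
      rw [abs_eq one_pos.le] at this
      simp only [orbitSize_one, Nat.cast_one, min_self]
      omega
    · have := h i j hij
      rw [abs_eq one_pos.le] at this
      simp only [orbitSize_one, Nat.cast_one, min_self]
      omega

/-- The orientation of the diagram defined by a height function. -/
def DynkinQuiver.ofCut (hξ : IsCut Γ (1 : Equiv.Perm V) ξ) : DynkinQuiver Γ where
  arrow i j := Γ.Adj i j ∧ ξ j < ξ i
  adj_of_arrow _ _ h := h.1
  oriented i j hij := by
    have := hξ.ne hij
    simp only [hij, hij.symm, true_and]
    omega

/-- Arrows point towards smaller heights, and adjacent heights differ by 1. Lowering a source by 2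
therefore reverses exactly the arrows incident to it. -/
theorem adaptedToQuiver_iff (w : List V) :
    ∀ (ξ : V → ℤ) (a : V → V → Prop), IsCut Γ (1 : Equiv.Perm V) ξ →
      (∀ i j, a i j ↔ Γ.Adj i j ∧ ξ j < ξ i) → (AdaptedToQuiver a w ↔ Adapted Γ 1 ξ w) := by
  induction w with
  | nil => intro ξ a _ _; exact Iff.rfl
  | cons i w ih =>
    intro ξ a hξ ha
    have h1 : (∀ j, ¬ a j i) ↔ IsSource Γ ξ i := by
      refine forall_congr' fun j => ?_
      rw [ha]
      constructor
      · intro h hij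
        have h2 := hξ.ne hij
        have h3 : ¬ ξ i < ξ j := fun h' => h ⟨hij.symm, h'⟩
        omega
      · rintro h ⟨h2, h3⟩
        have := h h2.symm
        omega
    simp only [AdaptedToQuiver, Adapted, h1]
    refine and_congr_right fun hi => ih _ _ (hξ.reflectHeight hi) fun x y => ?_
    have hcut := isCut_one_iff.1 hξ
    simp only [reverseAt, ha]
    rcases eq_or_ne i x with rfl | hx
    · rw [reflectHeight_self]
      rcases eq_or_ne i y with rfl | hy
      · simp
      · rw [reflectHeight_of_ne _ hy, orbitSize_one]
        simp only [true_or, true_and, ne_eq, not_true_eq_false, false_and, or_false]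
        constructor
        · rintro ⟨h2, h3⟩
          have := hi y h2.symm
          omega
        · rintro ⟨h2, h3⟩
          have := hcut i y h2
          rw [abs_eq one_pos.le] at this
          push_cast at h3
          omega
    · rw [reflectHeight_of_ne _ hx]
      rcases eq_or_ne i y with rfl | hy
      · rw [reflectHeight_self, orbitSize_one]
        simp only [or_true, true_and, ne_eq, not_true_eq_false, false_and, and_false, or_false]
        constructor
        · rintro ⟨h2, h3⟩
          refine ⟨h2.symm, ?_⟩
          have := hcut i x h2
          rw [abs_eq one_pos.le] at this
          push_cast
          omega
        · rintro ⟨h2, h3⟩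
          exact ⟨h2.symm, hi x h2.symm⟩
      · rw [reflectHeight_of_ne _ hy]
        simp [Ne.symm hx, Ne.symm hy]

theorem adaptedClass_of_iff {ξ : V → ℤ} (hξ : IsCut Γ (1 : Equiv.Perm V) ξ) (D : DynkinQuiver Γ)
    (h : ∀ i j, D.arrow i j ↔ Γ.Adj i j ∧ ξ j < ξ i) :
    D.adaptedClass Γ = adaptedWords Γ 1 ξ := by
  ext w
  exact and_congr_right fun _ => adaptedToQuiver_iff w ξ D.arrow hξ h

/-- With every vertex as its own representative, `RootedFolding.exists_isCut` integrates any
orientation to a height function; a shift then adjusts its parity. -/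
theorem range_adaptedClass_one [Nonempty V] (F : RootedFolding Γ (1 : Equiv.Perm V)) {ε : V → ℤ}
    (hε : IsParityFunction Γ (1 : Equiv.Perm V) ε) :
    Set.range (QDatum.adaptedClass (Γ := Γ) (σ := 1) (ε := ε)) =
      {c | ∃ D : DynkinQuiver Γ, c = D.adaptedClass Γ} := by
  have hσ : ∀ i j, Γ.Adj ((1 : Equiv.Perm V) i) ((1 : Equiv.Perm V) j) ↔ Γ.Adj i j :=
    fun i j => Iff.rfl
  have hd : ∀ i, orbitSize (1 : Equiv.Perm V) i = 1 ∨
      orbitSize (1 : Equiv.Perm V) i = orderOf (1 : Equiv.Perm V) := fun i => .inl (orbitSize_one i)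
  ext c
  constructor
  · rintro ⟨Q, rfl⟩
    have hQ := Q.isCut hd hε
    exact ⟨.ofCut hQ, (adaptedClass_of_iff hQ (.ofCut hQ) fun i j => Iff.rfl).symm⟩
  · rintro ⟨D, rfl⟩
    obtain ⟨ξ, hξ, -, -, h⟩ := F.exists_isCut hd hσ
      ⟨id, fun i => .refl _ _, fun i j h => by simpa using h⟩ D.arrow
      fun i j hij _ _ => D.oriented i j hij
    obtain ⟨k, hk⟩ := F.exists_shift_parity hd hξ hε
    refine ⟨.ofCut hσ hd (hξ.add_const k) hk, ?_⟩
    have h1 := adaptedClass_of_iff hξ D fun i j => ⟨fun ha => ?_, fun ha => ?_⟩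
    · rw [h1, ← adaptedWords_add_const k]; rfl
    · exact ⟨D.adj_of_arrow i j ha, ((h i j (D.adj_of_arrow i j ha) rfl rfl).2).2 ha⟩
    · exact ((h i j ha.1 rfl rfl).2).1 ha.2

variable (Γ σ) in
/-- The classes of the Q-data and their quivers are as in the main theorem, `c` being the dual Coxeter
number. -/
def QDataClassification (ε : V → ℤ) (c : ℕ) : Prop :=
  (∀ Q : QDatum Γ σ ε,
    (∃ w, IsReducedWord Γ w (longestElement Γ) ∧ Q.adaptedClass = commClass Γ w) ∧
    ∃ φ : Q.arVertices c ≃ positiveRoots Γ,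
      ∀ w ∈ Q.adaptedClass, ∀ ψ, Q.IsARIso c w ψ ↔ ψ = φ) ∧
  ∃ P : Set (Set (List V)),
    (∀ P', IsAdaptedClusterPoint Γ σ c P' ↔ P' = P) ∧
    Set.BijOn (QDatum.classMap Γ σ ε) Set.univ P

include hσ hd F in
/-- The main theorem, for a diagram with a good height function. -/
theorem classification_of_isGood [Nonempty V] (hΓ : IsFiniteType Γ) (hL : HasLongest Γ)
    (hconn : Γ.Preconnected) {ε : V → ℤ} (hε : IsParityFunction Γ σ ε) {h : ℕ} {ξ₀ : V → ℤ}
    (hξ₀ : IsCut Γ σ ξ₀) (hg₀ : IsGood Γ σ ((orderOf σ : ℤ) * h) ξ₀)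
    (hstar : σ ≠ 1 → 2 ∣ orderOf σ * h ∧
      ∀ i, starInvolution Γ i = (σ ^ (orderOf σ * h / 2))⁻¹ i)
    (hcox : σ ≠ 1 → ∃ t, IsCoxeterSequence σ t) :
    QDataClassification Γ σ ε h := by
  obtain ⟨k₀, hk₀⟩ := F.exists_shift_parity hd hξ₀ hε
  -- Goodness passes along reflections at sources and constant shifts, and these connect ξ₀ to every
  -- ξ of the prescribed parity.
  have hgood : ∀ ξ, IsCut Γ σ ξ → (∀ i, 2 * (orbitSize σ i : ℤ) ∣ ξ i - ε i) →
      IsGood Γ σ ((orderOf σ : ℤ) * h) ξ := by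
    intro ξ hξ hp
    obtain ⟨m, u, hu1, hu2⟩ := exists_adapted_to_shift (hξ₀.add_const k₀) hξ
      (fun i => dvd_of_dvd_of_eq (dvd_sub (hk₀ i) (hp i)) (by ring))
      (r := orderOf σ) (by exact_mod_cast orderOf_pos σ) (orbitSize_dvd_orderOf hd)
    have h1 := (hg₀.add_const k₀).heightAfter hσ hΓ hL hu1
    rw [hu2] at h1
    have h2 := h1.add_const (-(2 * orderOf σ * m))
    simpa using h2
  let Q₀ : QDatum Γ σ ε := .ofCut hσ hd (hξ₀.add_const k₀) hk₀
  have hP := isRClusterPoint_range hσ hd hgood hΓ hL hε Q₀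
  have hiter : σ ≠ 1 → ∀ t, IsCoxeterSequence σ t →
      commClass Γ (iterateSequence σ (orderOf σ * h / 2) t) ∈
        Set.range (QDatum.adaptedClass (Γ := Γ) (σ := σ) (ε := ε)) := by
    intro hne t ht
    obtain ⟨h2, hst⟩ := hstar hne
    obtain ⟨ξ, hξ, hit⟩ := ht.exists_isCut hσ hd F
    obtain ⟨ha, hfin⟩ := hit (orderOf σ * h / 2)
    obtain ⟨k, hk⟩ := F.exists_shift_parity hd hξ hε
    have hg : IsGood Γ σ ((orderOf σ : ℤ) * h) ξ := by
      simpa using (hgood _ (hξ.add_const k) hk).add_const (-k)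
    obtain ⟨w, hw, hwfin⟩ := hg
    -- Both words end at the same heights, as * is the inverse of σ^{r h/2}, so each letter occurs
    -- equally often in both. This transfers reducedness from w to the iterated sequence.
    have hperm : w.Perm (iterateSequence σ (orderOf σ * h / 2) t) := by
      refine List.perm_iff_count.2 fun i => ?_
      have h3 := hwfin i
      have h4 := hfin i
      rw [← hst] at h4
      have h5 : ((2 * (orderOf σ * h / 2) : ℕ) : ℤ) = orderOf σ * h := by
        rw [Nat.mul_div_cancel' h2, Nat.cast_mul]
      push_cast at h4 h5
      rw [h5, ← h3] at h4
      simp only [heightAfter] at h4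
      have h6 := orbitSize_cast_pos σ i
      have h7 := mul_left_cancel₀ (by positivity : (2 * (orbitSize σ i : ℤ)) ≠ 0)
        (sub_right_injective h4)
      exact_mod_cast h7.symm
    have heqv := eqvGen_of_perm hw.2 ha hperm
    refine ⟨.ofCut hσ hd (hξ.add_const k) hk, ?_⟩
    have h8 : iterateSequence σ (orderOf σ * h / 2) t ∈ adaptedWords Γ σ ξ :=
      ⟨(isReducedWord_iff_of_eqvGen heqv _).1 hw.1, ha⟩
    rw [← adaptedWords_eq_commClass hΓ h8, ← adaptedWords_add_const k]
    rfl
  refine ⟨adaptedClass_and_quiver hσ hd hgood hΓ hL hε rfl, _, fun P' => ⟨fun h' => ?_, ?_⟩,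
    bijOn_classMap hd hgood hΓ hL hconn hε⟩
  · obtain ⟨h1, h2, h3⟩ := h'
    by_cases hone : σ = 1
    · subst hone
      rw [h2 rfl, range_adaptedClass_one F hε]
    · obtain ⟨t, ht⟩ := hcox hone
      -- Two r-cluster points with a common class coincide; a single Coxeter sequence supplies the
      -- common class.
      exact h1.eq_of_mem hP (h3 hone t ht) (hiter hone t ht)
  · rintro rfl
    refine ⟨hP, fun hone => ?_, hiter⟩
    subst hone
    exact range_adaptedClass_one F hε

end CoxeterSequence

end QData

namespace QData

/-! ### Certificates for reduced words of the longest element -/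

section Certificates

variable {V : Type*} [Fintype V] [DecidableEq V] {Γ : SimpleGraph V} {σ : Equiv.Perm V}

/-- The linear form on the weight lattice with the values `δ` at the fundamental weights. -/
def weightForm (δ : V → ℤ) : (V → ℤ) →ₗ[ℤ] ℤ where
  toFun l := ∑ j, δ j * l j
  map_add' x y := by simp only [Pi.add_apply, mul_add, Finset.sum_add_distrib]
  map_smul' c x := by
    simp only [Pi.smul_apply, smul_eq_mul, RingHom.id_apply, Finset.mul_sum]
    exact Finset.sum_congr rfl fun j _ => by ring

theorem weightForm_apply (δ l : V → ℤ) : weightForm δ l = ∑ j, δ j * l j := rfl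

theorem isFiniteType_of_weightForm {δ : V → ℤ} (h0 : ∀ i, 0 < δ i)
    (h1 : ∀ i, 0 < weightForm δ (simpleRoot Γ i)) : IsFiniteType Γ := by
  refine ⟨δ, h0, fun j => ?_⟩
  have := h1 j
  simp only [weightForm_apply] at this
  simpa only [simpleRoot_comm Γ _ j] using this

variable (Γ) in
/-- The linear form `E ∘ g` is positive on the roots of the word. -/
def PosAlong (E : (V → ℤ) →ₗ[ℤ] ℤ) : ((V → ℤ) ≃ₗ[ℤ] (V → ℤ)) → List V → Prop
  | _, [] => True
  | g, i :: w => 0 < E (g (simpleRoot Γ i)) ∧ PosAlong E (g * simpleReflection Γ i) w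

variable {E : (V → ℤ) →ₗ[ℤ] ℤ}

theorem posAlong_append (u v : List V) : ∀ g : (V → ℤ) ≃ₗ[ℤ] (V → ℤ),
    PosAlong Γ E g (u ++ v) ↔ PosAlong Γ E g u ∧ PosAlong Γ E (g * wordProd Γ u) v := by
  induction u with
  | nil => intro g; simp [PosAlong]
  | cons i u ih =>
    intro g
    simp only [List.cons_append, PosAlong, ih, wordProd_cons, mul_assoc, and_assoc]

/-- The root of each position has all coordinates of one sign, and one positive value of E decides
which; positivity of all these roots is reducedness. -/
theorem isReduced_of_posAlong (hΓ : IsFiniteType Γ) (hE : ∀ i, 0 < E (simpleRoot Γ i))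
    {w : List V} (h : PosAlong Γ E 1 w) : IsReduced Γ w := by
  rw [isReduced_iff_forall_split hΓ]
  rintro u i v rfl
  rw [posAlong_append, one_mul] at h
  obtain ⟨x, hx, -, hx'⟩ := isPosRoot_simpleRoot (Γ := Γ) i
  exact IsRoot.isPosRoot_of_map_pos hΓ (IsRoot.wordProd ⟨x, hx, hx'⟩ u) E hE h.2.1

theorem isPosRoot_neg_of_map_neg (hΓ : IsFiniteType Γ) (hE : ∀ i, 0 < E (simpleRoot Γ i))
    (w : List V) (i : V) (h : E (wordProd Γ w (simpleRoot Γ i)) < 0) :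
    IsPosRoot Γ (-wordProd Γ w (simpleRoot Γ i)) := by
  obtain ⟨x, hx, -, hx'⟩ := isPosRoot_simpleRoot (Γ := Γ) i
  have h1 : simpleRoot Γ i = -wordProd Γ [i] (simpleRoot Γ i) := by
    rw [wordProd_cons, wordProd_nil, mul_one, simpleReflection_simpleRoot_self, neg_neg]
  have h2 : -wordProd Γ w (simpleRoot Γ i) = wordProd Γ (w ++ [i]) (simpleRoot Γ i) := by
    rw [wordProd_append, LinearEquiv.mul_apply]
    conv_lhs => rw [h1, map_neg, neg_neg]
  refine IsRoot.isPosRoot_of_map_pos hΓ ?_ E hE (by rw [map_neg]; omega)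
  rw [h2]
  exact IsRoot.wordProd ⟨x, hx, hx'⟩ _

variable (hσ : ∀ i j, Γ.Adj (σ i) (σ j) ↔ Γ.Adj i j)

variable (Γ σ) in
/-- The twisted Coxeter element attached to `t`. -/
noncomputable def twistedProd (t : List V) : (V → ℤ) ≃ₗ[ℤ] (V → ℤ) :=
  wordProd Γ t * permWeight σ

include hσ in
theorem wordProd_map_pow (m : ℕ) (w : List V) :
    permWeight (σ ^ m) * wordProd Γ w = wordProd Γ (w.map ⇑(σ ^ m)) * permWeight (σ ^ m) :=
  (wordProd_map (adj_pow_iff hσ m) w).symm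

-- The block σ^k(t) is the conjugate of t by σ^k, so the product telescopes into a power of t σ.
-- Each root of the long word is thus a power of one element applied to a root of t.
include hσ in
theorem wordProd_iterateSequence (m : ℕ) (t : List V) :
    wordProd Γ (iterateSequence σ m t) * permWeight (σ ^ m) = twistedProd Γ σ t ^ m := by
  induction m with
  | zero => rw [iterateSequence_zero, wordProd_nil, pow_zero, pow_zero, permWeight_one, one_mul]
  | succ m ih =>
    rw [iterateSequence_succ, wordProd_append, pow_succ, permWeight_mul, pow_succ, ← ih,
      twistedProd, mul_assoc, ← mul_assoc (wordProd Γ (t.map _)), ← wordProd_map_pow hσ]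
    simp only [mul_assoc]

include hσ in
theorem posAlong_map_pow (m : ℕ) (w : List V) : ∀ g : (V → ℤ) ≃ₗ[ℤ] (V → ℤ),
    PosAlong Γ E g (w.map ⇑(σ ^ m)) ↔ PosAlong Γ E (g * permWeight (σ ^ m)) w := by
  induction w with
  | nil => intro g; exact Iff.rfl
  | cons i w ih =>
    intro g
    have h1 := wordProd_map_pow hσ m [i]
    simp only [List.map_cons, List.map_nil, wordProd_cons, wordProd_nil, mul_one] at h1
    simp only [List.map_cons, PosAlong, ih, LinearEquiv.mul_apply,
      permWeight_simpleRoot (adj_pow_iff hσ m), mul_assoc, h1]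

include hσ in
theorem posAlong_iterateSequence (m : ℕ) {t : List V}
    (h : ∀ b < m, PosAlong Γ E (twistedProd Γ σ t ^ b) t) :
    PosAlong Γ E 1 (iterateSequence σ m t) := by
  induction m with
  | zero => trivial
  | succ m ih =>
    rw [iterateSequence_succ, posAlong_append]
    refine ⟨ih fun b hb => h b (hb.trans m.lt_succ_self), ?_⟩
    rw [posAlong_map_pow hσ, one_mul, wordProd_iterateSequence hσ]
    exact h m m.lt_succ_self

/-- A word whose roots are positive for a linear form, and which maps the simple roots to negatives
of simple roots, is a reduced word for the longest element. -/
theorem isReducedWord_of_posAlong (hΓ : IsFiniteType Γ) (hE : ∀ i, 0 < E (simpleRoot Γ i))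
    {w : List V} (h : PosAlong Γ E 1 w) {s : V → V}
    (hs : ∀ i, wordProd Γ w (simpleRoot Γ i) = -simpleRoot Γ (s i)) :
    HasLongest Γ ∧ IsReducedWord Γ w (longestElement Γ) ∧ ∀ i, starInvolution Γ i = s i := by
  have hneg : ∀ i, IsPosRoot Γ (-wordProd Γ w (simpleRoot Γ i)) := by
    intro i
    rw [hs, neg_neg]
    exact isPosRoot_simpleRoot _
  have hw := wordProd_eq_longestElement hΓ hneg
  exact ⟨⟨w, hneg⟩, (isReduced_of_posAlong hΓ hE h).isReducedWord hw,
    fun i => starInvolution_eq hΓ ⟨w, hneg⟩ (by rw [← hw, hs])⟩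

include hσ in
theorem isReducedWord_iterateSequence (hΓ : IsFiniteType Γ) (hE : ∀ i, 0 < E (simpleRoot Γ i))
    {m : ℕ} {t : List V} (h : ∀ b < m, PosAlong Γ E (twistedProd Γ σ t ^ b) t)
    (hm : ∀ i, (twistedProd Γ σ t ^ m) (simpleRoot Γ i) = -simpleRoot Γ i) :
    HasLongest Γ ∧ IsReducedWord Γ (iterateSequence σ m t) (longestElement Γ) ∧
      ∀ i, starInvolution Γ i = (σ ^ m)⁻¹ i := by
  refine isReducedWord_of_posAlong hΓ hE (posAlong_iterateSequence hσ m h) fun i => ?_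
  have h1 : simpleRoot Γ i = permWeight (σ ^ m) (simpleRoot Γ ((σ ^ m)⁻¹ i)) := by
    rw [permWeight_simpleRoot (adj_pow_iff hσ m)]
    simp
  rw [h1, ← LinearEquiv.mul_apply, wordProd_iterateSequence hσ, hm]

/-! ### Orbits of automorphisms of prime order -/

theorem orbitSize_eq_of_prime {p : ℕ} (hp : p.Prime) (h : orderOf σ = p) {i : V} (hi : σ i ≠ i) :
    orbitSize σ i = p := by
  have h1 : orbitSize σ i = orderOf (σ.cycleOf i) := by
    rw [(σ.isCycle_cycleOf hi).orderOf, orbitSize, ← Set.ncard_coe_finset]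
    congr 1
    ext j
    rw [Finset.mem_coe, Equiv.Perm.mem_support_cycleOf_iff, Equiv.Perm.mem_support]
    exact (and_iff_left hi).symm
  have h2 : orderOf (σ.cycleOf i) ∣ p := h ▸ Equiv.Perm.orderOf_cycleOf_dvd_orderOf σ i
  rcases (Nat.dvd_prime hp).1 h2 with h3 | h3
  · exact (hi (apply_eq_of_orbitSize_eq_one (h1.trans h3))).elim
  · rw [h1, h3]

theorem orbitSize_eq_one_of_apply_eq {i : V} (hi : σ i = i) : orbitSize σ i = 1 := by
  have h1 := orbitSize_le_of_pow_eq (σ := σ) (i := i) one_pos (by simpa using hi)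
  have h2 := orbitSize_pos σ i
  omega

theorem orbitSize_eq_or_of_prime (h : orderOf σ = 1 ∨ (orderOf σ).Prime) (i : V) :
    orbitSize σ i = 1 ∨ orbitSize σ i = orderOf σ := by
  by_cases hi : σ i = i
  · exact .inl (orbitSize_eq_one_of_apply_eq hi)
  · rcases h with h | h
    · rw [orderOf_eq_one_iff] at h
      exact (hi (by rw [h]; rfl)).elim
    · exact .inr (orbitSize_eq_of_prime h rfl hi)

/-- A rooted folding for an automorphism of prime order, in terms of fixed vertices and powers. -/
def RootedFolding.ofPow (h : orderOf σ = 1 ∨ (orderOf σ).Prime) (depth : V → ℕ)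
    (h1 : ∀ i, depth (σ i) = depth i)
    (h2 : ∀ i j, Γ.Adj i j → depth j + 1 = depth i ∨ depth i + 1 = depth j)
    (h3 : ∀ i, depth i ≠ 0 → ∃ j, Γ.Adj i j ∧ depth j + 1 = depth i)
    (h4 : ∀ i j, depth i = 0 → depth j = 0 → i = j ∨ σ i = j ∨ σ (σ i) = j)
    (h5 : ∀ i j, Γ.Adj i j → depth j + 1 = depth i → σ j = j → σ i = i)
    (h6 : ∀ i j j', Γ.Adj i j → Γ.Adj i j' → depth j + 1 = depth i → depth j' + 1 = depth i →
      j = j' ∨ σ i = i ∧ σ j ≠ j ∧ (σ j = j' ∨ σ (σ j) = j')) : RootedFolding Γ σ where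
  depth := depth
  depth_perm := h1
  depth_adj := h2
  exists_parent := h3
  root i j hi hj := by
    rcases h4 i j hi hj with rfl | rfl | rfl
    · exact .refl _ _
    · exact sameCycle_pow 1 i
    · exact sameCycle_pow 2 i
  parent_le i j hij hd := by
    by_cases hi : σ i = i
    · rw [orbitSize_eq_one_of_apply_eq hi]
      exact orbitSize_pos σ j
    · have hj : σ j ≠ j := fun hj => hi (h5 i j hij hd hj)
      rcases h with h | h
      · rw [orderOf_eq_one_iff] at h
        exact (hi (by rw [h]; rfl)).elim
      · rw [orbitSize_eq_of_prime h rfl hi, orbitSize_eq_of_prime h rfl hj]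
  parent_sameCycle i j j' hij hij' hd hd' := by
    rcases h6 i j j' hij hij' hd hd' with rfl | ⟨-, -, rfl | rfl⟩
    · exact .refl _ _
    · exact sameCycle_pow 1 j
    · exact sameCycle_pow 2 j
  parent_unique i j j' hij hij' hd hd' hs := by
    rcases h6 i j j' hij hij' hd hd' with h7 | ⟨hi, hj, -⟩
    · exact h7
    · rw [orbitSize_eq_one_of_apply_eq hi] at hs
      exact (hj (apply_eq_of_orbitSize_eq_one hs.symm)).elim

/-- A diagram which has a rooted folding for the identity is connected. -/
theorem RootedFolding.preconnected (F : RootedFolding Γ (1 : Equiv.Perm V)) : Γ.Preconnected := by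
  have key : ∀ n i, F.depth i = n → ∃ r, F.depth r = 0 ∧ Γ.Reachable i r := by
    intro n
    induction n with
    | zero => exact fun i hi => ⟨i, hi, .refl _⟩
    | succ n ih =>
      intro i hi
      obtain ⟨j, hij, hj⟩ := F.exists_parent i (by omega)
      obtain ⟨r, hr, hjr⟩ := ih j (by omega)
      exact ⟨r, hr, hij.reachable.trans hjr⟩
  intro i j
  obtain ⟨r, hr, hir⟩ := key _ i rfl
  obtain ⟨r', hr', hjr⟩ := key _ j rfl
  have hrr : r = r' := by simpa using F.root r r' hr hr'
  subst hrr
  exact hir.trans hjr.symm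

variable {ε : V → ℤ}

include hσ in
/-- The main theorem, when the iterates of some Coxeter sequence are a reduced word. -/
theorem classification_of_iterateSequence [Nonempty V] (hΓ : IsFiniteType Γ) (hL : HasLongest Γ)
    (h : orderOf σ = 1 ∨ (orderOf σ).Prime)
    (F : RootedFolding Γ σ) (hconn : Γ.Preconnected) (hε : IsParityFunction Γ σ ε) {c m : ℕ}
    (hm : orderOf σ * c = 2 * m) {t : List V} (ht : IsCoxeterSequence σ t)
    (hw : IsReducedWord Γ (iterateSequence σ m t) (longestElement Γ))
    (hstar : ∀ i, starInvolution Γ i = (σ ^ m)⁻¹ i) :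
    QDataClassification Γ σ ε c := by
  have hd := orbitSize_eq_or_of_prime h
  obtain ⟨ξ, hξ, hit⟩ := ht.exists_isCut hσ hd F
  have hm2 : orderOf σ * c / 2 = m := by omega
  refine classification_of_isGood hσ hd F hΓ hL hconn hε hξ
    ⟨_, ⟨hw, (hit m).1⟩, fun i => ?_⟩ (fun _ => ⟨⟨m, hm⟩, ?_⟩) fun _ => ⟨t, ht⟩
  · rw [(hit m).2, hstar]
    have : ((orderOf σ * c : ℕ) : ℤ) = 2 * m := by rw [hm]; push_cast; rfl
    push_cast at this
    rw [this]
  · rwa [hm2]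

/-- Each letter occurs once, so when i is reached its earlier neighbours have dropped once, and the
remaining ones not at all. -/
theorem adapted_of_pairwise {ξ : V → ℤ} {t : List V} (hn : t.Nodup)
    (h1 : t.Pairwise fun i j => Γ.Adj i j → ξ j < ξ i ∧ ξ i - 2 * orbitSize σ i < ξ j)
    (h2 : ∀ i ∈ t, ∀ j ∉ t, Γ.Adj i j → ξ j < ξ i) : Adapted Γ σ ξ t := by
  rw [adapted_iff_forall_split]
  rintro u i v rfl j hij
  rw [List.nodup_append] at hn
  rw [List.pairwise_append, List.pairwise_cons] at h1
  have hiu : i ∉ u := fun h => hn.2.2 i h i List.mem_cons_self rfl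
  rw [heightAfter_of_notMem ξ hiu]
  by_cases hju : j ∈ u
  · have h3 := (h1.2.2 j hju i List.mem_cons_self hij.symm).2
    simp only [heightAfter, List.count_eq_one_of_mem hn.1 hju, Nat.cast_one]
    omega
  · rw [heightAfter_of_notMem ξ hju]
    by_cases hjv : j ∈ v
    · exact (h1.2.1.1 j hjv hij).1
    · exact h2 i (by simp) j (by simp [hju, hjv, hij.ne']) hij

/-- The main theorem for the identity, when the iterates of some Coxeter sequence are a reduced word
and the sequence is adapted to a symmetric height function. -/
theorem classification_of_height [Nonempty V] (hΓ : IsFiniteType Γ) (hL : HasLongest Γ)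
    (F : RootedFolding Γ (1 : Equiv.Perm V)) (hε : IsParityFunction Γ (1 : Equiv.Perm V) ε) {m : ℕ}
    {ξ : V → ℤ} (hξ : ∀ i j, Γ.Adj i j → |ξ i - ξ j| = 1) {t : List V} (hn : t.Nodup)
    (hmem : ∀ i, i ∈ t) (hord : t.Pairwise fun i j => Γ.Adj i j → ξ j < ξ i)
    (hw : IsReducedWord Γ (iterateSequence 1 m t) (longestElement Γ))
    (hstar : ∀ i, ξ (starInvolution Γ i) = ξ i) :
    QDataClassification Γ (1 : Equiv.Perm V) ε (2 * m) := by
  have hσ : ∀ i j, Γ.Adj ((1 : Equiv.Perm V) i) ((1 : Equiv.Perm V) j) ↔ Γ.Adj i j :=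
    fun i j => Iff.rfl
  have h1 : Adapted Γ 1 ξ t := by
    refine adapted_of_pairwise hn (hord.imp fun h hij => ⟨h hij, ?_⟩) fun i _ j hj =>
      (hj (hmem j)).elim
    have h2 := h hij
    have h3 := hξ _ _ hij
    rw [abs_eq one_pos.le] at h3
    rw [orbitSize_one]
    push_cast
    omega
  have hit := adapted_iterateSequence hσ h1 (fun i => by
    simp only [heightAfter, orbitSize_one, List.count_eq_one_of_mem hn (hmem i)]
    rw [inv_one]
    simp) m
  refine classification_of_isGood hσ (fun i => .inl (orbitSize_one i)) F hΓ hL F.preconnected hε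
    (isCut_one_iff.2 hξ) ⟨_, ⟨hw, hit.1⟩, fun i => ?_⟩ (fun h => (h rfl).elim)
    fun h => (h rfl).elim
  rw [hit.2, hstar, one_pow, inv_one, orderOf_one]
  simp

end Certificates

end QData

namespace QData

/-! ### Evaluation of certificates on lists of integers -/

section Computation

variable {N : ℕ} {Γ : SimpleGraph (Fin N)} {σ : Equiv.Perm (Fin N)} (a : Fin N → Fin N → Bool)

/-- The values of a linear form at the images of the simple roots, after a simple reflection. -/
def stepValues (i : Fin N) (l : List ℤ) : List ℤ :=
  (List.finRange N).map fun j =>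
    if j = i then -(l.getD i 0) else if a i j then l.getD j 0 + l.getD i 0 else l.getD j 0

/-- The values of a linear form at the images of the simple roots under a word, provided that the
form is positive on the roots of the word. -/
def runValues : List (Fin N) → List ℤ → Option (List ℤ)
  | [], l => some l
  | i :: w, l => if 0 < l.getD i 0 then runValues w (stepValues a i l) else none

theorem getD_map_finRange (f : Fin N → ℤ) (i : Fin N) :
    ((List.finRange N).map f).getD i 0 = f i := by
  simp [List.getD_eq_getElem?_getD]

variable {a} (ha : ∀ i j, Γ.Adj i j ↔ a i j = true)

include ha in
theorem stepValues_map (E : (Fin N → ℤ) →ₗ[ℤ] ℤ) (g : (Fin N → ℤ) ≃ₗ[ℤ] (Fin N → ℤ)) (i : Fin N) :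
    stepValues a i ((List.finRange N).map fun j => E (g (simpleRoot Γ j))) =
      (List.finRange N).map fun j => E ((g * simpleReflection Γ i) (simpleRoot Γ j)) := by
  simp only [stepValues, getD_map_finRange]
  refine List.map_congr_left fun j _ => ?_
  rw [LinearEquiv.mul_apply]
  rcases eq_or_ne j i with rfl | hji
  · rw [if_pos rfl, simpleReflection_simpleRoot_self, map_neg, map_neg]
  · rw [if_neg hji, simpleReflection_apply, map_sub, map_sub, map_smul, map_smul]
    by_cases h : Γ.Adj i j
    · rw [if_pos ((ha i j).1 h), simpleRoot_of_adj h.symm]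
      simp only [smul_eq_mul]; ring
    · rw [if_neg (mt (ha i j).2 h), simpleRoot_of_not_adj hji (fun h' => h h'.symm)]
      simp

include ha in
theorem posAlong_of_runValues (E : (Fin N → ℤ) →ₗ[ℤ] ℤ) {l : List ℤ} (w : List (Fin N)) :
    ∀ g : (Fin N → ℤ) ≃ₗ[ℤ] (Fin N → ℤ),
      runValues a w ((List.finRange N).map fun j => E (g (simpleRoot Γ j))) = some l →
      PosAlong Γ E g w ∧
        l = (List.finRange N).map fun j => E ((g * wordProd Γ w) (simpleRoot Γ j)) := by
  induction w with
  | nil =>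
    intro g h
    refine ⟨trivial, ?_⟩
    rw [wordProd_nil, mul_one]
    exact (Option.some.inj h).symm
  | cons i w ih =>
    intro g h
    simp only [runValues, getD_map_finRange, stepValues_map ha] at h
    split_ifs at h with hpos
    obtain ⟨h1, h2⟩ := ih _ h
    exact ⟨⟨hpos, h1⟩, by rw [wordProd_cons, ← mul_assoc]; exact h2⟩

variable (a) in
/-- The value at the simple root `i` of the linear form with values `δ` at the fundamental
weights. -/
def rootValue (δ : Fin N → ℤ) (i : Fin N) : ℤ :=
  ∑ j, δ j * if j = i then 2 else if a i j then -1 else 0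

include ha in
theorem weightForm_simpleRoot (δ : Fin N → ℤ) (i : Fin N) :
    weightForm δ (simpleRoot Γ i) = rootValue a δ i := by
  rw [weightForm_apply, rootValue]
  refine Finset.sum_congr rfl fun j _ => ?_
  simp only [simpleRoot, ha]

include ha in
/-- A reduced word for the longest element, found by computation. -/
theorem isReducedWord_of_runValues {δ : Fin N → ℤ} (h0 : ∀ i, 0 < δ i)
    (h1 : ∀ i, 0 < rootValue a δ i) (h2 : ∀ i j, rootValue a δ i = rootValue a δ j → i = j)
    {w : List (Fin N)} {s : Fin N → Fin N}
    (hw : runValues a w ((List.finRange N).map (rootValue a δ)) =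
      some ((List.finRange N).map fun j => -rootValue a δ (s j))) :
    IsFiniteType Γ ∧ HasLongest Γ ∧ IsReducedWord Γ w (longestElement Γ) ∧
      ∀ i, starInvolution Γ i = s i := by
  have hE := weightForm_simpleRoot ha δ
  have hΓ : IsFiniteType Γ := isFiniteType_of_weightForm h0 fun i => by rw [hE]; exact h1 i
  have hpos : ∀ i, 0 < weightForm δ (simpleRoot Γ i) := fun i => by rw [hE]; exact h1 i
  obtain ⟨h3, h4⟩ := posAlong_of_runValues ha (weightForm δ) w 1 (by simpa [hE] using hw)
  have h5 : ∀ j, weightForm δ (wordProd Γ w (simpleRoot Γ j)) = -rootValue a δ (s j) := by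
    intro j
    have h6 := congrArg (fun l => l.getD j 0) h4
    simp only [getD_map_finRange, one_mul] at h6
    exact h6.symm
  have hneg : ∀ i, IsPosRoot Γ (-wordProd Γ w (simpleRoot Γ i)) := fun i =>
    isPosRoot_neg_of_map_neg hΓ hpos w i (by rw [h5]; have := h1 (s i); omega)
  have hprod := wordProd_eq_longestElement hΓ hneg
  have hL : HasLongest Γ := ⟨w, hneg⟩
  -- The form takes distinct values on the simple roots, so its value at -w_0 α_i identifies i*.
  refine ⟨hΓ, hL, (isReduced_of_posAlong hΓ hpos h3).isReducedWord hprod, fun i => h2 _ _ ?_⟩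
  have h7 := h5 i
  rw [hprod, longestElement_simpleRoot hΓ hL, map_neg, hE] at h7
  omega

/-- The concatenation of the images of `t` under the iterates of `s`. -/
def iterateWord (s : Fin N → Fin N) (m : ℕ) (t : List (Fin N)) : List (Fin N) :=
  (List.range m).flatMap fun k => t.map s^[k]

theorem iterateSequence_eq_iterateWord {s : Fin N → Fin N} (hs : ∀ i, σ i = s i) (m : ℕ)
    (t : List (Fin N)) : iterateSequence σ m t = iterateWord s m t := by
  obtain rfl : ⇑σ = s := funext hs
  simp only [iterateSequence, iterateWord, Equiv.Perm.iterate_eq_pow]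

theorem sameCycle_iff_of_orderOf_le (h : orderOf σ ≤ 3) {i j : Fin N} :
    σ.SameCycle i j ↔ i = j ∨ σ i = j ∨ σ (σ i) = j := by
  constructor
  · intro hij
    obtain ⟨l, hl, rfl⟩ := exists_lt_orderOf_of_sameCycle hij
    have : l < 3 := by omega
    interval_cases l
    · exact .inl rfl
    · exact .inr (.inl rfl)
    · exact .inr (.inr rfl)
  · rintro (rfl | rfl | rfl)
    · exact .refl _ _
    · exact sameCycle_pow 1 i
    · exact sameCycle_pow 2 i

theorem orderOf_cases {p : ℕ} (hp : p.Prime) (h : ∀ i, (σ ^ p) i = i) (hne : ∃ i, σ i ≠ i) :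
    orderOf σ = p := by
  have := Fact.mk hp
  refine orderOf_eq_prime (Equiv.ext h) fun h1 => ?_
  obtain ⟨i, hi⟩ := hne
  exact hi (by rw [h1]; rfl)

variable (a) in
/-- The combinatorial conditions on the depth function of a rooted folding by `s`. -/
def IsDepth (s : Fin N → Fin N) (depth : Fin N → ℕ) : Prop :=
  (∀ i, depth (s i) = depth i) ∧
  (∀ i j, a i j = true → depth j + 1 = depth i ∨ depth i + 1 = depth j) ∧
  (∀ i, depth i ≠ 0 → ∃ j, a i j = true ∧ depth j + 1 = depth i) ∧
  (∀ i j, depth i = 0 → depth j = 0 → i = j ∨ s i = j ∨ s (s i) = j) ∧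
  (∀ i j, a i j = true → depth j + 1 = depth i → s j = j → s i = i) ∧
  ∀ i j j', a i j = true → a i j' = true → depth j + 1 = depth i → depth j' + 1 = depth i →
      j = j' ∨ s i = i ∧ s j ≠ j ∧ (s j = j' ∨ s (s j) = j')

set_option synthInstance.maxHeartbeats 200000 in
set_option synthInstance.maxSize 1000 in
instance (s : Fin N → Fin N) (depth : Fin N → ℕ) : Decidable (IsDepth a s depth) := by
  unfold IsDepth; infer_instance

include ha in
theorem IsDepth.nonempty_rootedFolding {s : Fin N → Fin N} {depth : Fin N → ℕ}
    (h : IsDepth a s depth) (hs : ∀ i, σ i = s i) (hp : orderOf σ = 1 ∨ (orderOf σ).Prime) :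
    Nonempty (RootedFolding Γ σ) := by
  obtain rfl : ⇑σ = s := funext hs
  obtain ⟨h1, h2, h3, h4, h5, h6⟩ := h
  simp only [← ha] at h2 h3 h5 h6
  exact ⟨.ofPow hp depth h1 h2 h3 h4 h5 h6⟩

variable {ε : Fin N → ℤ}

include ha in
/-- The main theorem, when the iterates of some Coxeter sequence are found by computation to be a
reduced word. -/
theorem classification_of_runValues [NeZero N] {s : Fin N → Fin N} (hs : ∀ i, σ i = s i)
    (hσ : ∀ i j, Γ.Adj (σ i) (σ j) ↔ Γ.Adj i j) {p : ℕ} (hp : p = 1 ∨ p.Prime) (hp3 : p ≤ 3)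
    (horder : orderOf σ = p)
    (hε : IsParityFunction Γ σ ε) {δ : Fin N → ℤ} (h0 : ∀ i, 0 < δ i)
    (h1 : ∀ i, 0 < rootValue a δ i) (h2 : ∀ i j, rootValue a δ i = rootValue a δ j → i = j)
    {depth depth' : Fin N → ℕ} (hdepth : IsDepth a s depth) (hdepth' : IsDepth a id depth')
    {c m : ℕ} (hm : p * c = 2 * m) {t : List (Fin N)}
    (ht : ∀ i, ∃ j ∈ t, j = i ∨ s j = i ∨ s (s j) = i)
    (ht' : t.Pairwise fun i j => ¬ (i = j ∨ s i = j ∨ s (s i) = j)) {s' : Fin N → Fin N}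
    (hs' : ∀ i, s^[m] (s' i) = i)
    (hw : runValues a (iterateWord s m t) ((List.finRange N).map (rootValue a δ)) =
      some ((List.finRange N).map fun j => -rootValue a δ (s' j))) :
    QDataClassification Γ σ ε c := by
  subst horder
  obtain ⟨hΓ, hL, hred, hstar⟩ := isReducedWord_of_runValues ha h0 h1 h2 hw
  obtain ⟨F⟩ := hdepth.nonempty_rootedFolding ha hs hp
  obtain ⟨F'⟩ := hdepth'.nonempty_rootedFolding ha (σ := 1) (fun i => rfl) (.inl orderOf_one)
  rw [← iterateSequence_eq_iterateWord hs] at hred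
  refine classification_of_iterateSequence hσ hΓ hL hp F F'.preconnected hε hm
    (isCoxeterSequence_of_nodup (fun i => ?_) (ht'.imp fun h => ?_)) hred fun i => ?_
  · obtain ⟨j, hj, h⟩ := ht i
    rw [← hs, ← hs] at h
    exact ⟨j, hj, (sameCycle_iff_of_orderOf_le hp3).2 h⟩
  · rw [sameCycle_iff_of_orderOf_le hp3, hs, hs]
    exact h
  · rw [hstar, ← hs' i, ← funext hs, Equiv.Perm.iterate_eq_pow, perm_inv_apply_self,
      ← Equiv.Perm.iterate_eq_pow, funext hs, hs']

end Computation

end QData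

/-! ### The exceptional diagrams and the foldings of D_4 -/

namespace QData

/-- Adjacency of vertices in terms of a Cartan matrix. -/
def cartanAdj {N : ℕ} (A : Matrix (Fin N) (Fin N) ℤ) (i j : Fin N) : Bool :=
  decide (i ≠ j ∧ (A i j ≠ 0 ∨ A j i ≠ 0))

theorem diagram_adj_iff (X : ADEType) (i j : Fin X.rank) :
    X.diagram.Adj i j ↔ cartanAdj X.cartan i j = true := by
  rw [cartanAdj, decide_eq_true_iff]
  exact Iff.rfl

theorem cartanAdj_map {X : ADEType} {σ : Equiv.Perm (Fin X.rank)}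
    (hσ : ∀ i j, X.diagram.Adj (σ i) (σ j) ↔ X.diagram.Adj i j) (i j : Fin X.rank)
    (h : cartanAdj X.cartan i j = true) : cartanAdj X.cartan (σ i) (σ j) = true := by
  rw [← diagram_adj_iff] at h ⊢
  exact (hσ i j).2 h

-- The quantifiers follow the edges outwards from the branch vertex, so the exhaustive search is
-- pruned after each choice.
set_option synthInstance.maxHeartbeats 200000 in
set_option synthInstance.maxSize 1000 in
theorem eq_id_of_adj_E₈ : ∀ x3 x1 : Fin 8, cartanAdj CartanMatrix.E₈ x3 x1 = true →
    ∀ x2, cartanAdj CartanMatrix.E₈ x3 x2 = true → x2 ≠ x1 →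
    ∀ x4, cartanAdj CartanMatrix.E₈ x3 x4 = true → x4 ≠ x1 → x4 ≠ x2 →
    ∀ x0, cartanAdj CartanMatrix.E₈ x2 x0 = true → x0 ≠ x3 →
    ∀ x5, cartanAdj CartanMatrix.E₈ x4 x5 = true → x5 ≠ x3 →
    ∀ x6, cartanAdj CartanMatrix.E₈ x5 x6 = true → x6 ≠ x4 →
    ∀ x7, cartanAdj CartanMatrix.E₈ x6 x7 = true → x7 ≠ x5 →
    x0 = 0 ∧ x1 = 1 ∧ x2 = 2 ∧ x3 = 3 ∧ x4 = 4 ∧ x5 = 5 ∧ x6 = 6 ∧ x7 = 7 := by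
  decide +kernel

theorem qDataClassification_E₈ {σ : Equiv.Perm (Fin 8)}
    (hσ : ∀ i j, ADEType.E₈.diagram.Adj (σ i) (σ j) ↔ ADEType.E₈.diagram.Adj i j)
    {ε : Fin 8 → ℤ} (hε : IsParityFunction ADEType.E₈.diagram σ ε) :
    QDataClassification ADEType.E₈.diagram σ ε (ADEType.E₈.dualCoxeter (orderOf σ)) := by
  have hadj := cartanAdj_map (X := .E₈) hσ
  have hne : ∀ i j, i ≠ j → σ i ≠ σ j := fun i j h => σ.injective.ne h
  obtain ⟨h0, h1, h2, h3, h4, h5, h6, h7⟩ := eq_id_of_adj_E₈ (σ 3)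
    (σ 1) (hadj _ _ (by decide)) (σ 2) (hadj _ _ (by decide)) (hne _ _ (by decide))
    (σ 4) (hadj _ _ (by decide)) (hne _ _ (by decide)) (hne _ _ (by decide))
    (σ 0) (hadj _ _ (by decide)) (hne _ _ (by decide))
    (σ 5) (hadj _ _ (by decide)) (hne _ _ (by decide))
    (σ 6) (hadj _ _ (by decide)) (hne _ _ (by decide))
    (σ 7) (hadj _ _ (by decide)) (hne _ _ (by decide))
  have hid : ∀ i, σ i = id i := by
    intro i
    fin_cases i <;> assumption
  obtain rfl : σ = 1 := Equiv.ext hid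
  exact classification_of_runValues (diagram_adj_iff .E₈) hid hσ (.inl rfl) (by norm_num)
    orderOf_one hε
    -- The form takes the values 1, …, 8 on the simple roots, hence is positive and separates them.
    (δ := ![195, 291, 389, 580, 476, 367, 252, 130]) (by decide) (by decide +kernel)
    (by decide +kernel) (depth := ![0, 3, 1, 2, 3, 4, 5, 6]) (depth' := ![0, 3, 1, 2, 3, 4, 5, 6])
    (by decide +kernel) (by decide +kernel) (c := 30) (m := 15) rfl
    (t := [0, 1, 2, 3, 4, 5, 6, 7]) (by decide +kernel) (by decide +kernel) (s' := id)
    (by decide +kernel) (by decide +kernel)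

set_option synthInstance.maxHeartbeats 200000 in
set_option synthInstance.maxSize 1000 in
theorem eq_id_of_adj_E₇ : ∀ x3 x1 : Fin 7, cartanAdj CartanMatrix.E₇ x3 x1 = true →
    ∀ x2, cartanAdj CartanMatrix.E₇ x3 x2 = true → x2 ≠ x1 →
    ∀ x4, cartanAdj CartanMatrix.E₇ x3 x4 = true → x4 ≠ x1 → x4 ≠ x2 →
    ∀ x0, cartanAdj CartanMatrix.E₇ x2 x0 = true → x0 ≠ x3 →
    ∀ x5, cartanAdj CartanMatrix.E₇ x4 x5 = true → x5 ≠ x3 →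
    ∀ x6, cartanAdj CartanMatrix.E₇ x5 x6 = true → x6 ≠ x4 →
    x0 = 0 ∧ x1 = 1 ∧ x2 = 2 ∧ x3 = 3 ∧ x4 = 4 ∧ x5 = 5 ∧ x6 = 6 := by
  decide +kernel

theorem qDataClassification_E₇ {σ : Equiv.Perm (Fin 7)}
    (hσ : ∀ i j, ADEType.E₇.diagram.Adj (σ i) (σ j) ↔ ADEType.E₇.diagram.Adj i j)
    {ε : Fin 7 → ℤ} (hε : IsParityFunction ADEType.E₇.diagram σ ε) :
    QDataClassification ADEType.E₇.diagram σ ε (ADEType.E₇.dualCoxeter (orderOf σ)) := by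
  have hadj := cartanAdj_map (X := .E₇) hσ
  have hne : ∀ i j, i ≠ j → σ i ≠ σ j := fun i j h => σ.injective.ne h
  obtain ⟨h0, h1, h2, h3, h4, h5, h6⟩ := eq_id_of_adj_E₇ (σ 3)
    (σ 1) (hadj _ _ (by decide)) (σ 2) (hadj _ _ (by decide)) (hne _ _ (by decide))
    (σ 4) (hadj _ _ (by decide)) (hne _ _ (by decide)) (hne _ _ (by decide))
    (σ 0) (hadj _ _ (by decide)) (hne _ _ (by decide))
    (σ 5) (hadj _ _ (by decide)) (hne _ _ (by decide))
    (σ 6) (hadj _ _ (by decide)) (hne _ _ (by decide))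
  have hid : ∀ i, σ i = id i := by
    intro i
    fin_cases i <;> assumption
  obtain rfl : σ = 1 := Equiv.ext hid
  exact classification_of_runValues (diagram_adj_iff .E₇) hid hσ (.inl rfl) (by norm_num)
    orderOf_one hε
    -- The values on the simple roots are 2, 4, …, 14; the factor 2, the determinant of the Cartan
    -- matrix, makes δ integral.
    (δ := ![130, 192, 258, 380, 302, 214, 114]) (by decide) (by decide +kernel)
    (by decide +kernel) (depth := ![0, 3, 1, 2, 3, 4, 5]) (depth' := ![0, 3, 1, 2, 3, 4, 5])
    (by decide +kernel) (by decide +kernel) (c := 18) (m := 9) rfl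
    (t := [0, 1, 2, 3, 4, 5, 6]) (by decide +kernel) (by decide +kernel) (s' := id)
    (by decide +kernel) (by decide +kernel)

set_option synthInstance.maxHeartbeats 200000 in
set_option synthInstance.maxSize 1000 in
theorem eq_or_eq_of_adj_E₆ : ∀ x3 x1 : Fin 6, cartanAdj CartanMatrix.E₆ x3 x1 = true →
    ∀ x2, cartanAdj CartanMatrix.E₆ x3 x2 = true → x2 ≠ x1 →
    ∀ x4, cartanAdj CartanMatrix.E₆ x3 x4 = true → x4 ≠ x1 → x4 ≠ x2 →
    ∀ x0, cartanAdj CartanMatrix.E₆ x2 x0 = true → x0 ≠ x3 →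
    ∀ x5, cartanAdj CartanMatrix.E₆ x4 x5 = true → x5 ≠ x3 →
    (x0 = 0 ∧ x1 = 1 ∧ x2 = 2 ∧ x3 = 3 ∧ x4 = 4 ∧ x5 = 5) ∨
      (x0 = 5 ∧ x1 = 1 ∧ x2 = 4 ∧ x3 = 3 ∧ x4 = 2 ∧ x5 = 0) := by
  decide +kernel

/-- Here * is not the identity, so the criterion requiring * to be a power of σ fails. Instead t is
ordered by distance from the branch vertex, and its height function, minus that distance, is
invariant under *. -/
theorem qDataClassification_E₆_one {ε : Fin 6 → ℤ}
    (hε : IsParityFunction ADEType.E₆.diagram 1 ε) :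
    QDataClassification ADEType.E₆.diagram 1 ε 12 := by
  have ha := diagram_adj_iff .E₆
  obtain ⟨hΓ, hL, hred, hstar⟩ := isReducedWord_of_runValues ha
    -- The values on the simple roots are 3, 6, …, 18.
    (δ := ![81, 117, 159, 228, 168, 93]) (by decide) (by decide +kernel) (by decide +kernel)
    (w := iterateWord id 6 [3, 1, 2, 4, 0, 5]) (s := ![5, 1, 4, 3, 2, 0]) (by decide +kernel)
  have hdepth : IsDepth (cartanAdj CartanMatrix.E₆) id ![0, 3, 1, 2, 3, 4] := by decide +kernel
  obtain ⟨F⟩ := hdepth.nonempty_rootedFolding ha (σ := 1) (fun i => rfl) (.inl orderOf_one)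
  rw [← iterateSequence_eq_iterateWord (σ := 1) (s := id) fun i => rfl] at hred
  refine classification_of_height hΓ hL F hε (m := 6) (ξ := ![-2, -1, -1, 0, -1, -2])
    (t := [3, 1, 2, 4, 0, 5]) (fun i j hij => ?_) (by decide) (by decide) ?_ hred fun i => ?_
  · revert i j
    simp only [ha]
    decide +kernel
  · simp only [ha]
    decide +kernel
  · rw [hstar]
    revert i
    decide

theorem qDataClassification_E₆ {σ : Equiv.Perm (Fin 6)}
    (hσ : ∀ i j, ADEType.E₆.diagram.Adj (σ i) (σ j) ↔ ADEType.E₆.diagram.Adj i j)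
    {ε : Fin 6 → ℤ} (hε : IsParityFunction ADEType.E₆.diagram σ ε) :
    QDataClassification ADEType.E₆.diagram σ ε (ADEType.E₆.dualCoxeter (orderOf σ)) := by
  have hadj := cartanAdj_map (X := .E₆) hσ
  have hne : ∀ i j, i ≠ j → σ i ≠ σ j := fun i j h => σ.injective.ne h
  rcases eq_or_eq_of_adj_E₆ (σ 3)
    (σ 1) (hadj _ _ (by decide)) (σ 2) (hadj _ _ (by decide)) (hne _ _ (by decide))
    (σ 4) (hadj _ _ (by decide)) (hne _ _ (by decide)) (hne _ _ (by decide))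
    (σ 0) (hadj _ _ (by decide)) (hne _ _ (by decide))
    (σ 5) (hadj _ _ (by decide)) (hne _ _ (by decide))
    with ⟨h0, h1, h2, h3, h4, h5⟩ | ⟨h0, h1, h2, h3, h4, h5⟩
  · obtain rfl : σ = 1 := Equiv.ext fun i => by fin_cases i <;> assumption
    rw [orderOf_one]
    exact qDataClassification_E₆_one hε
  · have hs : ∀ i, σ i = ![5, 1, 4, 3, 2, 0] i := by
      intro i
      fin_cases i <;> assumption
    have hord : orderOf σ = 2 := orderOf_cases Nat.prime_two
      (fun i => by rw [pow_two, Equiv.Perm.mul_apply, hs, hs]; revert i; decide)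
      ⟨0, by rw [h0]; decide⟩
    rw [hord]
    exact classification_of_runValues (diagram_adj_iff .E₆) hs hσ (.inr Nat.prime_two)
      (by norm_num) hord hε
      (δ := ![81, 117, 159, 228, 168, 93]) (by decide) (by decide +kernel)
      -- The root is the orbit {0, 5} of the two ends: orbits may not grow away from the root, so
      -- the fixed vertices must come last.
      (by decide +kernel) (depth := ![0, 3, 1, 2, 1, 0]) (depth' := ![0, 3, 1, 2, 3, 4])
      (by decide +kernel) (by decide +kernel) (c := 9) (m := 9) rfl
      (t := [0, 2, 3, 1]) (by decide +kernel) (by decide +kernel) (s' := ![5, 1, 4, 3, 2, 0])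
      (by decide +kernel) (by decide +kernel)

/-- The four vertex diagram of type `D`. -/
abbrev D₄ : ADEType := .D 4 le_rfl

set_option synthInstance.maxHeartbeats 200000 in
set_option synthInstance.maxSize 1000 in
theorem eq_of_adj_D₄ : ∀ x1 x0 : Fin 4, cartanAdj (CartanMatrix.D 4) x1 x0 = true →
    ∀ x2, cartanAdj (CartanMatrix.D 4) x1 x2 = true → x2 ≠ x0 →
    ∀ x3, cartanAdj (CartanMatrix.D 4) x1 x3 = true → x3 ≠ x0 → x3 ≠ x2 →
    x1 = 1 ∧ ((x0 = 0 ∧ x2 = 2 ∧ x3 = 3) ∨ (x0 = 0 ∧ x2 = 3 ∧ x3 = 2) ∨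
      (x0 = 2 ∧ x2 = 0 ∧ x3 = 3) ∨ (x0 = 3 ∧ x2 = 2 ∧ x3 = 0) ∨
      (x0 = 2 ∧ x2 = 3 ∧ x3 = 0) ∨ (x0 = 3 ∧ x2 = 0 ∧ x3 = 2)) := by
  decide +kernel

/-- These are the nontrivial automorphisms other than the exchange of vertices 2 and 3. The form
takes the values 4, 8, 12, 16 on the simple roots, and m = r h^∨/2 is 4 or 6. -/
theorem qDataClassification_D₄_of_eq {σ : Equiv.Perm (Fin 4)}
    (hσ : ∀ i j, D₄.diagram.Adj (σ i) (σ j) ↔ D₄.diagram.Adj i j)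
    {ε : Fin 4 → ℤ} (hε : IsParityFunction D₄.diagram σ ε) {s : Fin 4 → Fin 4}
    (hs : ∀ i, σ i = s i) (h : s = ![2, 1, 0, 3] ∨ s = ![3, 1, 2, 0] ∨ s = ![2, 1, 3, 0] ∨
      s = ![3, 1, 0, 2]) :
    QDataClassification D₄.diagram σ ε (D₄.dualCoxeter (orderOf σ)) := by
  have hne : ∃ i, σ i ≠ i := ⟨0, by rw [hs]; rcases h with rfl | rfl | rfl | rfl <;> decide⟩
  have h2 : s ∘ s = id → orderOf σ = 2 := fun h => orderOf_cases Nat.prime_two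
    (fun i => by rw [pow_two, Equiv.Perm.mul_apply, hs, hs]; exact congrFun h i) hne
  have h3 : s ∘ s ∘ s = id → orderOf σ = 3 := fun h => orderOf_cases Nat.prime_three
    (fun i => by rw [pow_succ, pow_two, Equiv.Perm.mul_apply, Equiv.Perm.mul_apply, hs, hs, hs]
                 exact congrFun h i) hne
  rcases h with rfl | rfl | rfl | rfl
  · have hord := h2 (by decide)
    rw [hord]
    exact classification_of_runValues (diagram_adj_iff D₄) hs hσ (.inr Nat.prime_two)
      (by norm_num) hord hε (δ := ![26, 48, 30, 32]) (by decide) (by decide +kernel)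
      (by decide +kernel) (depth := ![0, 1, 0, 2]) (depth' := ![0, 1, 2, 2])
      (by decide +kernel) (by decide +kernel) (c := 4) (m := 4) rfl
      (t := [0, 1, 3]) (by decide +kernel) (by decide +kernel) (s' := id)
      (by decide +kernel) (by decide +kernel)
  · have hord := h2 (by decide)
    rw [hord]
    exact classification_of_runValues (diagram_adj_iff D₄) hs hσ (.inr Nat.prime_two)
      (by norm_num) hord hε (δ := ![26, 48, 30, 32]) (by decide) (by decide +kernel)
      (by decide +kernel) (depth := ![0, 1, 2, 0]) (depth' := ![0, 1, 2, 2])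
      (by decide +kernel) (by decide +kernel) (c := 4) (m := 4) rfl
      (t := [0, 1, 2]) (by decide +kernel) (by decide +kernel) (s' := id)
      (by decide +kernel) (by decide +kernel)
  · have hord := h3 (by decide)
    rw [hord]
    exact classification_of_runValues (diagram_adj_iff D₄) hs hσ (.inr Nat.prime_three)
      (by norm_num) hord hε (δ := ![26, 48, 30, 32]) (by decide) (by decide +kernel)
      (by decide +kernel) (depth := ![0, 1, 0, 0]) (depth' := ![0, 1, 2, 2])
      (by decide +kernel) (by decide +kernel) (c := 4) (m := 6) rfl
      (t := [0, 1]) (by decide +kernel) (by decide +kernel) (s' := id)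
      (by decide +kernel) (by decide +kernel)
  · have hord := h3 (by decide)
    rw [hord]
    exact classification_of_runValues (diagram_adj_iff D₄) hs hσ (.inr Nat.prime_three)
      (by norm_num) hord hε (δ := ![26, 48, 30, 32]) (by decide) (by decide +kernel)
      (by decide +kernel) (depth := ![0, 1, 0, 0]) (depth' := ![0, 1, 2, 2])
      (by decide +kernel) (by decide +kernel) (c := 4) (m := 6) rfl
      (t := [0, 1]) (by decide +kernel) (by decide +kernel) (s' := id)
      (by decide +kernel) (by decide +kernel)

end QData

namespace QData

/-! ### Chains of vertices acting by permutations of weights -/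

section Chain

variable {n : ℕ} {Γ : SimpleGraph (Fin n)} {K : ℕ} {e : ℕ → Fin n → ℤ}

variable (Γ) in
/-- The vectors `e₀, …, e_K` behave, with respect to the vertices `0, …, K - 1`, like the weights of
the vector representation in type `A`. -/
structure IsChainFrame (K : ℕ) (e : ℕ → Fin n → ℤ) : Prop where
  root : ∀ i : Fin n, (i : ℕ) < K → simpleRoot Γ i = e i - e (i + 1)
  coord : ∀ (i : Fin n) (a : ℕ), (i : ℕ) < K →
    e a i = (if (i : ℕ) = a then 1 else 0) - if (i : ℕ) + 1 = a then 1 else 0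

theorem IsChainFrame.reflection (h : IsChainFrame Γ K e) {i : Fin n} (hi : (i : ℕ) < K) (a : ℕ) :
    simpleReflection Γ i (e a) =
      if a = i then e (i + 1) else if a = i + 1 then e i else e a := by
  rw [simpleReflection_apply, h.coord i a hi, h.root i hi]
  by_cases h1 : (i : ℕ) = a
  · subst h1; simp
  · by_cases h2 : (i : ℕ) + 1 = a
    · subst h2; simp
    · rw [if_neg h1, if_neg h2, if_neg (Ne.symm h1), if_neg (Ne.symm h2)]; simp

theorem take_succ_finRange {k : ℕ} (hk : k < n) :
    (List.finRange n).take (k + 1) = (List.finRange n).take k ++ [⟨k, hk⟩] := by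
  rw [← List.take_append_getElem (by simpa using hk)]
  simp

theorem mem_take_finRange {k : ℕ} (hk : k ≤ n) (i : Fin n) :
    i ∈ (List.finRange n).take k ↔ (i : ℕ) < k := by
  induction k with
  | zero => simp
  | succ k ih =>
    rw [take_succ_finRange hk, List.mem_append, ih (by omega), List.mem_singleton, Fin.ext_iff]
    dsimp only
    omega

theorem pairwise_lt_take_finRange (k : ℕ) :
    ((List.finRange n).take k).Pairwise (· < ·) :=
  (List.pairwise_lt_finRange n).sublist (List.take_sublist _ _)

/-- A product of adjacent transpositions is a cycle. It follows that the root at place k of the word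
(0, 1, …) is e_0 - e_{k+1}, which is all that positivity checks need. -/
theorem IsChainFrame.wordProd_take (h : IsChainFrame Γ K e) {k : ℕ} (hk : k ≤ K) (hn : k ≤ n)
    (a : ℕ) : wordProd Γ ((List.finRange n).take k) (e a) =
      if a < k then e (a + 1) else if a = k then e 0 else e a := by
  induction k generalizing a with
  | zero =>
    rw [List.take_zero, wordProd_nil]
    split_ifs with h1 h2
    · omega
    · rw [h2]; rfl
    · rfl
  | succ k ih =>
    rw [take_succ_finRange hn, wordProd_append, wordProd_cons, wordProd_nil, mul_one,
      LinearEquiv.mul_apply, h.reflection (i := ⟨k, hn⟩) hk]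
    dsimp only
    by_cases h1 : a = k
    · subst h1
      rw [if_pos rfl, ih (by omega) (by omega), if_neg (by omega), if_neg (by omega),
        if_pos (by omega)]
    · rw [if_neg h1]
      by_cases h2 : a = k + 1
      · subst h2
        rw [if_pos rfl, ih (by omega) (by omega), if_neg (by omega), if_pos rfl,
          if_neg (by omega), if_pos rfl]
      · rw [if_neg h2, ih (by omega) (by omega)]
        by_cases h3 : a < k
        · rw [if_pos h3, if_pos (by omega)]
        · rw [if_neg h3, if_neg h1, if_neg (by omega), if_neg h2]

theorem IsChainFrame.wordProd_take_simpleRoot (h : IsChainFrame Γ K e) {k : Fin n}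
    (hk : (k : ℕ) < K) : wordProd Γ ((List.finRange n).take k) (simpleRoot Γ k) =
      e 0 - e (k + 1) := by
  rw [h.root k hk, map_sub, h.wordProd_take hk.le k.2.le, h.wordProd_take hk.le k.2.le,
    if_neg (lt_irrefl _), if_pos rfl, if_neg (by omega), if_neg (by omega)]

variable {E : (Fin n → ℤ) →ₗ[ℤ] ℤ}

theorem posAlong_take_finRange {g : (Fin n → ℤ) ≃ₗ[ℤ] (Fin n → ℤ)} {k : ℕ} (hk : k ≤ n)
    (h : ∀ i : Fin n, (i : ℕ) < k →
      0 < E (g (wordProd Γ ((List.finRange n).take i) (simpleRoot Γ i)))) :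
    PosAlong Γ E g ((List.finRange n).take k) := by
  induction k with
  | zero => rw [List.take_zero]; trivial
  | succ k ih =>
    rw [take_succ_finRange hk, posAlong_append]
    exact ⟨ih (by omega) fun i hi => h i (by omega), h ⟨k, hk⟩ (by simp), trivial⟩

theorem sum_mul_ite_eq (f : ℕ → ℤ) (a : ℕ) :
    ∑ j : Fin n, f j * (if (j : ℕ) = a then 1 else 0) = if a < n then f a else 0 := by
  split_ifs with h
  · rw [Finset.sum_eq_single ⟨a, h⟩]
    · simp
    · intro j _ hj
      rw [if_neg fun h' => hj (Fin.ext h'), mul_zero]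
    · simp
  · refine Finset.sum_eq_zero fun j _ => ?_
    rw [if_neg (by have := j.2; omega), mul_zero]

end Chain

/-! ### Type A: the staircase word -/

section TypeA

variable {n : ℕ} {Γ : SimpleGraph (Fin n)}

/-- The weights of the vector representation in type `A`. -/
def weightA (n : ℕ) (a : ℕ) (j : Fin n) : ℤ :=
  (if (j : ℕ) = a then 1 else 0) - if (j : ℕ) + 1 = a then 1 else 0

variable (hA : ∀ i j : Fin n, Γ.Adj i j ↔ (i : ℕ) + 1 = j ∨ (j : ℕ) + 1 = i)

include hA in
theorem isChainFrame_weightA : IsChainFrame Γ n (weightA n) where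
  root i _ := by
    funext j
    simp only [simpleRoot, hA, Fin.ext_iff, Pi.sub_apply, weightA]
    split_ifs <;> omega
  coord _ _ _ := rfl

/-- The sum of the positive coroots in type `A`. -/
def heightFormA (n : ℕ) : (Fin n → ℤ) →ₗ[ℤ] ℤ :=
  weightForm fun j => ((j : ℕ) + 1 : ℤ) * (n - (j : ℕ))

theorem sum_mul_weightA (f : ℕ → ℤ) (a : ℕ) :
    ∑ j : Fin n, f j * weightA n a j =
      (if a < n then f a else 0) - if a ≠ 0 ∧ a ≤ n then f (a - 1) else 0 := by
  simp only [weightA, mul_sub, Finset.sum_sub_distrib, sum_mul_ite_eq]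
  congr 1
  rcases a with - | a
  · rw [Finset.sum_eq_zero fun j _ => by rw [if_neg (by omega), mul_zero], if_neg (by simp)]
  · simp only [Nat.add_right_cancel_iff, sum_mul_ite_eq, ne_eq, Nat.add_eq_zero_iff, one_ne_zero,
      and_false, not_false_eq_true, true_and, Nat.add_sub_cancel, Nat.succ_le_iff]

theorem heightFormA_weightA {a : ℕ} (ha : a ≤ n) : heightFormA n (weightA n a) = n - 2 * a := by
  rw [heightFormA, weightForm_apply, sum_mul_weightA fun j => ((j : ℤ) + 1) * (n - j)]
  rcases a with - | a
  · split_ifs <;> omega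
  · rw [if_pos (show a + 1 ≠ 0 ∧ a + 1 ≤ n from ⟨Nat.succ_ne_zero a, ha⟩), Nat.add_sub_cancel]
    split_ifs with h
    · push_cast; ring
    · obtain rfl : n = a + 1 := by omega
      push_cast; ring

include hA in
theorem heightFormA_simpleRoot (i : Fin n) : heightFormA n (simpleRoot Γ i) = 2 := by
  rw [(isChainFrame_weightA hA).root i i.2, map_sub, heightFormA_weightA i.2.le,
    heightFormA_weightA i.2]
  push_cast; ring

include hA in
theorem isFiniteType_of_adjA : IsFiniteType Γ := by
  refine isFiniteType_of_weightForm (δ := fun j => ((j : ℕ) + 1 : ℤ) * (n - (j : ℕ)))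
    (fun i => ?_) fun i => ?_
  · have := i.2
    exact mul_pos (by omega) (by omega)
  · have := heightFormA_simpleRoot hA i
    rw [heightFormA] at this
    rw [this]
    norm_num

/-- The lexicographically first reduced word for the longest element in type `A`. -/
def staircaseWord (n m : ℕ) : List (Fin n) :=
  (List.range m).flatMap fun b => (List.finRange n).take (n - b)

theorem staircaseWord_succ (m : ℕ) :
    staircaseWord n (m + 1) = staircaseWord n m ++ (List.finRange n).take (n - m) := by
  simp [staircaseWord, List.range_succ]

include hA in
theorem wordProd_staircaseWord {m : ℕ} (hm : m ≤ n) {a : ℕ} (ha : a ≤ n) :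
    wordProd Γ (staircaseWord n m) (weightA n a) =
      weightA n (if a + m ≤ n then a + m else n - a) := by
  have hF := isChainFrame_weightA hA
  induction m generalizing a with
  | zero => simp [staircaseWord, ha]
  | succ m ih =>
    rw [staircaseWord_succ, wordProd_append, LinearEquiv.mul_apply,
      hF.wordProd_take (Nat.sub_le _ _) (Nat.sub_le _ _)]
    split_ifs with h1 h2 h3 h4 h5
    · rw [ih (by omega) (by omega), if_pos (by omega)]
      congr 1; omega
    · omega
    · omega
    · rw [ih (by omega) (by omega), if_pos (by omega)]
      congr 1; omega
    · omega
    · rw [ih (by omega) ha, if_neg (by omega)]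

-- The letter i of block m has the root ε_m - ε_{m+i+1}, and the form decreases along the weights
-- ε_a.
include hA in
theorem posAlong_staircaseWord {m : ℕ} (hm : m ≤ n) :
    PosAlong Γ (heightFormA n) 1 (staircaseWord n m) := by
  have hF := isChainFrame_weightA hA
  induction m with
  | zero => trivial
  | succ m ih =>
    rw [staircaseWord_succ, posAlong_append]
    refine ⟨ih (by omega), posAlong_take_finRange (Nat.sub_le _ _) fun i hi => ?_⟩
    rw [hF.wordProd_take_simpleRoot i.2, one_mul, map_sub, map_sub,
      wordProd_staircaseWord hA (by omega) (by omega),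
      wordProd_staircaseWord hA (by omega) (by omega), if_pos (by omega), if_pos (by omega),
      heightFormA_weightA (by omega), heightFormA_weightA (by omega)]
    push_cast; omega

include hA in
theorem isReducedWord_staircaseWord :
    HasLongest Γ ∧ IsReducedWord Γ (staircaseWord n n) (longestElement Γ) ∧
      ∀ i, starInvolution Γ i = i.rev := by
  have hF := isChainFrame_weightA hA
  refine isReducedWord_of_posAlong (isFiniteType_of_adjA hA) (E := heightFormA n)
    (fun i => by rw [heightFormA_simpleRoot hA]; norm_num) (posAlong_staircaseWord hA le_rfl)
    fun i => ?_
  have := i.2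
  rw [hF.root i i.2, hF.root _ i.rev.2, map_sub, wordProd_staircaseWord hA le_rfl (by omega),
    wordProd_staircaseWord hA le_rfl (by omega), neg_sub, Fin.val_rev]
  congr 2
  · split_ifs <;> omega
  · split_ifs <;> omega

-- The heights -i belong to the linear orientation, and vertex i occurs in block b exactly when b <
-- n - i. A word that is not an iterate is used because h^∨ = n + 1 can be odd.
include hA in
theorem adapted_staircaseWord {m : ℕ} (hm : m ≤ n) :
    Adapted Γ (1 : Equiv.Perm (Fin n)) (fun i => -(i : ℕ)) (staircaseWord n m) ∧
      ∀ i, heightAfter (1 : Equiv.Perm (Fin n)) (fun i => -(i : ℕ)) (staircaseWord n m) i =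
        -(i : ℕ) - 2 * min (m : ℤ) (n - (i : ℕ)) := by
  induction m with
  | zero =>
    refine ⟨trivial, fun i => ?_⟩
    have := i.2
    rw [staircaseWord, List.range_zero, List.flatMap_nil, heightAfter_nil]
    push_cast
    rw [min_eq_left (by omega)]
    ring
  | succ m ih =>
    obtain ⟨h1, h2⟩ := ih (by omega)
    rw [staircaseWord_succ, adapted_append, heightAfter_append]
    have hn : ((List.finRange n).take (n - m)).Nodup :=
      (List.nodup_finRange n).sublist (List.take_sublist _ _)
    have hmem := mem_take_finRange (n := n) (Nat.sub_le n m)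
    refine ⟨⟨h1, adapted_of_pairwise hn ?_ ?_⟩, fun i => ?_⟩
    · refine (pairwise_lt_take_finRange (n - m)).imp_of_mem fun {i j} hi hj hij hadj => ?_
      rw [hmem] at hi hj
      rw [hA] at hadj
      rw [h2, h2, orbitSize_one]
      rw [Fin.lt_def] at hij
      push_cast
      omega
    · intro i hi j hj hij
      rw [hmem] at hi hj
      rw [hA] at hij
      rw [h2, h2]
      omega
    · have hi := i.2
      by_cases h : i ∈ (List.finRange n).take (n - m)
      · simp only [heightAfter, List.count_eq_one_of_mem hn h] at h2 ⊢
        rw [h2, orbitSize_one]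
        rw [hmem] at h
        push_cast
        omega
      · rw [heightAfter_of_notMem _ h, h2]
        rw [hmem] at h
        push_cast
        omega

end TypeA

end QData

namespace QData

/-! ### Type A: automorphisms, the identity and the flip -/

section TypeA

variable {n : ℕ} {Γ : SimpleGraph (Fin n)} {σ : Equiv.Perm (Fin n)}
  (hA : ∀ i j : Fin n, Γ.Adj i j ↔ (i : ℕ) + 1 = j ∨ (j : ℕ) + 1 = i)

include hA in
/-- The automorphisms of the diagram in type `A`. -/
theorem eq_one_or_rev_of_adjA (hσ : ∀ i j, Γ.Adj (σ i) (σ j) ↔ Γ.Adj i j) :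
    σ = 1 ∨ ∀ i, σ i = i.rev := by
  rcases Nat.lt_or_ge n 2 with hn | hn
  · left
    ext i
    have h1 := i.2
    have h2 := (σ i).2
    rw [Equiv.Perm.one_apply]
    omega
  have hadj : ∀ (i : ℕ) (h : i + 1 < n), ((σ ⟨i, by omega⟩ : Fin n) : ℕ) + 1 = σ ⟨i + 1, h⟩ ∨
      ((σ ⟨i + 1, h⟩ : Fin n) : ℕ) + 1 = σ ⟨i, by omega⟩ := fun i h =>
    (hA _ _).1 ((hσ _ _).2 ((hA _ _).2 (.inl rfl)))
  have hne : ∀ (i : ℕ) (h : i + 2 < n), ((σ ⟨i, by omega⟩ : Fin n) : ℕ) ≠ σ ⟨i + 1 + 1, h⟩ := by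
    intro i h h'
    have := σ.injective (Fin.ext h')
    rw [Fin.mk.injEq] at this
    omega
  -- Consecutive values of σ differ by 1 and cannot turn back, by injectivity; so σ has constant
  -- slope 1 or -1.
  have hstep : ∀ (i : ℕ) (h : i + 1 < n), ((σ ⟨i + 1, h⟩ : Fin n) : ℤ) - σ ⟨i, by omega⟩ =
      (σ ⟨1, by omega⟩ : Fin n) - (σ ⟨0, by omega⟩ : Fin n) := by
    intro i h
    induction i with
    | zero => rfl
    | succ i ih =>
      have h1 := ih (by omega)
      have h2 := hadj i (by omega)
      have h3 := hadj (i + 1) h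
      have h4 := hne i h
      omega
  have hval : ∀ (i : ℕ) (h : i < n), ((σ ⟨i, h⟩ : Fin n) : ℤ) = (σ ⟨0, by omega⟩ : Fin n) +
      i * ((σ ⟨1, by omega⟩ : Fin n) - (σ ⟨0, by omega⟩ : Fin n)) := by
    intro i h
    induction i with
    | zero => simp
    | succ i ih =>
      have h1 := ih (by omega)
      have h2 := hstep i h
      push_cast
      linarith
  have hlast := hval (n - 1) (by omega)
  have h0 := (σ ⟨0, by omega⟩).2
  have h1 := (σ ⟨n - 1, by omega⟩).2
  have hd01 := hadj 0 (by omega)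
  simp only [zero_add] at hd01
  rcases hd01 with hd | hd
  · left
    have hd' : ((σ ⟨1, by omega⟩ : Fin n) : ℤ) - (σ ⟨0, by omega⟩ : Fin n) = 1 := by omega
    ext i
    have h2 : ((σ i : Fin n) : ℤ) = _ := hval i i.2
    rw [hd'] at h2 hlast
    rw [Equiv.Perm.one_apply]
    omega
  · right
    have hd' : ((σ ⟨1, by omega⟩ : Fin n) : ℤ) - (σ ⟨0, by omega⟩ : Fin n) = -1 := by omega
    intro i
    have h2 : ((σ i : Fin n) : ℤ) = _ := hval i i.2
    rw [hd'] at h2 hlast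
    have := i.2
    rw [Fin.ext_iff, Fin.val_rev]
    omega

include hA in
theorem nonempty_rootedFolding_adjA :
    Nonempty (RootedFolding Γ (1 : Equiv.Perm (Fin n))) := by
  refine ⟨.ofPow (.inl orderOf_one) (fun i => i) (fun i => rfl) (fun i j hij => ?_)
    (fun i hi => ?_) (fun i j hi hj => ?_) (fun i j _ _ _ => rfl) fun i j j' hij hij' hj hj' => ?_⟩
  · rw [hA] at hij; omega
  · exact ⟨⟨i - 1, by omega⟩, (hA _ _).2 (.inr (by dsimp only; omega)), by dsimp only; omega⟩
  · left; ext; omega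
  · left; ext; omega

include hA in
theorem qDataClassification_adjA_one (hn : 1 ≤ n) {ε : Fin n → ℤ} (hε : IsParityFunction Γ 1 ε) :
    QDataClassification Γ 1 ε (n + 1) := by
  have : NeZero n := ⟨by omega⟩
  obtain ⟨hL, hw, hstar⟩ := isReducedWord_staircaseWord hA
  obtain ⟨F⟩ := nonempty_rootedFolding_adjA hA
  obtain ⟨h1, h2⟩ := adapted_staircaseWord hA le_rfl
  refine classification_of_isGood (fun i j => Iff.rfl) (fun i => .inl (orbitSize_one i)) F
    (isFiniteType_of_adjA hA) hL F.preconnected hε (isCut_one_iff.2 fun i j hij => ?_)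
    ⟨_, ⟨hw, h1⟩, fun i => ?_⟩ (fun h => (h rfl).elim) fun h => (h rfl).elim
  · rw [hA] at hij
    rw [abs_eq one_pos.le]
    omega
  -- Both sides are equal to i - 2n.
  · have := i.2
    rw [h2, hstar, orderOf_one, Fin.val_rev]
    push_cast
    omega

section Flip

variable {q : ℕ} (hn : n = 2 * q + 1) (hs : ∀ i, σ i = i.rev)

include hA hs in
theorem adj_iff_of_rev (i j : Fin n) : Γ.Adj (σ i) (σ j) ↔ Γ.Adj i j := by
  rw [hA, hA, hs, hs, Fin.val_rev, Fin.val_rev]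
  omega

include hs in
theorem permWeight_weightA {a : ℕ} (ha : a ≤ n) :
    permWeight σ (weightA n a) = -weightA n (n - a) := by
  funext j
  have h1 : σ⁻¹ j = j.rev := by rw [Equiv.Perm.inv_eq_iff_eq, hs, Fin.rev_rev]
  have := j.2
  simp only [permWeight_apply, h1, Pi.neg_apply, weightA, Fin.val_rev]
  split_ifs <;> omega

-- The twisted Coxeter element runs through ε_0, -ε_n, ε_1, -ε_{n-1}, …, ε_q, -ε_0, closing up to
-- sign after n steps, and negates the remaining weight ε_{q+1}. Since n is odd, its n-th power is
-- -1.
include hA hn hs in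
theorem twistedProd_weightA {a : ℕ} (ha : a ≤ n) :
    twistedProd Γ σ ((List.finRange n).take (q + 1)) (weightA n a) =
      if a < q then -weightA n (n - a) else if a = q then -weightA n 0 else
        -weightA n (n + 1 - a) := by
  rw [twistedProd, LinearEquiv.mul_apply, permWeight_weightA hs ha, map_neg,
    (isChainFrame_weightA hA).wordProd_take (by omega) (by omega)]
  split_ifs <;> first | omega | rfl | skip
  rw [Nat.sub_add_comm ha]

include hA hn hs in
theorem twistedProd_pow_weightA_even {a : ℕ} (ha : a ≤ q) :
    (twistedProd Γ σ ((List.finRange n).take (q + 1)) ^ (2 * a)) (weightA n 0) = weightA n a := by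
  induction a with
  | zero => rfl
  | succ a ih =>
    rw [Nat.mul_succ, pow_succ', pow_succ', LinearEquiv.mul_apply, LinearEquiv.mul_apply,
      ih (by omega), twistedProd_weightA hA hn hs (by omega), if_pos (by omega), map_neg,
      twistedProd_weightA hA hn hs (by omega), if_neg (by omega), if_neg (by omega), neg_neg]
    congr 1
    omega

include hA hn hs in
theorem twistedProd_pow_weightA_odd {a : ℕ} (ha : a < q) :
    (twistedProd Γ σ ((List.finRange n).take (q + 1)) ^ (2 * a + 1)) (weightA n 0) =
      -weightA n (n - a) := by
  rw [pow_succ', LinearEquiv.mul_apply, twistedProd_pow_weightA_even hA hn hs ha.le,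
    twistedProd_weightA hA hn hs (by omega), if_pos ha]

include hA hn hs in
theorem twistedProd_pow_weightA_zero :
    (twistedProd Γ σ ((List.finRange n).take (q + 1)) ^ n) (weightA n 0) = -weightA n 0 := by
  have h : twistedProd Γ σ ((List.finRange n).take (q + 1)) ^ n =
      twistedProd Γ σ ((List.finRange n).take (q + 1)) ^ (2 * q + 1) := congrArg _ hn
  rw [h, pow_succ', LinearEquiv.mul_apply, twistedProd_pow_weightA_even hA hn hs le_rfl,
    twistedProd_weightA hA hn hs (by omega), if_neg (lt_irrefl _), if_pos rfl]

include hA hn hs in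
theorem twistedProd_pow_weightA_middle (b : ℕ) :
    (twistedProd Γ σ ((List.finRange n).take (q + 1)) ^ b) (weightA n (q + 1)) =
      (-1 : ℤ) ^ b • weightA n (q + 1) := by
  induction b with
  | zero => simp
  | succ b ih =>
    rw [pow_succ', LinearEquiv.mul_apply, ih, map_smul, twistedProd_weightA hA hn hs (by omega),
      if_neg (by omega), if_neg (by omega), show n + 1 - (q + 1) = q + 1 by omega, pow_succ,
      mul_smul, neg_one_smul]

include hA hn hs in
theorem twistedProd_pow_weightA {a : ℕ} (ha : a ≤ n) :
    (twistedProd Γ σ ((List.finRange n).take (q + 1)) ^ n) (weightA n a) = -weightA n a := by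
  have key : ∀ b, (twistedProd Γ σ ((List.finRange n).take (q + 1)) ^ n)
      ((twistedProd Γ σ ((List.finRange n).take (q + 1)) ^ b) (weightA n 0)) =
      -(twistedProd Γ σ ((List.finRange n).take (q + 1)) ^ b) (weightA n 0) := by
    intro b
    rw [← LinearEquiv.mul_apply, ← pow_add, add_comm n b, pow_add, LinearEquiv.mul_apply,
      twistedProd_pow_weightA_zero hA hn hs, map_neg]
  rcases lt_trichotomy a (q + 1) with h | rfl | h
  · rw [← twistedProd_pow_weightA_even hA hn hs (a := a) (by omega)]
    exact key _
  · rw [twistedProd_pow_weightA_middle hA hn hs, Odd.neg_one_pow ⟨q, hn⟩, neg_one_smul]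
  · have h1 := twistedProd_pow_weightA_odd hA hn hs (a := n - a) (by omega)
    rw [show n - (n - a) = a by omega] at h1
    have h2 := key (2 * (n - a) + 1)
    rw [h1, map_neg] at h2
    exact neg_injective h2

-- The form decreases slowly and stays positive along this orbit; after n steps the sign changes and
-- the same values recur negated.
include hA hn hs in
theorem heightFormA_twistedProd_pow {b : ℕ} (hb : b < n) :
    heightFormA n ((twistedProd Γ σ ((List.finRange n).take (q + 1)) ^ b) (weightA n 0)) =
      n - 2 * (b / 2 : ℕ) := by
  rcases Nat.even_or_odd' b with ⟨a, rfl | rfl⟩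
  · rw [twistedProd_pow_weightA_even hA hn hs (by omega), heightFormA_weightA (by omega)]
    omega
  · rw [twistedProd_pow_weightA_odd hA hn hs (by omega), map_neg, heightFormA_weightA (by omega)]
    omega

-- For i < q the root compares the orbit of ε_0 at times b and b + 2(i + 1): either the form has
-- strictly decreased, or the sign has changed. For i = q the second weight is ±ε_{q+1}, on which
-- the form is ±1.
include hA hn hs in
theorem posAlong_twistedProd_pow {b : ℕ} (hb : b < n) :
    PosAlong Γ (heightFormA n) (twistedProd Γ σ ((List.finRange n).take (q + 1)) ^ b)
      ((List.finRange n).take (q + 1)) := by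
  refine posAlong_take_finRange (by omega) fun i hi => ?_
  rw [(isChainFrame_weightA hA).wordProd_take_simpleRoot i.2, map_sub, map_sub,
    heightFormA_twistedProd_pow hA hn hs hb]
  rcases Nat.lt_or_ge i q with h | h
  · rw [← twistedProd_pow_weightA_even hA hn hs (a := i + 1) h, ← LinearEquiv.mul_apply, ← pow_add]
    rcases Nat.lt_or_ge (b + 2 * ((i : ℕ) + 1)) n with h' | h'
    · rw [heightFormA_twistedProd_pow hA hn hs h']
      omega
    · obtain ⟨k, hk⟩ := Nat.exists_eq_add_of_le' h'
      rw [hk, pow_add, LinearEquiv.mul_apply, twistedProd_pow_weightA_zero hA hn hs, map_neg,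
        map_neg, heightFormA_twistedProd_pow hA hn hs (by omega)]
      omega
  · have hiq : (i : ℕ) = q := by omega
    rw [hiq, twistedProd_pow_weightA_middle hA hn hs, map_smul, heightFormA_weightA (by omega)]
    rcases Nat.even_or_odd b with hb' | hb'
    · rw [hb'.neg_one_pow, one_smul]
      obtain ⟨k, rfl⟩ := hb'
      push_cast
      omega
    · rw [hb'.neg_one_pow, neg_one_smul]
      obtain ⟨k, rfl⟩ := hb'
      push_cast
      omega

include hA hn hs in
theorem qDataClassification_adjA_rev (hq : 1 ≤ q) {ε : Fin n → ℤ} (hε : IsParityFunction Γ σ ε) :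
    orderOf σ = 2 ∧ QDataClassification Γ σ ε n := by
  have : NeZero n := ⟨by omega⟩
  have hord : orderOf σ = 2 := orderOf_cases Nat.prime_two
    (fun i => by rw [pow_two, Equiv.Perm.mul_apply, hs, hs, Fin.rev_rev])
    ⟨⟨0, by omega⟩, by rw [hs, ne_eq, Fin.ext_iff, Fin.val_rev]; dsimp only; omega⟩
  have hσ := adj_iff_of_rev hA hs
  have hF := isChainFrame_weightA hA
  have hΓ := isFiniteType_of_adjA hA
  obtain ⟨hL, hw, hstar⟩ := isReducedWord_iterateSequence hσ hΓ (E := heightFormA n) (m := n)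
    (t := (List.finRange n).take (q + 1)) (fun i => by rw [heightFormA_simpleRoot hA]; norm_num)
    (fun b hb => posAlong_twistedProd_pow hA hn hs hb) fun i => by
      rw [hF.root i i.2, map_sub, twistedProd_pow_weightA hA hn hs i.2.le,
        twistedProd_pow_weightA hA hn hs i.2]
      abel
  obtain ⟨F'⟩ := nonempty_rootedFolding_adjA hA
  have hp : orderOf σ = 1 ∨ (orderOf σ).Prime := .inr (by rw [hord]; exact Nat.prime_two)
  have hmem := mem_take_finRange (n := n) (k := q + 1) (by omega)
  have hsv : ∀ i, (σ i : ℕ) = n - (i + 1) := fun i => by rw [hs, Fin.val_rev]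
  refine ⟨hord, classification_of_iterateSequence hσ hΓ hL hp
    -- The depth is the distance from the nearer end of the chain, so the fixed middle vertex q is
    -- deepest.
    (.ofPow hp (fun i => min (i : ℕ) (2 * q - i)) (fun i => ?_) (fun i j hij => ?_)
      (fun i hi => ?_) (fun i j hi hj => ?_) (fun i j hij hd hj => ?_)
      fun i j j' hij hij' hj hj' => ?_)
    F'.preconnected hε (by rw [hord]) (isCoxeterSequence_of_nodup (fun i => ?_) ?_) hw hstar⟩
  · rw [hsv]; omega
  · rw [hA] at hij; omega
  · rcases Nat.lt_or_ge q i with h | h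
    · refine ⟨⟨i + 1, by omega⟩, (hA _ _).2 (.inl rfl), ?_⟩
      dsimp only; omega
    · refine ⟨⟨i - 1, by omega⟩, (hA _ _).2 (.inr ?_), ?_⟩
      · dsimp only; omega
      · dsimp only; omega
  · rw [Fin.ext_iff, Fin.ext_iff, hsv]; omega
  · rw [Fin.ext_iff, hsv] at hj ⊢
    rw [hA] at hij
    omega
  · rw [hA] at hij hij'
    simp only [Fin.ext_iff, ne_eq, hsv]
    omega
  · rcases Nat.lt_or_ge i (q + 1) with h | h
    · exact ⟨i, (hmem i).2 h, .refl _ _⟩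
    · refine ⟨σ i, (hmem _).2 (by rw [hsv]; omega), ?_⟩
      exact (sameCycle_pow 1 i).symm
  · refine (pairwise_lt_take_finRange (q + 1)).imp_of_mem fun {i j} hi hj hij => ?_
    rw [hmem] at hi hj
    rw [Fin.lt_def] at hij
    rw [sameCycle_iff_of_orderOf_le (by omega)]
    simp only [Fin.ext_iff, hsv]
    omega

end Flip

end TypeA

theorem diagram_A_adj_iff (n : ℕ) (hn : 1 ≤ n) (i j : Fin n) :
    (ADEType.A n hn).diagram.Adj i j ↔ (i : ℕ) + 1 = j ∨ (j : ℕ) + 1 = i := by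
  rw [diagram_adj_iff (.A n hn), cartanAdj, decide_eq_true_iff]
  simp only [ADEType.cartan, CartanMatrix.A, Matrix.of_apply, ne_eq, Fin.ext_iff]
  split_ifs <;> first | omega | (simp; omega)

theorem qDataClassification_A (n : ℕ) (hn : 1 ≤ n) {σ : Equiv.Perm (Fin n)}
    (hσ : ∀ i j, (ADEType.A n hn).diagram.Adj (σ i) (σ j) ↔ (ADEType.A n hn).diagram.Adj i j)
    (hσ' : ∀ i, ¬ (ADEType.A n hn).diagram.Adj i (σ i))
    {ε : Fin n → ℤ} (hε : IsParityFunction (ADEType.A n hn).diagram σ ε) :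
    QDataClassification (ADEType.A n hn).diagram σ ε
      ((ADEType.A n hn).dualCoxeter (orderOf σ)) := by
  have hA := diagram_A_adj_iff n hn
  by_cases hone : σ = 1
  · subst hone
    rw [orderOf_one]
    exact qDataClassification_adjA_one hA hn hε
  have hs := (eq_one_or_rev_of_adjA hA hσ).resolve_left hone
  rcases Nat.even_or_odd' n with ⟨q, hq | hq⟩
  -- For even n the flip exchanges the two adjacent middle vertices, which is excluded.
  · have h1 := hσ' ⟨q, show q < n by omega⟩
    rw [hA, hs, Fin.val_rev] at h1
    dsimp only at h1
    omega
  · rcases Nat.eq_zero_or_pos q with hq0 | hq0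
    · refine (hone (Equiv.ext fun i => Fin.ext ?_)).elim
      have h1 : (i : ℕ) < n := i.2
      have h2 : (σ i : ℕ) < n := (σ i).2
      rw [Equiv.Perm.one_apply]
      omega
    · obtain ⟨h1, h2⟩ := qDataClassification_adjA_rev hA hq hs hq0 hε
      rw [h1]
      exact h2

end QData

namespace QData

/-! ### Maps that cycle a family of vectors with one change of sign -/

section NegacyclicMap

variable {M : Type*} [AddCommGroup M] {τ : M ≃ₗ[ℤ] M} {e : ℕ → M} {N : ℕ}
  (h1 : ∀ a, a + 1 < N → τ (e a) = e (a + 1)) (h2 : ∀ a, a + 1 = N → τ (e a) = -e 0)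

include h1 in
theorem negacyclic_pow_zero {b : ℕ} (hb : b < N) : (τ ^ b) (e 0) = e b := by
  induction b with
  | zero => rfl
  | succ b ih => rw [pow_succ', LinearEquiv.mul_apply, ih (by omega), h1 b hb]

include h1 h2 in
theorem negacyclic_pow_card (hN : 0 < N) : (τ ^ N) (e 0) = -e 0 := by
  obtain ⟨m, rfl⟩ := Nat.exists_eq_add_of_le' hN
  rw [pow_succ', LinearEquiv.mul_apply, negacyclic_pow_zero h1 (by omega), h2 _ rfl]

include h1 h2 in
theorem negacyclic_pow {a : ℕ} (ha : a < N) : (τ ^ N) (e a) = -e a := by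
  rw [← negacyclic_pow_zero h1 ha, ← LinearEquiv.mul_apply, ← pow_add, add_comm, pow_add,
    LinearEquiv.mul_apply, negacyclic_pow_card h1 h2 (by omega), map_neg]

-- The vector is e_b - e_{b+a}, or e_b + e_{b+a-N} once the index has wrapped around. The values of
-- E strictly decrease and stay nonnegative, so E is positive in both cases.
include h1 h2 in
theorem negacyclic_pos {E : M →ₗ[ℤ] ℤ} {c : ℤ} (hc : (N : ℤ) ≤ c + 1)
    (hE : ∀ a, a < N → E (e a) = 4 * (c - a)) {b a : ℕ} (hb : b < N) (ha : a < N) (ha0 : 0 < a) :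
    0 < E ((τ ^ b) (e 0 - e a)) := by
  rw [map_sub, map_sub, negacyclic_pow_zero h1 hb, hE b hb, ← negacyclic_pow_zero h1 ha,
    ← LinearEquiv.mul_apply, ← pow_add]
  rcases Nat.lt_or_ge (b + a) N with h | h
  · rw [negacyclic_pow_zero h1 h, hE _ h]
    push_cast; omega
  · obtain ⟨k, hk⟩ := Nat.exists_eq_add_of_le' h
    rw [hk, pow_add, LinearEquiv.mul_apply, negacyclic_pow_card h1 h2 (by omega), map_neg, map_neg,
      negacyclic_pow_zero h1 (by omega), hE _ (by omega)]
    omega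

end NegacyclicMap

/-! ### Type D: the identity and the exchange of the last two vertices -/

section TypeD

variable {n : ℕ} {Γ : SimpleGraph (Fin n)} {σ : Equiv.Perm (Fin n)}

/-- The weights of the vector representation in type `D`. -/
def weightD (n : ℕ) (a : ℕ) (j : Fin n) : ℤ :=
  weightA n a j + if (j : ℕ) + 1 = n ∧ a + 2 = n then 1 else 0

variable (hn : 4 ≤ n) (hD : ∀ i j : Fin n, Γ.Adj i j ↔ ((i : ℕ) + 1 = j ∧ (j : ℕ) + 1 < n) ∨
    ((j : ℕ) + 1 = i ∧ (i : ℕ) + 1 < n) ∨ ((i : ℕ) + 3 = n ∧ (j : ℕ) + 1 = n) ∨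
    ((j : ℕ) + 3 = n ∧ (i : ℕ) + 1 = n))

-- The vertices 0, …, n - 2 form a chain as in type A; the last simple root, ε_{n-2} + ε_{n-1}, is
-- treated separately.
include hn hD in
theorem isChainFrame_weightD : IsChainFrame Γ (n - 1) (weightD n) where
  root i hi := by
    funext j
    have := j.2
    simp only [simpleRoot, hD, Fin.ext_iff, Pi.sub_apply, weightD, weightA]
    split_ifs <;> omega
  coord i a hi := by
    simp only [weightD, weightA]
    rw [if_neg (c := (i : ℕ) + 1 = n ∧ a + 2 = n) (by omega), add_zero]

include hn hD in
theorem simpleRoot_last {i : Fin n} (hi : (i : ℕ) + 1 = n) :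
    simpleRoot Γ i = weightD n (n - 2) + weightD n (n - 1) := by
  funext j
  have := j.2
  simp only [simpleRoot, hD, Fin.ext_iff, Pi.add_apply, weightD, weightA]
  split_ifs <;> omega

include hn hD in
theorem simpleReflection_last {i : Fin n} (hi : (i : ℕ) + 1 = n) {a : ℕ} (ha : a < n) :
    simpleReflection Γ i (weightD n a) =
      if a + 2 = n then -weightD n (n - 1) else if a + 1 = n then -weightD n (n - 2)
        else weightD n a := by
  have h1 : weightD n a i = if a + 2 = n ∨ a + 1 = n then 1 else 0 := by
    simp only [weightD, weightA]
    split_ifs <;> omega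
  rw [simpleReflection_apply, h1, simpleRoot_last hn hD hi]
  by_cases h2 : a + 2 = n
  · rw [if_pos (.inl h2), if_pos h2, one_smul, show a = n - 2 by omega]
    abel
  · by_cases h3 : a + 1 = n
    · rw [if_pos (.inr h3), if_neg h2, if_pos h3, one_smul, show a = n - 1 by omega]
      abel
    · rw [if_neg (by omega), if_neg h2, if_neg h3, zero_smul, sub_zero]

/-- Twice the sum of the positive coroots in type `D`. -/
def coheightD (n j : ℕ) : ℤ :=
  if j + 2 < n then 2 * (j + 1) * (2 * n - 2 - j) else n * (n - 1)

theorem weightForm_weightD (hn : 4 ≤ n) {a : ℕ} (ha : a < n) :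
    weightForm (fun j : Fin n => coheightD n j) (weightD n a) = 4 * ((n : ℤ) - 1 - a) := by
  have h1 : ∑ j : Fin n, coheightD n j * (if (j : ℕ) + 1 = n ∧ a + 2 = n then 1 else 0) =
      if a + 2 = n then coheightD n (n - 1) else 0 := by
    by_cases h : a + 2 = n
    · rw [if_pos h, ← if_pos (c := n - 1 < n) (t := coheightD n (n - 1)) (e := 0) (by omega),
        ← sum_mul_ite_eq]
      refine Finset.sum_congr rfl fun j _ => ?_
      congr 1
      refine if_congr ?_ rfl rfl
      omega
    · rw [if_neg h]
      exact Finset.sum_eq_zero fun j _ => by rw [if_neg fun h' => h h'.2, mul_zero]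
  rw [weightForm_apply]
  simp only [weightD, mul_add, Finset.sum_add_distrib]
  rw [h1, sum_mul_weightA (fun j => coheightD n j), if_pos ha]
  rcases a with - | a
  · rw [if_neg (by simp), if_neg (by omega), coheightD, if_pos (by omega)]
    push_cast; ring
  · rw [if_pos ⟨Nat.succ_ne_zero a, ha.le⟩, Nat.add_sub_cancel]
    rcases Nat.lt_trichotomy (a + 3) n with h | h | h
    · rw [if_neg (by omega), coheightD, coheightD, if_pos (by omega), if_pos (by omega)]
      push_cast; ring
    · rw [if_pos (by omega), coheightD, coheightD, coheightD, if_neg (by omega), if_pos (by omega),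
        if_neg (by omega), ← h]
      push_cast; ring
    · obtain rfl : n = a + 2 := by omega
      rw [if_neg (by omega), coheightD, coheightD, if_neg (by omega), if_neg (by omega)]
      push_cast; ring

include hn hD in
theorem weightForm_simpleRoot_pos (i : Fin n) :
    0 < weightForm (fun j : Fin n => coheightD n j) (simpleRoot Γ i) := by
  have hi := i.2
  rcases Nat.lt_or_ge i (n - 1) with h | h
  · rw [(isChainFrame_weightD hn hD).root i h, map_sub, weightForm_weightD hn (by omega),
      weightForm_weightD hn (by omega)]
    push_cast; omega
  · rw [simpleRoot_last hn hD (by omega), map_add, weightForm_weightD hn (by omega),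
      weightForm_weightD hn (by omega)]
    omega

include hn hD in
theorem isFiniteType_of_adjD : IsFiniteType Γ := by
  refine isFiniteType_of_weightForm (δ := fun j => coheightD n j) (fun i => ?_)
    (weightForm_simpleRoot_pos hn hD)
  simp only [coheightD]
  have hi := i.2
  split_ifs with h
  · exact mul_pos (by omega) (by omega)
  · exact mul_pos (by omega) (by omega)

include hn hD in
theorem nonempty_rootedFolding_adjD :
    Nonempty (RootedFolding Γ (1 : Equiv.Perm (Fin n))) := by
  refine ⟨.ofPow (.inl orderOf_one) (fun i => min (i : ℕ) (n - 2)) (fun i => rfl)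
    (fun i j hij => ?_) (fun i hi => ?_) (fun i j hi hj => ?_) (fun i j _ _ _ => rfl)
    fun i j j' hij hij' hj hj' => ?_⟩
  · rw [hD] at hij; omega
  · have := i.2
    rcases Nat.lt_or_ge i (n - 1) with h | h
    · refine ⟨⟨i - 1, by omega⟩, (hD _ _).2 (.inr (.inl ⟨?_, ?_⟩)), ?_⟩ <;>
        first | omega | (dsimp only; omega)
    · refine ⟨⟨n - 3, by omega⟩, (hD _ _).2 (.inr (.inr (.inr ⟨?_, ?_⟩))), ?_⟩ <;>
        first | omega | (dsimp only; omega)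
  · left; ext; omega
  · left
    rw [hD] at hij hij'
    ext
    omega

section Identity

-- The Coxeter element is negacyclic on ε_0, …, ε_{n-2} and negates ε_{n-1}; accordingly its power n
-- - 1 = h^∨/2 gives w_0.
include hn hD in
theorem wordProd_finRange_weightD {a : ℕ} (ha : a < n) :
    wordProd Γ ((List.finRange n).take n) (weightD n a) =
      if a + 1 < n - 1 then weightD n (a + 1) else if a + 1 = n - 1 then -weightD n 0
        else -weightD n a := by
  have hF := isChainFrame_weightD hn hD
  have h1 : (List.finRange n).take n =
      (List.finRange n).take (n - 1) ++ [⟨n - 1, by omega⟩] := by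
    rw [← take_succ_finRange, Nat.sub_add_cancel (by omega)]
  rw [h1, wordProd_append, wordProd_cons, wordProd_nil, mul_one, LinearEquiv.mul_apply,
    simpleReflection_last hn hD (by dsimp only; omega) ha]
  split_ifs with h2 h3 h4 h5 h6 <;> first | omega | skip
  · rw [map_neg, hF.wordProd_take le_rfl (by omega), if_neg (by omega), if_pos rfl]
  · rw [map_neg, hF.wordProd_take le_rfl (by omega), if_pos (by omega)]
    congr 2; omega
  · rw [hF.wordProd_take le_rfl (by omega), if_pos (by omega)]

include hn hD in
theorem wordProd_finRange_pow_weightD_last (b : ℕ) :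
    (wordProd Γ ((List.finRange n).take n) ^ b) (weightD n (n - 1)) =
      (-1 : ℤ) ^ b • weightD n (n - 1) := by
  induction b with
  | zero => simp
  | succ b ih =>
    rw [pow_succ', LinearEquiv.mul_apply, ih, map_smul, wordProd_finRange_weightD hn hD (by omega),
      if_neg (by omega), if_neg (by omega), pow_succ, mul_smul, neg_one_smul]

include hn hD in
theorem posAlong_wordProd_finRange_pow {b : ℕ} (hb : b < n - 1) :
    PosAlong Γ (weightForm fun j : Fin n => coheightD n j)
      (wordProd Γ ((List.finRange n).take n) ^ b) ((List.finRange n).take n) := by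
  have hF := isChainFrame_weightD hn hD
  have h1 : ∀ a, a + 1 < n - 1 → wordProd Γ ((List.finRange n).take n) (weightD n a) =
      weightD n (a + 1) := fun a ha => by
    rw [wordProd_finRange_weightD hn hD (by omega), if_pos ha]
  have h2 : ∀ a, a + 1 = n - 1 → wordProd Γ ((List.finRange n).take n) (weightD n a) =
      -weightD n 0 := fun a ha => by
    rw [wordProd_finRange_weightD hn hD (by omega), if_neg (by omega), if_pos ha]
  have hlast : weightForm (fun j : Fin n => coheightD n j) (weightD n (n - 1)) = 0 := by
    rw [weightForm_weightD hn (by omega)]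
    omega
  refine posAlong_take_finRange le_rfl fun i _ => ?_
  have hi := i.2
  rcases Nat.lt_or_ge i (n - 1) with h | h
  · rw [hF.wordProd_take_simpleRoot h]
    rcases Nat.lt_or_ge (i + 1) (n - 1) with h' | h'
    · exact negacyclic_pos h1 h2 (c := n - 1) (by omega)
        (fun a ha => weightForm_weightD hn (by omega)) hb h' (by omega)
    · rw [map_sub, map_sub, negacyclic_pow_zero h1 hb, show (i : ℕ) + 1 = n - 1 by omega,
        wordProd_finRange_pow_weightD_last hn hD, map_smul, hlast, weightForm_weightD hn (by omega),
        smul_zero]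
      omega
  · rw [simpleRoot_last hn hD (by omega), show (i : ℕ) = n - 1 by omega, map_add,
      hF.wordProd_take le_rfl (by omega), hF.wordProd_take le_rfl (by omega), if_pos (by omega),
      if_neg (by omega), if_pos rfl, map_add, map_add, negacyclic_pow_zero h1 hb,
      show n - 2 + 1 = n - 1 by omega, wordProd_finRange_pow_weightD_last hn hD, map_smul, hlast,
      weightForm_weightD hn (by omega), smul_zero]
    omega

-- The power n - 1 negates ε_0, …, ε_{n-2} and multiplies ε_{n-1} by (-1)^{n-1}, so the parity of n
-- decides whether the last two vertices are exchanged. The condition on minima suffices, because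
-- the chosen height function does not distinguish them.
include hn hD in
theorem wordProd_finRange_pow_simpleRoot (i : Fin n) :
    ∃ j : Fin n, min (j : ℕ) (n - 2) = min (i : ℕ) (n - 2) ∧
      (wordProd Γ ((List.finRange n).take n) ^ (n - 1)) (simpleRoot Γ i) = -simpleRoot Γ j := by
  have hF := isChainFrame_weightD hn hD
  have h1 : ∀ a, a < n - 1 → (wordProd Γ ((List.finRange n).take n) ^ (n - 1)) (weightD n a) =
      -weightD n a := fun a ha => negacyclic_pow (fun a ha => by
        rw [wordProd_finRange_weightD hn hD (by omega), if_pos ha]) (fun a ha => by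
        rw [wordProd_finRange_weightD hn hD (by omega), if_neg (by omega), if_pos ha]) ha
  have h2 := wordProd_finRange_pow_weightD_last hn hD (n - 1)
  have hn2 : n - 2 < n := by omega
  have hn1 : n - 1 < n := by omega
  have hi := i.2
  have hroot : ∀ h : n - 2 < n, simpleRoot Γ ⟨n - 2, h⟩ = weightD n (n - 2) - weightD n (n - 1) :=
    fun h => by
      rw [hF.root _ (by dsimp only; omega)]
      congr 2
      dsimp only
      omega
  have hroot' : ∀ h : n - 1 < n, simpleRoot Γ ⟨n - 1, h⟩ = weightD n (n - 2) + weightD n (n - 1) :=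
    fun h => simpleRoot_last hn hD (by dsimp only; omega)
  rcases Nat.lt_or_ge i (n - 2) with h | h
  · refine ⟨i, rfl, ?_⟩
    rw [hF.root i (by omega), map_sub, h1 _ (by omega), h1 _ (by omega)]
    abel
  · have hi' : i = ⟨n - 2, hn2⟩ ∨ i = ⟨n - 1, hn1⟩ := by
      simp only [Fin.ext_iff]; omega
    rcases Nat.even_or_odd (n - 1) with hpar | hpar
    · rw [hpar.neg_one_pow, one_smul] at h2
      rcases hi' with rfl | rfl
      · refine ⟨⟨n - 1, by omega⟩, by dsimp only; omega, ?_⟩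
        rw [hroot, hroot', map_sub, h1 _ (by omega), h2]
        abel
      · refine ⟨⟨n - 2, by omega⟩, by dsimp only; omega, ?_⟩
        rw [hroot, hroot', map_add, h1 _ (by omega), h2]
        abel
    · rw [hpar.neg_one_pow, neg_one_smul] at h2
      refine ⟨i, rfl, ?_⟩
      rcases hi' with rfl | rfl
      · rw [hroot, map_sub, h1 _ (by omega), h2]
        abel
      · rw [hroot', map_add, h1 _ (by omega), h2]
        abel

include hn hD in
theorem qDataClassification_adjD_one {ε : Fin n → ℤ} (hε : IsParityFunction Γ 1 ε) :
    QDataClassification Γ 1 ε (2 * (n - 1)) := by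
  have : NeZero n := ⟨by omega⟩
  have hΓ := isFiniteType_of_adjD hn hD
  obtain ⟨F⟩ := nonempty_rootedFolding_adjD hn hD
  choose s hs1 hs2 using wordProd_finRange_pow_simpleRoot hn hD
  have hσ : ∀ i j, Γ.Adj ((1 : Equiv.Perm (Fin n)) i) ((1 : Equiv.Perm (Fin n)) j) ↔ Γ.Adj i j :=
    fun i j => Iff.rfl
  have htw : twistedProd Γ 1 ((List.finRange n).take n) = wordProd Γ ((List.finRange n).take n) := by
    rw [twistedProd, permWeight_one, mul_one]
  have hit := wordProd_iterateSequence hσ (n - 1) ((List.finRange n).take n)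
  rw [one_pow, permWeight_one, mul_one, htw] at hit
  obtain ⟨hL, hw, hstar⟩ := isReducedWord_of_posAlong hΓ (weightForm_simpleRoot_pos hn hD)
    (posAlong_iterateSequence hσ (n - 1) (t := (List.finRange n).take n) fun b hb => by
      rw [htw]; exact posAlong_wordProd_finRange_pow hn hD hb) (s := s) fun i => by
      rw [hit]; exact hs2 i
  refine classification_of_height hΓ hL F hε (ξ := fun i => -(min (i : ℕ) (n - 2) : ℕ))
    (t := (List.finRange n).take n) (fun i j hij => ?_) ?_ (fun i => ?_) ?_ hw fun i => ?_
  · rw [hD] at hij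
    rw [abs_eq one_pos.le]
    omega
  · exact (List.nodup_finRange n).sublist (List.take_sublist _ _)
  · exact (mem_take_finRange le_rfl i).2 i.2
  · refine (pairwise_lt_take_finRange n).imp fun {i j} hij hadj => ?_
    rw [hD] at hadj
    rw [Fin.lt_def] at hij
    omega
  · rw [hstar, hs1]

end Identity

section Swap

variable (hs : ∀ i, (σ i : ℕ) = if (i : ℕ) + 2 = n then n - 1 else if (i : ℕ) + 1 = n then n - 2
  else i)

include hn hs in
theorem swap_swap (i : Fin n) : σ (σ i) = i := by
  have := i.2
  rw [Fin.ext_iff, hs, hs]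
  split_ifs <;> omega

include hn hD hs in
theorem adj_iff_of_swap (i j : Fin n) : Γ.Adj (σ i) (σ j) ↔ Γ.Adj i j := by
  have := i.2
  have := j.2
  rw [hD, hD, hs, hs]
  split_ifs <;> omega

include hn hs in
theorem permWeight_weightD {a : ℕ} (ha : a < n) :
    permWeight σ (weightD n a) = if a + 1 = n then -weightD n a else weightD n a := by
  funext j
  have h1 : σ⁻¹ j = σ j := by rw [Equiv.Perm.inv_eq_iff_eq, swap_swap hn hs]
  have := j.2
  rw [permWeight_apply, h1]
  by_cases h : a + 1 = n
  · rw [if_pos h]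
    simp only [Pi.neg_apply, weightD, weightA, hs]
    split_ifs <;> omega
  · rw [if_neg h]
    simp only [weightD, weightA, hs]
    split_ifs <;> omega

-- On the weights, σ only changes the sign of ε_{n-1}. The twisted Coxeter element is therefore
-- negacyclic on all n weights, and its n-th power is -1.
include hn hD hs in
theorem twistedProd_weightD {a : ℕ} (ha : a < n) :
    twistedProd Γ σ ((List.finRange n).take (n - 1)) (weightD n a) =
      if a + 1 = n then -weightD n 0 else weightD n (a + 1) := by
  have hF := isChainFrame_weightD hn hD
  rw [twistedProd, LinearEquiv.mul_apply, permWeight_weightD hn hs ha]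
  split_ifs with h
  · rw [map_neg, hF.wordProd_take le_rfl (by omega), if_neg (by omega), if_pos (by omega)]
  · rw [hF.wordProd_take le_rfl (by omega), if_pos (by omega)]

include hn hD hs in
theorem qDataClassification_adjD_swap {ε : Fin n → ℤ} (hε : IsParityFunction Γ σ ε) :
    orderOf σ = 2 ∧ QDataClassification Γ σ ε n := by
  have : NeZero n := ⟨by omega⟩
  have hord : orderOf σ = 2 := orderOf_cases Nat.prime_two
    (fun i => by rw [pow_two, Equiv.Perm.mul_apply, swap_swap hn hs])
    ⟨⟨n - 2, by omega⟩, by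
      rw [ne_eq, Fin.ext_iff, hs, if_pos (by dsimp only; omega)]; dsimp only; omega⟩
  have hσ := adj_iff_of_swap hn hD hs
  have hF := isChainFrame_weightD hn hD
  have hΓ := isFiniteType_of_adjD hn hD
  have h1 : ∀ a, a + 1 < n → twistedProd Γ σ ((List.finRange n).take (n - 1)) (weightD n a) =
      weightD n (a + 1) := fun a ha => by
    rw [twistedProd_weightD hn hD hs (by omega), if_neg (by omega)]
  have h2 : ∀ a, a + 1 = n → twistedProd Γ σ ((List.finRange n).take (n - 1)) (weightD n a) =
      -weightD n 0 := fun a ha => by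
    rw [twistedProd_weightD hn hD hs (by omega), if_pos (by omega)]
  obtain ⟨hL, hw, hstar⟩ := isReducedWord_iterateSequence hσ hΓ (m := n)
    (E := weightForm fun j : Fin n => coheightD n j)
    (t := (List.finRange n).take (n - 1)) (weightForm_simpleRoot_pos hn hD)
    (fun b hb => posAlong_take_finRange (by omega) fun i hi => by
      rw [hF.wordProd_take_simpleRoot hi]
      exact negacyclic_pos h1 h2 (c := n - 1) (by omega)
        (fun a ha => weightForm_weightD hn (by omega)) hb (by omega) (by omega)) fun i => by
      have hi := i.2
      rcases Nat.lt_or_ge i (n - 1) with h | h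
      · rw [hF.root i h, map_sub, negacyclic_pow h1 h2 (by omega), negacyclic_pow h1 h2 (by omega)]
        abel
      · rw [simpleRoot_last hn hD (by omega), map_add, negacyclic_pow h1 h2 (by omega),
          negacyclic_pow h1 h2 (by omega)]
        abel
  obtain ⟨F'⟩ := nonempty_rootedFolding_adjD hn hD
  have hp : orderOf σ = 1 ∨ (orderOf σ).Prime := .inr (by rw [hord]; exact Nat.prime_two)
  have hmem := mem_take_finRange (n := n) (k := n - 1) (by omega)
  refine ⟨hord, classification_of_iterateSequence hσ hΓ hL hp
    -- Truncated subtraction puts both exchanged vertices at depth 0, so the root is the orbit of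
    -- size two.
    (.ofPow hp (fun i => n - 2 - (i : ℕ)) (fun i => ?_) (fun i j hij => ?_)
      (fun i hi => ?_) (fun i j hi hj => ?_) (fun i j hij hd hj => ?_)
      fun i j j' hij hij' hj hj' => ?_)
    F'.preconnected hε (by rw [hord]) (isCoxeterSequence_of_nodup (fun i => ?_) ?_) hw hstar⟩
  · rw [hs]; split_ifs <;> omega
  · rw [hD] at hij; omega
  · refine ⟨⟨i + 1, by omega⟩, (hD _ _).2 (.inl ⟨rfl, ?_⟩), ?_⟩ <;> dsimp only <;> omega
  · have := i.2
    have := j.2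
    rw [Fin.ext_iff, Fin.ext_iff, hs]
    split_ifs <;> omega
  · rw [Fin.ext_iff, hs] at hj ⊢
    rw [hD] at hij
    split_ifs at hj ⊢ <;> omega
  · rw [hD] at hij hij'
    simp only [Fin.ext_iff, ne_eq, hs]
    split_ifs <;> omega
  · have := i.2
    rcases Nat.lt_or_ge i (n - 1) with h | h
    · exact ⟨i, (hmem i).2 h, .refl _ _⟩
    · refine ⟨σ i, (hmem _).2 (by rw [hs]; split_ifs <;> omega), ?_⟩
      exact (sameCycle_pow 1 i).symm
  · refine (pairwise_lt_take_finRange (n - 1)).imp_of_mem fun {i j} hi hj hij => ?_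
    rw [hmem] at hi hj
    rw [Fin.lt_def] at hij
    rw [sameCycle_iff_of_orderOf_le (by omega), swap_swap hn hs]
    simp only [Fin.ext_iff, hs]
    split_ifs <;> omega

end Swap

end TypeD

end QData

namespace QData

/-! ### Type D: diagram automorphisms and the classification -/

section TypeD

/-- Adjacency in the diagram of type `D` with `n` vertices. -/
def AdjD (n x y : ℕ) : Prop :=
  (x + 1 = y ∧ y + 1 < n) ∨ (y + 1 = x ∧ x + 1 < n) ∨ (x + 3 = n ∧ y + 1 = n) ∨
    (y + 3 = n ∧ x + 1 = n)

theorem AdjD.eq_branch {n x y z w : ℕ} (h1 : AdjD n x y) (h2 : AdjD n x z) (h3 : AdjD n x w)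
    (h12 : y ≠ z) (h13 : y ≠ w) (h23 : z ≠ w) : x + 3 = n := by
  rcases h1 with h1 | h1 | h1 | h1 <;> rcases h2 with h2 | h2 | h2 | h2 <;> first | omega | skip
  all_goals rcases h3 with h3 | h3 | h3 | h3 <;> omega

theorem AdjD.eq_next {n x y z : ℕ} (hx : x + 3 = n) (h1 : AdjD n x y) (h2 : AdjD n y z)
    (h : z ≠ x) : y + 4 = n := by
  rcases h1 with h1 | h1 | h1 | h1 <;> rcases h2 with h2 | h2 | h2 | h2 <;> omega

theorem AdjD.eq_prev {n x y : ℕ} (h : AdjD n x y) (hy : y + 4 ≤ n) (hx : x ≠ y + 1) :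
    x + 1 = y := by
  rcases h with h | h | h | h <;> omega

theorem AdjD.eq_leaf {n x y : ℕ} (h : AdjD n x y) (hx : x + 3 = n) (hy : y + 4 ≠ n) :
    y + 2 = n ∨ y + 1 = n := by
  rcases h with h | h | h | h <;> omega

variable {n : ℕ} {Γ : SimpleGraph (Fin n)} {σ : Equiv.Perm (Fin n)}
  (hD : ∀ i j : Fin n, Γ.Adj i j ↔ ((i : ℕ) + 1 = j ∧ (j : ℕ) + 1 < n) ∨
    ((j : ℕ) + 1 = i ∧ (i : ℕ) + 1 < n) ∨ ((i : ℕ) + 3 = n ∧ (j : ℕ) + 1 = n) ∨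
    ((j : ℕ) + 3 = n ∧ (i : ℕ) + 1 = n))

include hD in
/-- The automorphisms of the diagram in type `D`, with at least five vertices. -/
theorem eq_one_or_swap_of_adjD (hn : 5 ≤ n) (hσ : ∀ i j, Γ.Adj (σ i) (σ j) ↔ Γ.Adj i j) :
    σ = 1 ∨ ∀ i, (σ i : ℕ) = if (i : ℕ) + 2 = n then n - 1 else
      if (i : ℕ) + 1 = n then n - 2 else i := by
  have hadj : ∀ i j, Γ.Adj i j → AdjD n (σ i) (σ j) := fun i j h => (hD _ _).1 ((hσ _ _).2 h)
  have hne : ∀ i j : Fin n, (i : ℕ) ≠ j → (σ i : ℕ) ≠ σ j := fun i j h h' =>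
    h (congrArg Fin.val (σ.injective (Fin.ext h')))
  obtain ⟨a, ha⟩ : ∃ a : Fin n, (a : ℕ) + 5 = n := ⟨⟨n - 5, by omega⟩, by dsimp only; omega⟩
  obtain ⟨b, hb⟩ : ∃ b : Fin n, (b : ℕ) + 4 = n := ⟨⟨n - 4, by omega⟩, by dsimp only; omega⟩
  obtain ⟨c, hc⟩ : ∃ c : Fin n, (c : ℕ) + 3 = n := ⟨⟨n - 3, by omega⟩, by dsimp only; omega⟩
  obtain ⟨p, hp⟩ : ∃ p : Fin n, (p : ℕ) + 2 = n := ⟨⟨n - 2, by omega⟩, by dsimp only; omega⟩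
  obtain ⟨l, hl⟩ : ∃ l : Fin n, (l : ℕ) + 1 = n := ⟨⟨n - 1, by omega⟩, by dsimp only; omega⟩
  have hcb := hadj c b ((hD _ _).2 (by omega))
  have hcp := hadj c p ((hD _ _).2 (by omega))
  have hcl := hadj c l ((hD _ _).2 (by omega))
  have hba := hadj b a ((hD _ _).2 (by omega))
  have hbp' := hne b p (by omega)
  have hbl' := hne b l (by omega)
  have hpl' := hne p l (by omega)
  have hac' := hne a c (by omega)
  -- The vertex n - 3 is the only one with three neighbours, hence is fixed. Of these neighbours
  -- only n - 4 has a further neighbour, so it is fixed as well.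
  have hσc := hcb.eq_branch hcp hcl hbp' hbl' hpl'
  have hσb := AdjD.eq_next hσc hcb hba hac'
  have hσp := hcp.eq_leaf hσc (by omega)
  have hσl := hcl.eq_leaf hσc (by omega)
  -- Induction along the long arm away from the branch vertex: with two consecutive vertices fixed,
  -- the next one has only one possible image.
  have key : ∀ k : ℕ, ∀ i j : Fin n, (i : ℕ) + k + 4 = n → (j : ℕ) = i + 1 →
      (σ i : ℕ) = i ∧ (σ j : ℕ) = j := by
    intro k
    induction k with
    | zero =>
      intro i j hi hj
      obtain rfl : i = b := Fin.ext (by omega)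
      obtain rfl : j = c := Fin.ext (by omega)
      omega
    | succ k ih =>
      intro i j hi hj
      obtain ⟨h1, h2⟩ := ih j ⟨j + 1, by omega⟩ (by omega) rfl
      have h3 := hadj i j ((hD _ _).2 (by omega))
      have h4 := hne i ⟨j + 1, by omega⟩ (by dsimp only; omega)
      rw [h2] at h4
      rw [h1] at h3
      have hle : (j : ℕ) + 4 ≤ n := by clear * - hi hj; omega
      have h5 := h3.eq_prev hle h4
      exact ⟨Nat.add_right_cancel (h5.trans hj), h1⟩
  have hlow : ∀ i : Fin n, (i : ℕ) + 3 ≤ n → (σ i : ℕ) = i := by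
    intro i hi
    rcases hi.eq_or_lt with h | h
    · obtain rfl : i = c := Fin.ext (by omega)
      omega
    · exact (key (n - 4 - i) i ⟨i + 1, by omega⟩ (by omega) rfl).1
  have hσpl : (σ p : ℕ) = n - 2 ∧ (σ l : ℕ) = n - 1 ∨ (σ p : ℕ) = n - 1 ∧ (σ l : ℕ) = n - 2 := by
    omega
  clear hσp hσl hbp' hbl' hpl' hac'
  have hcase : ∀ i : Fin n, (i : ℕ) + 3 ≤ n ∨ i = p ∨ i = l := by
    intro i
    simp only [Fin.ext_iff]
    omega
  rcases hσpl with ⟨h1, h2⟩ | ⟨h1, h2⟩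
  · left
    ext i
    rw [Equiv.Perm.one_apply]
    rcases hcase i with h | rfl | rfl
    · exact hlow i h
    · rw [h1]; clear * - hp; omega
    · rw [h2]; clear * - hl; omega
  · right
    intro i
    rcases hcase i with h | rfl | rfl
    · have h3 : (i : ℕ) + 2 ≠ n ∧ (i : ℕ) + 1 ≠ n := by clear * - h; omega
      rw [hlow i h, if_neg h3.1, if_neg h3.2]
    · rw [h1, if_pos hp]
    · have h3 : (i : ℕ) + 2 ≠ n := by clear * - hl; omega
      rw [h2, if_neg h3, if_pos hl]

end TypeD

theorem diagram_D_adj_iff (n : ℕ) (hn : 4 ≤ n) (i j : Fin n) :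
    (ADEType.D n hn).diagram.Adj i j ↔ ((i : ℕ) + 1 = j ∧ (j : ℕ) + 1 < n) ∨
      ((j : ℕ) + 1 = i ∧ (i : ℕ) + 1 < n) ∨ ((i : ℕ) + 3 = n ∧ (j : ℕ) + 1 = n) ∨
      ((j : ℕ) + 3 = n ∧ (i : ℕ) + 1 = n) := by
  rw [diagram_adj_iff (.D n hn), cartanAdj, decide_eq_true_iff]
  simp only [ADEType.cartan, CartanMatrix.D, Matrix.of_apply, ne_eq, Fin.ext_iff]
  have := i.2
  have := j.2
  split_ifs <;> first | omega | (simp; omega)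

theorem qDataClassification_D (n : ℕ) (hn : 4 ≤ n) {σ : Equiv.Perm (Fin n)}
    (hσ : ∀ i j, (ADEType.D n hn).diagram.Adj (σ i) (σ j) ↔ (ADEType.D n hn).diagram.Adj i j)
    {ε : Fin n → ℤ} (hε : IsParityFunction (ADEType.D n hn).diagram σ ε) :
    QDataClassification (ADEType.D n hn).diagram σ ε
      ((ADEType.D n hn).dualCoxeter (orderOf σ)) := by
  have hD := diagram_D_adj_iff n hn
  have hone : σ = 1 → QDataClassification (ADEType.D n hn).diagram σ ε
      ((ADEType.D n hn).dualCoxeter (orderOf σ)) := by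
    rintro rfl
    rw [orderOf_one]
    have := qDataClassification_adjD_one hn hD hε
    rwa [show 2 * (n - 1) = 2 * n - 2 by omega] at this
  have hswap : (∀ i, (σ i : ℕ) = if (i : ℕ) + 2 = n then n - 1 else
      if (i : ℕ) + 1 = n then n - 2 else i) → QDataClassification (ADEType.D n hn).diagram σ ε
      ((ADEType.D n hn).dualCoxeter (orderOf σ)) := by
    intro hs
    obtain ⟨h1, h2⟩ := qDataClassification_adjD_swap hn hD hs hε
    rw [h1]
    exact h2
  rcases hn.eq_or_lt with rfl | hn5
  · have hadj := cartanAdj_map (X := D₄) hσ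
    have hne : ∀ i j, i ≠ j → σ i ≠ σ j := fun i j h => σ.injective.ne h
    have hcases := eq_of_adj_D₄ (σ 1) (σ 0) (hadj _ _ (by decide))
      (σ 2) (hadj _ _ (by decide)) (hne _ _ (by decide))
      (σ 3) (hadj _ _ (by decide)) (hne _ _ (by decide)) (hne _ _ (by decide))
    obtain ⟨h1, h⟩ := hcases
    rcases h with ⟨h0, h2, h3⟩ | ⟨h0, h2, h3⟩ | ⟨h0, h2, h3⟩ | ⟨h0, h2, h3⟩ | ⟨h0, h2, h3⟩ |
      ⟨h0, h2, h3⟩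
    · exact hone (Equiv.ext fun i => by fin_cases i <;> assumption)
    · refine hswap fun i => ?_
      fin_cases i
      · exact congrArg Fin.val h0
      · exact congrArg Fin.val h1
      · exact congrArg Fin.val h2
      · exact congrArg Fin.val h3
    · exact qDataClassification_D₄_of_eq hσ hε (s := ![2, 1, 0, 3])
        (fun i => by fin_cases i <;> assumption) (.inl rfl)
    · exact qDataClassification_D₄_of_eq hσ hε (s := ![3, 1, 2, 0])
        (fun i => by fin_cases i <;> assumption) (.inr (.inl rfl))
    · exact qDataClassification_D₄_of_eq hσ hε (s := ![2, 1, 3, 0])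
        (fun i => by fin_cases i <;> assumption) (.inr (.inr (.inl rfl)))
    · exact qDataClassification_D₄_of_eq hσ hε (s := ![3, 1, 0, 2])
        (fun i => by fin_cases i <;> assumption) (.inr (.inr (.inr rfl)))
  · rcases eq_one_or_swap_of_adjD hD hn5 hσ with h | h
    · exact hone h
    · exact hswap h

end QData

theorem mainTheorem4 (X : ADEType) (σ : Equiv.Perm (Fin X.rank))
    (hσ : ∀ i j, X.diagram.Adj (σ i) (σ j) ↔ X.diagram.Adj i j)
    (hσ' : ∀ i, ¬ X.diagram.Adj i (σ i))
    (ε : Fin X.rank → ℤ) (hε : IsParityFunction X.diagram σ ε) :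
    (∀ Q : QDatum X.diagram σ ε,
      (∃ w, IsReducedWord X.diagram w (longestElement X.diagram) ∧
        Q.adaptedClass = commClass X.diagram w) ∧
      ∃ φ : Q.arVertices (X.dualCoxeter (orderOf σ)) ≃ positiveRoots X.diagram,
        ∀ w ∈ Q.adaptedClass, ∀ ψ, Q.IsARIso _ w ψ ↔ ψ = φ) ∧
    ∃ P : Set (Set (List (Fin X.rank))),
      (∀ P', IsAdaptedClusterPoint X.diagram σ (X.dualCoxeter (orderOf σ)) P' ↔ P' = P) ∧
      Set.BijOn (QDatum.classMap X.diagram σ ε) Set.univ P := by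
  have h : QDataClassification X.diagram σ ε (X.dualCoxeter (orderOf σ)) := by
    cases X with
    | A n hn => exact qDataClassification_A n hn hσ hσ' hε
    | D n hn => exact qDataClassification_D n hn hσ hε
    | E₆ => exact qDataClassification_E₆ hσ hε
    | E₇ => exact qDataClassification_E₇ hσ hε
    | E₈ => exact qDataClassification_E₈ hσ hε
  exact h
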